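/- **Setting.** Let $N\ge 2$, let $p_1,\dots,p_N\in\mathbb R^{N-1}$ satisfy $|p_i-p_j|=1$ for $i\ne j$, and put $F_i(x)=\frac12x+\frac12p_i$, $V_0=\{p_1,\dots,p_N\}$, $V_{m}=\bigcup_{i}F_i(V_{m-1})$ for $m\ge 1$. Let $V=\overline{\bigcup_m V_m}$ be the Sierpinski gasket. For $x,y\in V_m$ write $x\sim_m y$ if some cell $F_{w_1}\circ\dots\circ F_{w_m}(V)$, $w\in\{1,\dots,N\}^m$, contains both $x$ and $y$. For $u\in C(V)$ let $$W_m(u)=\tfrac12\Big(\tfrac{N+2}{N}\Big)^m\sum_{x,y\in V_m,\ x\sim_m y}(u(x)-u(y))^2,\qquad W(u)=\lim_{m\to\infty}W_m(u)\in[0,\infty]$$ (the sequence is increasing), and $H^1(V)=\{u\in C(V): W(u)<\infty\}$. Let $\mu$ be a finite Borel measure on $V$ such that every nonempty relatively open subset of $V$ has positive measure and $\mu(V_0)=0$. For $B=(B_1,\dots,B_N)$ with $B_i:\mathbb R\to[0,\infty]$ define $W_B:L^2_\mu(V)\to[0,\infty]$ by $W_B(u)=W(u)+\sum_{i=1}^N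 B_i(u(p_i))$ if $u\in H^1(V)$ and $W_B(u)=\infty$ otherwise. Let $W_{0}$ be the energy with all $B_i=0$ and $W_\infty$ the energy with $B_i(0)=0$, $B_i(s)=\infty$ for $s\ne0$. A strongly continuous semigroup $S=(S(t))_{t\ge0}$ of (possibly nonlinear) contractions on $L^2_\mu(V)$ is *generated* by an energy $\tilde W:L^2_\mu(V)\to[0,\infty]$ if for every $u_0\in L^2_\mu(V)$ the function $u(t)=S(t)u_0$ belongs to $C([0,\infty);L^2_\mu(V))\cap H^1_{loc}((0,\infty);L^2_\mu(V))$ and satisfies $u(0)=u_0$ and $\dot u+\partial\tilde W(u)\ni0$ almost everywhere on $(0,\infty)$, where $\partial\tilde W(u)=\{f:\tilde W(u+v)-\tilde W(u)\ge\langle f,v\rangle_{L^2_\mu}\ \forall v\}$ for $\tilde W(u)<\infty$, and $\partial\tilde W(u)=\emptyset$ otherwise. $S$ is *positive* if $S(t)u\ge0$ whenever $t\ge 0$, $u\ge0$, and *order preserving* if $S(t)u\le S(t)v$ whenever $t\ge 0$, $u\le v$. $S_1\preccurlyeq S_2$ means that $S_2$ is order preserving and $|S_1(t)u|\le S_2(t)v$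 whenever $t\ge 0$, $|u|\le v$; and $S_1\stackrel{t}{\preccurlyeq}S_2$ means $S_1\preccurlyeq S_2$ and $S_1\preccurlyeq -S_2(-\,\cdot\,)$. **Corollary 4.1.** Let $B_1,\dots,B_N:\mathbb R\to[0,\infty]$ be lower semicontinuous, bi-monotone (decreasing on $(-\infty,0]$ and increasing on $[0,\infty)$) and normalised ($B_i(0)=0$), and assume that $W_B$ is convex. Then each of $W_B$, $W_0$ and $W_\infty$ generates a unique strongly continuous semigroup of contractions on $L^2_\mu(V)$, denoted by $S_B$, $S$ and $S_\infty$, respectively; $S_B$ is positive and order preserving, and $$S_\infty\stackrel{t}{\preccurlyeq}S_B\stackrel{t}{\preccurlyeq}S .$$ -/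

import Mathlib

open MeasureTheory Filter Topology
open scoped NNReal ENNReal

noncomputable section

namespace Sierpinski

/-! ### The Sierpinski gasket -/

section Gasket

variable {E : Type*} [NormedAddCommGroup E] [NormedSpace ℝ E] {N : ℕ}

/-- The similarity `F_i(x) = x/2 + p_i/2`. -/
def similarity (p : Fin N → E) (i : Fin N) (x : E) : E :=
  (1 / 2 : ℝ) • x + (1 / 2 : ℝ) • p i

/-- `F_w = F_{w_1} ∘ ⋯ ∘ F_{w_m}` for a word `w = (w_1, …, w_m)`. -/
def wordMap (p : Fin N → E) : List (Fin N) → E → E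
  | [] => id
  | i :: w => similarity p i ∘ wordMap p w

open Classical in
/-- The vertex sets: `V_0 = {p_1, …, p_N}` and `V_{m+1} = ⋃ i, F_i(V_m)`. -/
def levelSet (p : Fin N → E) : ℕ → Finset E
  | 0 => Finset.univ.image p
  | m + 1 => Finset.univ.biUnion fun i => (levelSet p m).image (similarity p i)

/-- The Sierpinski gasket `V`, the closure of `V_* = ⋃ m, V_m`. -/
def gasket (p : Fin N → E) : Set E :=
  closure (⋃ m, (levelSet p m : Set E))

theorem levelSet_subset_gasket (p : Fin N → E) (m : ℕ) :
    (levelSet p m : Set E) ⊆ gasket p :=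
  (Set.subset_iUnion (fun m => (levelSet p m : Set E)) m).trans subset_closure

/-- The boundary vertex `p_i`, as a point of the gasket. -/
def vertex (p : Fin N → E) (i : Fin N) : gasket p :=
  ⟨p i, levelSet_subset_gasket p 0 (by simp [levelSet])⟩

/-- The intrinsic boundary `V_0`, as a subset of the gasket. -/
def boundary (p : Fin N → E) : Set (gasket p) :=
  Set.range (vertex p)

/-- `x ∼_m y`: some cell `F_w(V)` of level `m` contains both `x` and `y`. -/
def SameCell (p : Fin N → E) (m : ℕ) (x y : E) : Prop :=
  ∃ w : List (Fin N), w.length = m ∧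
    x ∈ wordMap p w '' gasket p ∧ y ∈ wordMap p w '' gasket p

open Classical in
/-- The vertices of level `m`, as points of the gasket. -/
def gasketLevel (p : Fin N → E) (m : ℕ) : Finset (gasket p) :=
  (levelSet p m).subtype (· ∈ gasket p)

open Classical in
/-- The `m`-energy `W_m(u)`; the sum is over ordered pairs `(x, y)` with `x ∼_m y`. -/
def levelEnergy (p : Fin N → E) (m : ℕ) (u : gasket p → ℝ) : ℝ :=
  1 / 2 * (((N : ℝ) + 2) / N) ^ m *
    ∑ x ∈ gasketLevel p m, ∑ y ∈ gasketLevel p m,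
      if SameCell p m x y then (u x - u y) ^ 2 else 0

/-- The energy `W(u) = lim_m W_m(u) ∈ [0, ∞]`. -/
def energy (p : Fin N → E) (u : gasket p → ℝ) : ℝ≥0∞ :=
  limUnder atTop fun m => ENNReal.ofReal (levelEnergy p m u)

/-- The space `H¹(V)` of continuous functions of finite energy. -/
def H1 (p : Fin N → E) : Set C(gasket p, ℝ) :=
  {u | energy p u < ⊤}

variable [MeasurableSpace E]

open Classical in
/-- The perturbed energy `W_B : L²_μ(V) → [0, ∞]`. A class `u` belongs to `H¹(V)` if it has a
representative there; the representative is unique if nonempty open sets have positive measure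
(see `perturbedEnergy_eq`). -/
def perturbedEnergy (p : Fin N → E) (μ : Measure (gasket p)) (B : Fin N → ℝ → ℝ≥0∞)
    (u : Lp ℝ 2 μ) : ℝ≥0∞ :=
  if h : ∃ g : C(gasket p, ℝ), g ∈ H1 p ∧ u =ᵐ[μ] g then
    energy p h.choose + ∑ i, B i (h.choose (vertex p i))
  else ⊤

theorem perturbedEnergy_eq (p : Fin N → E) (μ : Measure (gasket p)) [μ.IsOpenPosMeasure]
    (B : Fin N → ℝ → ℝ≥0∞) (u : Lp ℝ 2 μ) (g : C(gasket p, ℝ)) (hg : g ∈ H1 p)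
    (hu : u =ᵐ[μ] g) :
    perturbedEnergy p μ B u = energy p g + ∑ i, B i (g (vertex p i)) := by
  have h : ∃ g : C(gasket p, ℝ), g ∈ H1 p ∧ u =ᵐ[μ] g := ⟨g, hg, hu⟩
  have hc : h.choose = g := by
    apply DFunLike.coe_injective
    exact (Continuous.ae_eq_iff_eq μ h.choose.continuous g.continuous).1
      (h.choose_spec.2.symm.trans hu)
  unfold perturbedEnergy
  rw [dif_pos h, hc]

/-- The free (Neumann) energy: `W` on `H¹(V)`, extended to `L²_μ(V)` by `∞`. -/
def neumannEnergy (p : Fin N → E) (μ : Measure (gasket p)) : Lp ℝ 2 μ → ℝ≥0∞ :=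
  perturbedEnergy p μ fun _ _ => 0

open Classical in
/-- The Dirichlet energy `W_∞`: here `B_i(s) = ∞` for `s ≠ 0` and `B_i(0) = 0`. -/
def dirichletEnergy (p : Fin N → E) (μ : Measure (gasket p)) : Lp ℝ 2 μ → ℝ≥0∞ :=
  perturbedEnergy p μ fun _ s => if s = 0 then 0 else ⊤

end Gasket

/-- `f` is decreasing on `(-∞, 0]` and increasing on `[0, ∞)`. -/
def BiMonotone (f : ℝ → ℝ≥0∞) : Prop :=
  AntitoneOn f (Set.Iic 0) ∧ MonotoneOn f (Set.Ici 0)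

/-! ### Semigroups generated by convex energies -/

section Semigroup

variable {H : Type*} [NormedAddCommGroup H] [InnerProductSpace ℝ H]

/-- The subgradient `∂W(u) = {f | W(u + v) - W(u) ≥ ⟨f, v⟩ for all v}` at `u ∈ dom W`;
it is empty if `u ∉ dom W`. -/
def subgradient (W : H → ℝ≥0∞) (u : H) : Set H :=
  {f | W u < ⊤ ∧ ∀ v : H, (W u : EReal) + ((inner ℝ f v : ℝ) : EReal) ≤ (W (u + v) : EReal)}

/-- `u ∈ C([0, ∞); H) ∩ H¹_loc((0, ∞); H)`, with derivative `g`, solves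
`u' + ∂W(u) ∋ 0` almost everywhere on `(0, ∞)` and `u(0) = u₀`. -/
def IsStrongSolution (W : H → ℝ≥0∞) (u₀ : H) (u : ℝ≥0 → H) : Prop :=
  Continuous u ∧ u 0 = u₀ ∧
  ∃ g : ℝ → H,
    (∀ a b : ℝ≥0, 0 < a → a ≤ b →
      MemLp g 2 (volume.restrict (Set.Icc (a : ℝ) b)) ∧
      u b - u a = ∫ τ in (a : ℝ)..b, g τ) ∧
    ∀ᵐ τ ∂(volume.restrict (Set.Ioi (0 : ℝ))), -g τ ∈ subgradient W (u τ.toNNReal)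

/-- A strongly continuous semigroup of (possibly nonlinear) contractions on `H`. -/
@[ext]
structure ContractionSemigroup (H : Type*) [NormedAddCommGroup H] where
  toFun : ℝ≥0 → H → H
  map_zero' : ∀ u, toFun 0 u = u
  map_add' : ∀ s t u, toFun (s + t) u = toFun s (toFun t u)
  continuous' : ∀ u, Continuous fun t => toFun t u
  contraction' : ∀ t u v, ‖toFun t u - toFun t v‖ ≤ ‖u - v‖

instance (H : Type*) [NormedAddCommGroup H] :
    CoeFun (ContractionSemigroup H) fun _ => ℝ≥0 → H → H :=
  ⟨ContractionSemigroup.toFun⟩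

/-- The semigroup `S` on the whole space `H` is generated by the energy `W`: each orbit
`t ↦ S(t)u₀` is a strong solution of `u' + ∂W(u) ∋ 0`, `u(0) = u₀`. -/
def Generates (W : H → ℝ≥0∞) (S : ContractionSemigroup H) : Prop :=
  ∀ u₀ : H, IsStrongSolution W u₀ fun t => S t u₀

end Semigroup

/-! ### Order properties of families of operators on `L²` -/

section Order

variable {X : Type*} [MeasurableSpace X] {μ : Measure X}

def IsPositive (S : ℝ≥0 → Lp ℝ 2 μ → Lp ℝ 2 μ) : Prop :=
  ∀ t u, 0 ≤ u → 0 ≤ S t u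

def OrderPreserving (S : ℝ≥0 → Lp ℝ 2 μ → Lp ℝ 2 μ) : Prop :=
  ∀ t u v, u ≤ v → S t u ≤ S t v

/-- `S₁ ≼ S₂`. -/
def DominatedBy (S₁ S₂ : ℝ≥0 → Lp ℝ 2 μ → Lp ℝ 2 μ) : Prop :=
  OrderPreserving S₂ ∧ ∀ t u v, |u| ≤ v → |S₁ t u| ≤ S₂ t v

/-- `S₁ ≼ᵗ S₂`, that is, `S₁ ≼ S₂` and `S₁ ≼ -S₂(-·)`. -/
def TotallyDominatedBy (S₁ S₂ : ℝ≥0 → Lp ℝ 2 μ → Lp ℝ 2 μ) : Prop :=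
  DominatedBy S₁ S₂ ∧ DominatedBy S₁ fun t u => -S₂ t (-u)

end Order

end Sierpinski

end

/-! The proof has an abstract half about convex energies on a Hilbert space and a concrete half
about the gasket; they meet in `IsConvexEnergy`.

Abstractly, a convex, lower semicontinuous energy with dense domain has nonexpansive resolvents.
Implicit Euler schemes with dyadic step sizes converge, because two half steps stay close to one
full step (`norm_iterate_half_sub_sq_le`). The limit `flow` inherits the evolution variational
inequality (`norm_flow_sub_sq_le`). This inequality yields finite energy at positive times,
difference quotients bounded in L², hence an a.e. derivative, and, by differentiating it, the
subgradient inclusion (`isStrongSolution_flow`). Monotonicity of subgradients gives uniqueness, so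
every generated semigroup equals `flow`.

Order properties are proved for resolvents and pass to the limit. If replacing the minimisers (a, b)
by another pair raises neither the total energy nor the total squared distance to the data, then
nothing has changed (`IsProx.eq_of_exchange`). Exchanging (a, b) for (a ⊓ b, a ⊔ b) gives order
preservation. Exchanging it for a clipped to [-b, b] and |a| ⊔ b gives domination. Both exchanges
decrease sums of squared increments, hence `W`, so only the boundary functionals remain to be
compared. The second half of total domination is the first half for the reflected energies u ↦
W(-u).

Concretely, convexity of the free and Dirichlet energies is direct. Lower semicontinuity rests on
the decay of oscillation on small cells: bounded energy gives equicontinuity, so L² convergence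
improves to pointwise convergence, even at the μ-null vertices. For density, harmonic extension is
constructed, piecewise harmonic splines approximate continuous functions uniformly, and a cut-off
makes them vanish on V₀ at no cost in L², since μ(V₀) = 0. -/

noncomputable section

namespace Sierpinski

/-! ### Proximal points of convex energies -/

section Prox

variable {H : Type*} [NormedAddCommGroup H] [InnerProductSpace ℝ H] {W : H → ℝ≥0∞}

/-- A convex, lower semicontinuous and densely defined energy. -/
structure IsConvexEnergy (W : H → ℝ≥0∞) : Prop where
  convex : ConvexOn ℝ≥0 Set.univ W
  lsc : LowerSemicontinuous W
  dense : Dense {u | W u ≠ ⊤}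

theorem IsConvexEnergy.segment (hW : IsConvexEnergy W) {u v : H} (hu : W u ≠ ⊤) (hv : W v ≠ ⊤)
    {θ : ℝ} (h0 : 0 ≤ θ) (h1 : θ ≤ 1) :
    W ((1 - θ) • u + θ • v) ≠ ⊤ ∧
      (W ((1 - θ) • u + θ • v)).toReal ≤ (1 - θ) * (W u).toReal + θ * (W v).toReal := by
  have h := hW.convex.2 (Set.mem_univ u) (Set.mem_univ v)
    (zero_le (a := (1 - θ).toNNReal)) (zero_le (a := θ.toNNReal)) (by
      rw [← Real.toNNReal_add (by linarith) h0]; simp)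
  have e1 : ((1 - θ).toNNReal : ℝ≥0) • u = (1 - θ) • u := by
    rw [NNReal.smul_def, Real.coe_toNNReal _ (by linarith)]
  have e2 : (θ.toNNReal : ℝ≥0) • v = θ • v := by
    rw [NNReal.smul_def, Real.coe_toNNReal _ h0]
  rw [e1, e2] at h
  have hfin : ((1 - θ).toNNReal • W u + θ.toNNReal • W v) ≠ ⊤ := by
    simp only [ENNReal.smul_def, smul_eq_mul]
    exact ENNReal.add_ne_top.2 ⟨ENNReal.mul_ne_top ENNReal.coe_ne_top hu,
      ENNReal.mul_ne_top ENNReal.coe_ne_top hv⟩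
  refine ⟨ne_top_of_le_ne_top hfin h, (ENNReal.toReal_mono hfin h).trans_eq ?_⟩
  simp only [ENNReal.smul_def, smul_eq_mul] at hfin ⊢
  rw [ENNReal.toReal_add (ENNReal.add_ne_top.1 hfin).1 (ENNReal.add_ne_top.1 hfin).2,
    ENNReal.toReal_mul, ENNReal.toReal_mul, ENNReal.coe_toReal, ENNReal.coe_toReal,
    Real.coe_toNNReal _ h0, Real.coe_toNNReal _ (by linarith)]

theorem _root_.LowerSemicontinuous.le_of_tendsto {X ι : Type*} [TopologicalSpace X]
    {f : X → ℝ≥0∞} (hf : LowerSemicontinuous f) {l : Filter ι} [l.NeBot] {u : ι → X} {x : X}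
    (hu : Tendsto u l (𝓝 x)) {c : ι → ℝ≥0∞} {d : ℝ≥0∞} (hc : Tendsto c l (𝓝 d))
    (h : ∀ᶠ n in l, f (u n) ≤ c n) : f x ≤ d := by
  by_contra! hlt
  obtain ⟨e, he1, he2⟩ := exists_between hlt
  obtain ⟨n, h1, h2, h3⟩ :=
    ((hu.eventually (hf x e he2)).and ((hc.eventually_lt_const he1).and h)).exists
  exact absurd (h1.trans_le (h3.trans h2.le)) (lt_irrefl _)

/-- Finiteness travels with the bound because `ENNReal.toReal ⊤ = 0`: a bound on the real value
alone would say nothing about the limit. -/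
theorem _root_.LowerSemicontinuous.toReal_le_of_tendsto {X ι : Type*} [TopologicalSpace X]
    {f : X → ℝ≥0∞} (hf : LowerSemicontinuous f) {l : Filter ι} [l.NeBot] {u : ι → X} {x : X}
    (hu : Tendsto u l (𝓝 x)) {c : ι → ℝ} {d : ℝ} (hc : Tendsto c l (𝓝 d))
    (h : ∀ᶠ n in l, f (u n) ≠ ⊤ ∧ (f (u n)).toReal ≤ c n) : f x ≠ ⊤ ∧ (f x).toReal ≤ d := by
  have h1 : f x ≤ ENNReal.ofReal d := by
    refine hf.le_of_tendsto hu (ENNReal.tendsto_ofReal hc) (h.mono fun n hn => ?_)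
    rw [← ENNReal.ofReal_toReal hn.1]
    exact ENNReal.ofReal_le_ofReal hn.2
  have h2 : 0 ≤ d := ge_of_tendsto hc (h.mono fun n hn => ENNReal.toReal_nonneg.trans hn.2)
  exact ⟨ne_top_of_le_ne_top ENNReal.ofReal_ne_top h1, ENNReal.toReal_le_of_le_ofReal h2 h1⟩

theorem norm_segment_sub_sq (x u v : H) (θ : ℝ) :
    ‖(1 - θ) • u + θ • v - x‖ ^ 2 =
      (1 - θ) * ‖u - x‖ ^ 2 + θ * ‖v - x‖ ^ 2 - θ * (1 - θ) * ‖v - u‖ ^ 2 := by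
  have e1 : (1 - θ) • u + θ • v - x = (u - x) + θ • ((v - x) - (u - x)) := by
    module
  have e2 : v - u = (v - x) - (u - x) := by abel
  rw [e1, e2]
  generalize u - x = p
  generalize v - x = q
  rw [norm_add_sq_real, norm_smul, mul_pow, norm_sub_sq_real, real_inner_smul_right,
    inner_sub_right, real_inner_self_eq_norm_sq, real_inner_comm p q, Real.norm_eq_abs, sq_abs]
  ring

/-- `z` minimises `v ↦ W v + ‖v - x‖² / (2τ)`, expressed by the variational inequality. -/
def IsProx (W : H → ℝ≥0∞) (τ : ℝ) (x z : H) : Prop :=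
  W z ≠ ⊤ ∧ ∀ v, W v ≠ ⊤ →
    ‖z - v‖ ^ 2 ≤ ‖x - v‖ ^ 2 - ‖z - x‖ ^ 2 + 2 * τ * ((W v).toReal - (W z).toReal)

/-- Compare z with the point at parameter θ on the segment to v, divide by θ and let θ → 0. The
quadratic gain comes from the strong convexity of the squared distance. -/
theorem IsConvexEnergy.isProx_of_forall_le (hW : IsConvexEnergy W) {τ : ℝ} (hτ : 0 < τ) {x z : H}
    (hz : W z ≠ ⊤) (hmin : ∀ v, W v ≠ ⊤ →
      2 * τ * (W z).toReal + ‖z - x‖ ^ 2 ≤ 2 * τ * (W v).toReal + ‖v - x‖ ^ 2) :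
    IsProx W τ x z := by
  refine ⟨hz, fun v hv => ?_⟩
  have key : ∀ θ ∈ Set.Ioo (0 : ℝ) 1,
      2 * τ * (W z).toReal + ‖z - x‖ ^ 2 + (1 - θ) * ‖v - z‖ ^ 2
        ≤ 2 * τ * (W v).toReal + ‖v - x‖ ^ 2 := by
    rintro θ ⟨h0, h1⟩
    obtain ⟨hf, hle⟩ := hW.segment hz hv h0.le h1.le
    have h := hmin _ hf
    rw [norm_segment_sub_sq] at h
    have h2 : 2 * τ * (W ((1 - θ) • z + θ • v)).toReal ≤
        2 * τ * ((1 - θ) * (W z).toReal + θ * (W v).toReal) := by gcongr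
    have h3 : θ * (2 * τ * (W z).toReal + ‖z - x‖ ^ 2 + (1 - θ) * ‖v - z‖ ^ 2)
        ≤ θ * (2 * τ * (W v).toReal + ‖v - x‖ ^ 2) := by nlinarith
    exact le_of_mul_le_mul_left h3 h0
  have hlim : Tendsto (fun θ : ℝ => 2 * τ * (W z).toReal + ‖z - x‖ ^ 2 + (1 - θ) * ‖v - z‖ ^ 2)
      (𝓝[>] 0) (𝓝 (2 * τ * (W z).toReal + ‖z - x‖ ^ 2 + (1 - 0) * ‖v - z‖ ^ 2)) :=
    ((by fun_prop : Continuous fun θ : ℝ =>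
      2 * τ * (W z).toReal + ‖z - x‖ ^ 2 + (1 - θ) * ‖v - z‖ ^ 2).tendsto 0).mono_left
      nhdsWithin_le_nhds
  have := le_of_tendsto hlim (by
    filter_upwards [Ioo_mem_nhdsGT (zero_lt_one' ℝ)] with θ hθ using key θ hθ)
  rw [norm_sub_rev z v, norm_sub_rev x v]
  linarith

/-- Direct method: testing the infimum at midpoints makes any minimising sequence Cauchy in norm, so
no weak compactness is needed, and lower semicontinuity identifies its limit as a minimiser. -/
theorem IsConvexEnergy.exists_isProx [CompleteSpace H] (hW : IsConvexEnergy W) {τ : ℝ}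
    (hτ : 0 < τ) (x : H) : ∃ z, IsProx W τ x z := by
  obtain ⟨w, hw⟩ := hW.dense.nonempty
  set Φ : H → ℝ := fun v => 2 * τ * (W v).toReal + ‖v - x‖ ^ 2 with hΦ
  set m : ℝ := sInf (Φ '' {v | W v ≠ ⊤}) with hm
  have hbdd : BddBelow (Φ '' {v | W v ≠ ⊤}) := ⟨0, by
    rintro _ ⟨v, -, rfl⟩; simp only [hΦ]; positivity⟩
  have hne : (Φ '' {v | W v ≠ ⊤}).Nonempty := ⟨_, w, hw, rfl⟩
  have hmle : ∀ v, W v ≠ ⊤ → m ≤ Φ v := fun v hv => csInf_le hbdd ⟨v, hv, rfl⟩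
  have hex : ∀ n : ℕ, ∃ v, W v ≠ ⊤ ∧ Φ v < m + 1 / (n + 1) := by
    intro n
    obtain ⟨_, ⟨v, hv, rfl⟩, hlt⟩ := exists_lt_of_csInf_lt hne
      (show sInf (Φ '' {v | W v ≠ ⊤}) < m + 1 / ((n : ℝ) + 1) by
        have : (0 : ℝ) < 1 / ((n : ℝ) + 1) := by positivity
        linarith)
    exact ⟨v, hv, hlt⟩
  choose v hv hvm using hex
  have hdist : ∀ n k, ‖v n - v k‖ ^ 2 ≤ 2 * (1 / ((n : ℝ) + 1) + 1 / ((k : ℝ) + 1)) := by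
    intro n k
    obtain ⟨hf, hle⟩ := hW.segment (hv k) (hv n) (θ := 1 / 2) (by norm_num) (by norm_num)
    have h1 := hmle _ hf
    have h2 := norm_segment_sub_sq x (v k) (v n) (1 / 2)
    have h3 := hvm n
    have h4 := hvm k
    simp only [hΦ] at h1 h3 h4
    rw [h2] at h1
    nlinarith
  have hcau : CauchySeq v := by
    refine cauchySeq_of_le_tendsto_0 (fun n : ℕ => √(4 * (1 / ((n : ℝ) + 1)))) ?_ ?_
    · intro n k K hn hk
      rw [dist_eq_norm]
      apply Real.le_sqrt_of_sq_le
      refine (hdist n k).trans ?_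
      have h1 : 1 / ((n : ℝ) + 1) ≤ 1 / ((K : ℝ) + 1) := by gcongr
      have h2 : 1 / ((k : ℝ) + 1) ≤ 1 / ((K : ℝ) + 1) := by gcongr
      linarith
    · have := ((tendsto_one_div_add_atTop_nhds_zero_nat (𝕜 := ℝ)).const_mul 4).sqrt
      simpa using this
  obtain ⟨z, hz⟩ := cauchySeq_tendsto_of_complete hcau
  obtain ⟨hzt, hWz⟩ := hW.lsc.toReal_le_of_tendsto hz (c := fun n : ℕ =>
      (m + 1 / ((n : ℝ) + 1) - ‖v n - x‖ ^ 2) / (2 * τ)) (d := (m + 0 - ‖z - x‖ ^ 2) / (2 * τ))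
      (Tendsto.div_const (Tendsto.sub
        (tendsto_const_nhds.add tendsto_one_div_add_atTop_nhds_zero_nat)
        (((hz.sub_const x).norm).pow 2)) _)
      (Eventually.of_forall fun n => ⟨hv n, by
        rw [le_div_iff₀ (by positivity)]
        have := hvm n
        simp only [hΦ] at this
        linarith⟩)
  refine ⟨z, hW.isProx_of_forall_le hτ hzt fun u hu => ?_⟩
  rw [le_div_iff₀ (by positivity)] at hWz
  have h2 := hmle u hu
  simp only [hΦ] at h2
  linarith

/-- Test each variational inequality with the other proximal point and add: the energies cancel and
Cauchy–Schwarz finishes. -/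
theorem IsProx.norm_sub_le {τ : ℝ} {x x' z z' : H} (h : IsProx W τ x z) (h' : IsProx W τ x' z') :
    ‖z - z'‖ ≤ ‖x - x'‖ := by
  have h1 := h.2 z' h'.1
  have h2 := h'.2 z h.1
  have e : ‖x - z'‖ ^ 2 - ‖z - x‖ ^ 2 + ‖x' - z‖ ^ 2 - ‖z' - x'‖ ^ 2
      = 2 * inner ℝ (x - x') (z - z') := by
    simp only [norm_sub_sq_real, inner_sub_left, inner_sub_right]
    rw [real_inner_comm x z, real_inner_comm x' z']
    ring
  have h3 := real_inner_le_norm (x - x') (z - z')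
  rw [norm_sub_rev z' z] at h2
  have h4 : ‖z - z'‖ * ‖z - z'‖ ≤ ‖x - x'‖ * ‖z - z'‖ := by nlinarith
  rcases (norm_nonneg (z - z')).eq_or_lt with h0 | h0
  · rw [← h0]; exact norm_nonneg _
  · exact le_of_mul_le_mul_right h4 h0

theorem IsProx.eq {τ : ℝ} {x z z' : H} (h : IsProx W τ x z) (h' : IsProx W τ x z') : z = z' := by
  have := h.norm_sub_le h'
  rw [sub_self, norm_zero] at this
  exact sub_eq_zero.1 (norm_le_zero_iff.1 this)

open Classical in
/-- The resolvent `(1 + τ ∂W)⁻¹`. -/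
def resolvent (W : H → ℝ≥0∞) (τ : ℝ) (x : H) : H :=
  if h : ∃ z, IsProx W τ x z then h.choose else x

variable [CompleteSpace H]

theorem IsConvexEnergy.isProx_resolvent (hW : IsConvexEnergy W) {τ : ℝ} (hτ : 0 < τ) (x : H) :
    IsProx W τ x (resolvent W τ x) := by
  unfold resolvent
  rw [dif_pos (hW.exists_isProx hτ x)]
  exact (hW.exists_isProx hτ x).choose_spec

theorem IsConvexEnergy.energy_resolvent_le (hW : IsConvexEnergy W) {τ : ℝ} (hτ : 0 < τ) {x : H}
    (hx : W x ≠ ⊤) : (W (resolvent W τ x)).toReal ≤ (W x).toReal := by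
  have h := (hW.isProx_resolvent hτ x).2 x hx
  rw [sub_self, norm_zero] at h
  by_contra! hlt
  nlinarith [sq_nonneg ‖resolvent W τ x - x‖, mul_pos hτ (sub_pos.2 hlt)]

theorem IsConvexEnergy.norm_iterate_sub_le (hW : IsConvexEnergy W) {τ : ℝ} (hτ : 0 < τ) (n : ℕ)
    (x y : H) : ‖(resolvent W τ)^[n] x - (resolvent W τ)^[n] y‖ ≤ ‖x - y‖ := by
  induction n generalizing x y with
  | zero => simp
  | succ n ih =>
    rw [Function.iterate_succ_apply, Function.iterate_succ_apply]
    exact (ih _ _).trans ((hW.isProx_resolvent hτ x).norm_sub_le (hW.isProx_resolvent hτ y))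

theorem IsConvexEnergy.iterate_ne_top (hW : IsConvexEnergy W) {τ : ℝ} (hτ : 0 < τ) {n : ℕ}
    (x : H) (h : n ≠ 0 ∨ W x ≠ ⊤) : W ((resolvent W τ)^[n] x) ≠ ⊤ := by
  cases n with
  | zero => simpa using h
  | succ n =>
    rw [Function.iterate_succ_apply']
    exact (hW.isProx_resolvent hτ _).1

theorem IsConvexEnergy.energy_iterate_le (hW : IsConvexEnergy W) {τ : ℝ} (hτ : 0 < τ) (n : ℕ)
    {x : H} (hx : W x ≠ ⊤) : (W ((resolvent W τ)^[n] x)).toReal ≤ (W x).toReal := by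
  induction n with
  | zero => simp
  | succ n ih =>
    rw [Function.iterate_succ_apply']
    exact (hW.energy_resolvent_le hτ (hW.iterate_ne_top hτ x (Or.inr hx))).trans ih

/-- The evolution variational inequality for the implicit Euler scheme. -/
theorem IsConvexEnergy.norm_iterate_sub_sq_le (hW : IsConvexEnergy W) {τ : ℝ} (hτ : 0 < τ) (n : ℕ)
    (x : H) {v : H} (hv : W v ≠ ⊤) :
    ‖(resolvent W τ)^[n] x - v‖ ^ 2 ≤
      ‖x - v‖ ^ 2 + 2 * (n * τ) * ((W v).toReal - (W ((resolvent W τ)^[n] x)).toReal) := by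
  induction n with
  | zero => simp
  | succ n ih =>
    have h := (hW.isProx_resolvent hτ ((resolvent W τ)^[n] x)).2 v hv
    rw [Function.iterate_succ_apply']
    -- Each of the n earlier steps was bounded with an energy that is at least the new one, so all n
    -- + 1 terms may use the final energy.
    have hdec : n * (W (resolvent W τ ((resolvent W τ)^[n] x))).toReal ≤
        n * (W ((resolvent W τ)^[n] x)).toReal := by
      rcases Nat.eq_zero_or_pos n with rfl | hn
      · simp
      · have := hW.energy_resolvent_le hτ (hW.iterate_ne_top hτ x (Or.inl hn.ne'))
        gcongr
    push_cast
    nlinarith [sq_nonneg ‖resolvent W τ ((resolvent W τ)^[n] x) - (resolvent W τ)^[n] x‖,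
      mul_le_mul_of_nonneg_left hdec hτ.le]

/-- Test two half steps with the next coarse point, and the coarse step with the current fine point.
The coarse energy cancels in the sum and the fine energies telescope in n, so the error is of order
τ uniformly in n. -/
theorem IsConvexEnergy.norm_iterate_half_sub_sq_le (hW : IsConvexEnergy W) {τ : ℝ} (hτ : 0 < τ)
    (n : ℕ) {x : H} (hx : W x ≠ ⊤) :
    ‖(resolvent W (τ / 2))^[2 * n] x - (resolvent W τ)^[n] x‖ ^ 2 ≤
      2 * τ * ((W x).toReal - (W ((resolvent W (τ / 2))^[2 * n] x)).toReal) := by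
  have hτ2 : 0 < τ / 2 := by positivity
  induction n with
  | zero => simp
  | succ n ih =>
    set y := (resolvent W (τ / 2))^[2 * n] x
    set z := (resolvent W τ)^[n] x
    have ey : (resolvent W (τ / 2))^[2 * (n + 1)] x = (resolvent W (τ / 2))^[2] y := by
      rw [show 2 * (n + 1) = 2 + 2 * n by ring, Function.iterate_add_apply]
    rw [ey, Function.iterate_succ_apply' (resolvent W τ) n x]
    have hp := hW.isProx_resolvent hτ z
    have hy : W y ≠ ⊤ := hW.iterate_ne_top hτ2 x (Or.inr hx)
    have h1 := hW.norm_iterate_sub_sq_le hτ2 2 y hp.1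
    have h2 := hp.2 y hy
    rw [norm_sub_rev z y] at h2
    rw [norm_sub_rev y (resolvent W τ z)] at h1
    push_cast at h1
    nlinarith [sq_nonneg ‖resolvent W τ z - z‖]

theorem IsConvexEnergy.norm_resolvent_sub_sq_le (hW : IsConvexEnergy W) {τ : ℝ} (hτ : 0 < τ)
    {x : H} (hx : W x ≠ ⊤) : ‖resolvent W τ x - x‖ ^ 2 ≤ 2 * τ * (W x).toReal := by
  have h := hW.norm_iterate_sub_sq_le hτ 1 x hx
  simp only [Function.iterate_one, sub_self, norm_zero] at h
  push_cast at h
  nlinarith [mul_nonneg hτ.le (ENNReal.toReal_nonneg (a := W (resolvent W τ x)))]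

end Prox

/-! ### The gradient flow as limit of the implicit Euler scheme -/

section Flow

variable {H : Type*} [NormedAddCommGroup H] [InnerProductSpace ℝ H] {W : H → ℝ≥0∞}

/-- The implicit Euler scheme at time `t` with step size `2⁻ᵏ`. -/
def euler (W : H → ℝ≥0∞) (k : ℕ) (t : ℝ≥0) (x : H) : H :=
  (resolvent W ((1 / 2) ^ k))^[⌊(t : ℝ) * 2 ^ k⌋₊] x

/-- The gradient flow of `W`. -/
def flow (W : H → ℝ≥0∞) (t : ℝ≥0) (x : H) : H :=
  limUnder atTop fun k => euler W k t x

theorem tendsto_floor_mul_two_pow (t : ℝ≥0) :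
    Tendsto (fun k : ℕ => (⌊(t : ℝ) * 2 ^ k⌋₊ : ℝ) * (1 / 2) ^ k) atTop (𝓝 (t : ℝ)) := by
  have h := (tendsto_nat_floor_mul_div_atTop (R := ℝ) t.2).comp
    (tendsto_pow_atTop_atTop_of_one_lt (one_lt_two (α := ℝ)))
  refine h.congr fun k => ?_
  simp [div_eq_mul_inv]

variable [CompleteSpace H]

theorem IsConvexEnergy.norm_euler_sub_le (hW : IsConvexEnergy W) (k : ℕ) (t : ℝ≥0) (x y : H) :
    ‖euler W k t x - euler W k t y‖ ≤ ‖x - y‖ :=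
  hW.norm_iterate_sub_le (by positivity) _ _ _

theorem IsConvexEnergy.norm_iterate_succ_sub_le (hW : IsConvexEnergy W) {τ : ℝ} (hτ : 0 < τ)
    {n m : ℕ} (hnm : n = m ∨ n = m + 1) {x : H} (hx : W x ≠ ⊤) :
    ‖(resolvent W τ)^[n] x - (resolvent W τ)^[m] x‖ ≤ √(2 * τ * (W x).toReal) := by
  rcases hnm with rfl | rfl
  · rw [sub_self, norm_zero]
    positivity
  · apply Real.le_sqrt_of_sq_le
    rw [Function.iterate_succ_apply']
    refine (hW.norm_resolvent_sub_sq_le hτ (hW.iterate_ne_top hτ x (Or.inr hx))).trans ?_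
    have := hW.energy_iterate_le hτ m hx
    gcongr

theorem floor_two_mul (a : ℝ) (ha : 0 ≤ a) : ⌊a * 2⌋₊ = 2 * ⌊a⌋₊ ∨ ⌊a * 2⌋₊ = 2 * ⌊a⌋₊ + 1 := by
  have h1 := Nat.floor_le ha
  have h2 := Nat.lt_floor_add_one a
  have h3 : 2 * ⌊a⌋₊ ≤ ⌊a * 2⌋₊ := Nat.le_floor (by push_cast; linarith)
  have h4 : ⌊a * 2⌋₊ < 2 * ⌊a⌋₊ + 2 := (Nat.floor_lt (by positivity)).2 (by push_cast; linarith)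
  omega

theorem floor_add_add (a b : ℝ) (ha : 0 ≤ a) (hb : 0 ≤ b) :
    ⌊a + b⌋₊ = ⌊a⌋₊ + ⌊b⌋₊ ∨ ⌊a + b⌋₊ = ⌊a⌋₊ + ⌊b⌋₊ + 1 := by
  have h1 := Nat.floor_le ha
  have h2 := Nat.lt_floor_add_one a
  have h1' := Nat.floor_le hb
  have h2' := Nat.lt_floor_add_one b
  have h3 : ⌊a⌋₊ + ⌊b⌋₊ ≤ ⌊a + b⌋₊ := Nat.le_floor (by push_cast; linarith)
  have h4 : ⌊a + b⌋₊ < ⌊a⌋₊ + ⌊b⌋₊ + 2 :=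
    (Nat.floor_lt (by positivity)).2 (by push_cast; linarith)
  omega

/-- Halving the mesh costs one term from comparing half steps with full steps, and one for the
possible extra step when the number of half steps up to time t is odd. Both are of order √τ with τ =
2⁻ᵏ, hence the summable ratio √(1/2). -/
theorem IsConvexEnergy.norm_euler_succ_sub_le (hW : IsConvexEnergy W) (k : ℕ) (t : ℝ≥0) {x : H}
    (hx : W x ≠ ⊤) :
    ‖euler W (k + 1) t x - euler W k t x‖ ≤ 2 * √(2 * (W x).toReal) * √(1 / 2) ^ k := by
  have hτ : (0 : ℝ) < (1 / 2) ^ k := by positivity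
  have hs : √(2 * (1 / 2) ^ k * (W x).toReal) = √(2 * (W x).toReal) * √(1 / 2) ^ k := by
    have h : √((1 / 2 : ℝ) ^ k) = √(1 / 2) ^ k := by
      rw [Real.sqrt_eq_iff_eq_sq (by positivity) (by positivity), ← pow_mul, mul_comm, pow_mul,
        Real.sq_sqrt (by norm_num)]
    rw [← h, ← Real.sqrt_mul (by positivity)]
    congr 1; ring
  set n := ⌊(t : ℝ) * 2 ^ k⌋₊
  have h1 : ‖euler W (k + 1) t x - (resolvent W ((1 / 2) ^ k / 2))^[2 * n] x‖ ≤
      √(2 * ((1 / 2) ^ k / 2) * (W x).toReal) := by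
    have e : ((1 / 2 : ℝ)) ^ (k + 1) = (1 / 2) ^ k / 2 := by rw [pow_succ]; ring
    unfold euler
    rw [e]
    refine hW.norm_iterate_succ_sub_le (by positivity) ?_ hx
    have := floor_two_mul ((t : ℝ) * 2 ^ k) (by positivity)
    rwa [mul_assoc, ← pow_succ] at this
  have h2 : ‖(resolvent W ((1 / 2) ^ k / 2))^[2 * n] x - euler W k t x‖ ≤
      √(2 * (1 / 2) ^ k * (W x).toReal) := by
    apply Real.le_sqrt_of_sq_le
    refine (hW.norm_iterate_half_sub_sq_le hτ n hx).trans ?_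
    gcongr
    linarith [ENNReal.toReal_nonneg (a := W ((resolvent W ((1 / 2) ^ k / 2))^[2 * n] x))]
  have h3 : √(2 * ((1 / 2) ^ k / 2) * (W x).toReal) ≤ √(2 * (1 / 2) ^ k * (W x).toReal) := by
    apply Real.sqrt_le_sqrt
    gcongr
    linarith
  calc _ ≤ _ := norm_sub_le_norm_sub_add_norm_sub _ ((resolvent W ((1 / 2) ^ k / 2))^[2 * n] x) _
    _ ≤ _ := add_le_add (h1.trans h3) h2
    _ = _ := by rw [hs]; ring

theorem IsConvexEnergy.tendsto_euler (hW : IsConvexEnergy W) (t : ℝ≥0) (x : H) :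
    Tendsto (fun k => euler W k t x) atTop (𝓝 (flow W t x)) := by
  -- The rate is available only on the domain of `W`; density and nonexpansiveness extend
  -- convergence to all of `H`.
  have hdom : ∀ y, W y ≠ ⊤ → CauchySeq fun k => euler W k t y := by
    intro y hy
    refine cauchySeq_of_le_geometric (√(1 / 2)) (2 * √(2 * (W y).toReal)) ?_ fun k => ?_
    · rw [Real.sqrt_lt' one_pos]; norm_num
    · rw [dist_comm, dist_eq_norm]
      exact hW.norm_euler_succ_sub_le k t hy
  refine tendsto_nhds_limUnder (cauchySeq_tendsto_of_complete (Metric.cauchySeq_iff.2 fun ε hε => ?_))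
  obtain ⟨y, hy, hxy⟩ := Metric.dense_iff.1 hW.dense x (ε / 3) (by positivity)
  rw [Metric.mem_ball, dist_eq_norm] at hy
  obtain ⟨K, hK⟩ := Metric.cauchySeq_iff.1 (hdom y hxy) (ε / 3) (by positivity)
  refine ⟨K, fun m hm n hn => ?_⟩
  have h1 := hK m hm n hn
  have h2 := hW.norm_euler_sub_le m t x y
  have h3 := hW.norm_euler_sub_le n t y x
  rw [norm_sub_rev x y] at h2
  rw [← dist_eq_norm] at h2 h3
  calc _ ≤ _ := dist_triangle4 _ (euler W m t y) (euler W n t y) _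
    _ < ε / 3 + ε / 3 + ε / 3 := by linarith
    _ = ε := by ring

theorem IsConvexEnergy.norm_flow_sub_le (hW : IsConvexEnergy W) (t : ℝ≥0) (x y : H) :
    ‖flow W t x - flow W t y‖ ≤ ‖x - y‖ :=
  le_of_tendsto ((hW.tendsto_euler t x).sub (hW.tendsto_euler t y)).norm
    (Eventually.of_forall fun k => hW.norm_euler_sub_le k t x y)

theorem IsConvexEnergy.flow_zero (hW : IsConvexEnergy W) (x : H) : flow W 0 x = x := by
  refine tendsto_nhds_unique (hW.tendsto_euler 0 x) ?_
  simp [euler]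

theorem IsConvexEnergy.continuous_flow_apply (hW : IsConvexEnergy W) (t : ℝ≥0) :
    Continuous (flow W t) :=
  (LipschitzWith.of_dist_le_mul (K := 1) fun x y => by
    simpa [dist_eq_norm] using hW.norm_flow_sub_le t x y).continuous

/-- Rounding s + t down to the mesh differs from rounding s and t separately by at most one step,
whose effect vanishes as k → ∞. -/
theorem IsConvexEnergy.flow_add (hW : IsConvexEnergy W) (s t : ℝ≥0) (x : H) :
    flow W (s + t) x = flow W s (flow W t x) := by
  refine congrFun (Continuous.ext_on hW.dense (hW.continuous_flow_apply (s + t))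
    ((hW.continuous_flow_apply s).comp (hW.continuous_flow_apply t)) fun y hy => ?_) x
  refine tendsto_nhds_unique (hW.tendsto_euler (s + t) y) ?_
  have h1 : Tendsto (fun k => ‖euler W k (s + t) y - euler W k s (euler W k t y)‖) atTop
      (𝓝 0) := by
    have hlim : Tendsto (fun k : ℕ => √(2 * (1 / 2) ^ k * (W y).toReal)) atTop (𝓝 0) := by
      have := (((tendsto_pow_atTop_nhds_zero_of_lt_one (r := (1 / 2 : ℝ)) (by norm_num)
        (by norm_num)).const_mul 2).mul_const (W y).toReal).sqrt
      simpa using this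
    refine squeeze_zero (fun _ => norm_nonneg _) (fun k => ?_) hlim
    unfold euler
    rw [← Function.iterate_add_apply, NNReal.coe_add, add_mul]
    exact hW.norm_iterate_succ_sub_le (by positivity)
      (floor_add_add _ _ (by positivity) (by positivity)) hy
  have h2 : Tendsto (fun k => ‖euler W k s (euler W k t y) - euler W k s (flow W t y)‖) atTop
      (𝓝 0) := by
    refine squeeze_zero (fun _ => norm_nonneg _) (fun k => hW.norm_euler_sub_le k s _ _) ?_
    simpa using ((hW.tendsto_euler t y).sub_const (flow W t y)).norm
  have h3 := ((tendsto_zero_iff_norm_tendsto_zero.2 h1).add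
    (tendsto_zero_iff_norm_tendsto_zero.2 h2)).add (hW.tendsto_euler s (flow W t y))
  simpa using h3

/-- The discrete evolution inequality between times s and t, solved for the energy at t so that
lower semicontinuity applies. It also yields the smoothing effect: the energy is finite at t for
every initial value. -/
theorem IsConvexEnergy.energy_flow_le (hW : IsConvexEnergy W) {s t : ℝ≥0} (hst : s < t) (x : H)
    {v : H} (hv : W v ≠ ⊤) :
    W (flow W t x) ≠ ⊤ ∧ (W (flow W t x)).toReal ≤ (W v).toReal +
      (‖flow W s x - v‖ ^ 2 - ‖flow W t x - v‖ ^ 2) / (2 * ((t : ℝ) - s)) := by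
  have hpos : (0 : ℝ) < (t : ℝ) - s := sub_pos.2 (NNReal.coe_lt_coe.2 hst)
  have hts : Tendsto (fun k : ℕ => (⌊(t : ℝ) * 2 ^ k⌋₊ : ℝ) * (1 / 2) ^ k -
      (⌊(s : ℝ) * 2 ^ k⌋₊ : ℝ) * (1 / 2) ^ k) atTop (𝓝 ((t : ℝ) - s)) :=
    (tendsto_floor_mul_two_pow t).sub (tendsto_floor_mul_two_pow s)
  refine hW.lsc.toReal_le_of_tendsto (hW.tendsto_euler t x) (c := fun k =>
    (W v).toReal + (‖euler W k s x - v‖ ^ 2 - ‖euler W k t x - v‖ ^ 2) /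
      (2 * ((⌊(t : ℝ) * 2 ^ k⌋₊ : ℝ) * (1 / 2) ^ k - (⌊(s : ℝ) * 2 ^ k⌋₊ : ℝ) * (1 / 2) ^ k))) ?_ ?_
  · refine tendsto_const_nhds.add (Tendsto.div (Tendsto.sub ?_ ?_)
      (hts.const_mul 2) (by positivity))
    · exact (((hW.tendsto_euler s x).sub_const v).norm).pow 2
    · exact (((hW.tendsto_euler t x).sub_const v).norm).pow 2
  · filter_upwards [hts.eventually (lt_mem_nhds hpos)] with k hk
    have hτ : (0 : ℝ) < (1 / 2) ^ k := by positivity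
    set n := ⌊(t : ℝ) * 2 ^ k⌋₊ with hn
    set m := ⌊(s : ℝ) * 2 ^ k⌋₊ with hm
    -- On fine meshes at least one Euler step separates s from t, and one step already lands in the
    -- domain of `W`.
    have hmn : m < n := by
      rw [← sub_mul] at hk
      have := pos_of_mul_pos_left hk hτ.le
      exact_mod_cast sub_pos.1 this
    have e : euler W k t x = (resolvent W ((1 / 2) ^ k))^[n - m] (euler W k s x) := by
      unfold euler
      rw [← Function.iterate_add_apply, ← hn, ← hm, Nat.sub_add_cancel hmn.le]
    have h := hW.norm_iterate_sub_sq_le hτ (n - m) (euler W k s x) hv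
    rw [← e] at h
    have hfin : W (euler W k t x) ≠ ⊤ := by
      rw [e]; exact hW.iterate_ne_top hτ _ (Or.inl (by omega))
    refine ⟨hfin, ?_⟩
    rw [Nat.cast_sub hmn.le, sub_mul] at h
    rw [← sub_le_iff_le_add', le_div_iff₀ (by positivity)]
    linarith

theorem IsConvexEnergy.flow_ne_top (hW : IsConvexEnergy W) {t : ℝ≥0} (ht : 0 < t) (x : H) :
    W (flow W t x) ≠ ⊤ := by
  obtain ⟨v, hv⟩ := hW.dense.nonempty
  exact (hW.energy_flow_le ht x hv).1

/-- The evolution variational inequality for the gradient flow. -/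
theorem IsConvexEnergy.norm_flow_sub_sq_le (hW : IsConvexEnergy W) {s t : ℝ≥0} (hst : s ≤ t)
    (x : H) {v : H} (hv : W v ≠ ⊤) :
    ‖flow W t x - v‖ ^ 2 ≤ ‖flow W s x - v‖ ^ 2 +
      2 * ((t : ℝ) - s) * ((W v).toReal - (W (flow W t x)).toReal) := by
  rcases hst.eq_or_lt with rfl | hst
  · simp
  have hpos : (0 : ℝ) < (t : ℝ) - s := sub_pos.2 (NNReal.coe_lt_coe.2 hst)
  have h := (hW.energy_flow_le hst x hv).2
  rw [← sub_le_iff_le_add', le_div_iff₀ (by positivity)] at h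
  linarith

theorem IsConvexEnergy.energy_flow_antitone (hW : IsConvexEnergy W) {s t : ℝ≥0} (hst : s ≤ t)
    (x : H) (hs : W (flow W s x) ≠ ⊤) :
    (W (flow W t x)).toReal ≤ (W (flow W s x)).toReal := by
  rcases hst.eq_or_lt with rfl | hst
  · exact le_rfl
  have hpos : (0 : ℝ) < (t : ℝ) - s := sub_pos.2 (NNReal.coe_lt_coe.2 hst)
  have h := hW.norm_flow_sub_sq_le hst.le x hs
  rw [sub_self, norm_zero] at h
  by_contra! hlt
  nlinarith [sq_nonneg ‖flow W t x - flow W s x‖, mul_pos hpos (sub_pos.2 hlt)]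

/-- Orbits starting in the domain are 1/2-Hölder in time by the evolution inequality; the others are
uniform limits of such orbits. -/
theorem IsConvexEnergy.continuous_flow (hW : IsConvexEnergy W) (x : H) :
    Continuous fun t => flow W t x := by
  have hdom : ∀ y, W y ≠ ⊤ → Continuous fun t => flow W t y := by
    intro y hy
    have hb : ∀ s t : ℝ≥0, s ≤ t →
        ‖flow W t y - flow W s y‖ ≤ √(2 * |(t : ℝ) - s| * (W y).toReal) := by
      intro s t hst
      apply Real.le_sqrt_of_sq_le
      have hs : W (flow W s y) ≠ ⊤ := by
        rcases (zero_le (a := s)).eq_or_lt with rfl | h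
        · rwa [hW.flow_zero]
        · exact hW.flow_ne_top h y
      have h1 := hW.norm_flow_sub_sq_le hst y hs
      have h2 := hW.energy_flow_antitone (zero_le (a := s)) y (by rwa [hW.flow_zero])
      rw [hW.flow_zero] at h2
      rw [sub_self, norm_zero] at h1
      have h3 : (0 : ℝ) ≤ (t : ℝ) - s := sub_nonneg.2 (NNReal.coe_le_coe.2 hst)
      rw [abs_of_nonneg h3]
      nlinarith [mul_le_mul_of_nonneg_left h2 h3,
        mul_nonneg h3 (ENNReal.toReal_nonneg (a := W (flow W t y)))]
    have hb' : ∀ s t : ℝ≥0,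
        ‖flow W t y - flow W s y‖ ≤ √(2 * |(t : ℝ) - s| * (W y).toReal) := by
      intro s t
      rcases le_total s t with h | h
      · exact hb s t h
      · rw [norm_sub_rev, abs_sub_comm]
        exact hb t s h
    refine continuous_iff_continuousAt.2 fun s => ?_
    rw [ContinuousAt, tendsto_iff_norm_sub_tendsto_zero]
    refine squeeze_zero (fun _ => norm_nonneg _) (hb' s) ?_
    have : Continuous fun t : ℝ≥0 => √(2 * |(t : ℝ) - s| * (W y).toReal) := by fun_prop
    simpa using this.tendsto s
  refine continuous_of_uniform_approx_of_continuous fun U hU => ?_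
  obtain ⟨ε, hε, hεU⟩ := Metric.mem_uniformity_dist.1 hU
  obtain ⟨y, hy, hxy⟩ := Metric.dense_iff.1 hW.dense x ε hε
  refine ⟨fun t => flow W t y, hdom y hxy, fun t => hεU ?_⟩
  rw [Metric.mem_ball, dist_comm, dist_eq_norm] at hy
  rw [dist_eq_norm]
  exact (hW.norm_flow_sub_le t x y).trans_lt hy

/-- The gradient flow as a semigroup of contractions. -/
def IsConvexEnergy.semigroup (hW : IsConvexEnergy W) : ContractionSemigroup H where
  toFun := flow W
  map_zero' := hW.flow_zero
  map_add' := hW.flow_add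
  continuous' := hW.continuous_flow
  contraction' := hW.norm_flow_sub_le

end Flow

/-! ### Weak derivatives of Hilbert space valued functions -/

section WeakDerivative

variable {H : Type*} [NormedAddCommGroup H] [InnerProductSpace ℝ H]

/-- Banach–Alaoglu along a free ultrafilter, which replaces the extraction of a subsequence and so
needs no separability. -/
theorem exists_weak_limit [CompleteSpace H] (f : ℕ → H) (C : ℝ) (hf : ∀ n, ‖f n‖ ≤ C) :
    ∃ g : H, ∀ φ : H, Tendsto (fun n => inner ℝ φ (f n)) (hyperfilter ℕ) (𝓝 (inner ℝ φ g)) := by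
  have hc := WeakDual.isCompact_closedBall (0 : StrongDual ℝ H) C
  set F : ℕ → WeakDual ℝ H := fun n =>
    StrongDual.toWeakDual (InnerProductSpace.toDual ℝ H (f n))
  obtain ⟨ℓ, -, hℓ⟩ := hc.ultrafilter_le_nhds ((hyperfilter ℕ).map F) (by
    refine le_principal_iff.2 (Filter.mem_map.2 (Eventually.of_forall fun n => ?_))
    simp only [F, Set.mem_preimage, Metric.mem_closedBall, dist_zero_right]
    have : WeakDual.toStrongDual (StrongDual.toWeakDual (InnerProductSpace.toDual ℝ H (f n))) =
      InnerProductSpace.toDual ℝ H (f n) := rfl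
    rw [this, LinearIsometryEquiv.norm_map]
    exact hf n)
  refine ⟨(InnerProductSpace.toDual ℝ H).symm (WeakDual.toStrongDual ℓ), fun φ => ?_⟩
  rw [real_inner_comm, InnerProductSpace.toDual_symm_apply]
  have h1 : Tendsto F (hyperfilter ℕ) (𝓝 ℓ) := hℓ
  have h2 := ((WeakDual.eval_continuous (𝕜 := ℝ) φ).tendsto ℓ).comp h1
  refine h2.congr fun n => ?_
  exact real_inner_comm _ _

theorem tendsto_average_of_continuous [CompleteSpace H] {u : ℝ → H} (hu : Continuous u) (c : ℝ) :
    Tendsto (fun n : ℕ => ((n : ℝ) + 1) • ∫ r in c..(c + 1 / ((n : ℝ) + 1)), u r) atTop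
      (𝓝 (u c)) := by
  have h1 : HasDerivAt (fun x => ∫ r in c..x, u r) (u c) c :=
    intervalIntegral.integral_hasDerivAt_right (hu.intervalIntegrable _ _)
      (hu.stronglyMeasurableAtFilter _ _) hu.continuousAt
  have h2 := h1.tendsto_slope_zero_right
  have h3 : Tendsto (fun n : ℕ => 1 / ((n : ℝ) + 1)) atTop (𝓝[>] 0) :=
    tendsto_nhdsWithin_iff.2 ⟨tendsto_one_div_add_atTop_nhds_zero_nat,
      Eventually.of_forall fun n => Set.mem_Ioi.2 (by positivity)⟩
  refine (h2.comp h3).congr fun n => ?_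
  simp

theorem integral_difference_quotient {u : ℝ → H} (hu : Continuous u) (c d h : ℝ) :
    ∫ r in c..d, (u (r + h) - u r) = (∫ r in d..(d + h), u r) - ∫ r in c..(c + h), u r := by
  have hi : ∀ x y, IntervalIntegrable u volume x y := fun x y => hu.intervalIntegrable x y
  rw [intervalIntegral.integral_sub ((by fun_prop : Continuous fun r => u (r + h)).intervalIntegrable
    _ _) (hi _ _), intervalIntegral.integral_comp_add_right]
  have h1 := intervalIntegral.integral_add_adjacent_intervals (hi c (c + h)) (hi (c + h) (d + h))
  have h2 := intervalIntegral.integral_add_adjacent_intervals (hi c d) (hi d (d + h))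
  rw [← h2] at h1
  rw [sub_eq_sub_iff_add_eq_add, add_comm _ (∫ r in c..(c + h), u r), h1, add_comm]

/-- A continuous function with bounded difference quotients in `L²` has a derivative in `L²`. -/
theorem exists_weak_derivative [CompleteSpace H] {u : ℝ → H} (hu : Continuous u) {a b C : ℝ}
    (hC : ∀ h : ℝ, 0 < h → ∫ r in a..b, ‖u (r + h) - u r‖ ^ 2 ≤ C * h ^ 2) (hab : a ≤ b) :
    ∃ g : ℝ → H, MemLp g 2 (volume.restrict (Set.Icc a b)) ∧
      ∀ c d, a ≤ c → c ≤ d → d ≤ b → u d - u c = ∫ r in c..d, g r := by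
  set ν : Measure ℝ := volume.restrict (Set.Icc a b) with hν
  set D : ℕ → ℝ → H := fun n r => ((n : ℝ) + 1) • (u (r + 1 / ((n : ℝ) + 1)) - u r) with hD
  have hDc : ∀ n, Continuous (D n) := fun n => by simp only [hD]; fun_prop
  have hDm : ∀ n, MemLp (D n) 2 ν := fun n =>
    have ⟨C, hC⟩ := isCompact_Icc.exists_bound_of_continuousOn (hDc n).continuousOn
    MemLp.of_bound (hDc n).aestronglyMeasurable C
      ((ae_restrict_iff' measurableSet_Icc).2 (Eventually.of_forall hC))
  obtain ⟨g, hg⟩ := exists_weak_limit (fun n => (hDm n).toLp (D n)) (√C) (fun n => by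
    apply Real.le_sqrt_of_sq_le
    rw [← real_inner_self_eq_norm_sq, L2.inner_def]
    have e : ∫ r, inner ℝ ((hDm n).toLp (D n) r) ((hDm n).toLp (D n) r) ∂ν
        = ∫ r in a..b, ‖D n r‖ ^ 2 := by
      rw [intervalIntegral.integral_of_le hab, ← integral_Icc_eq_integral_Ioc]
      refine integral_congr_ae ?_
      filter_upwards [(hDm n).coeFn_toLp] with r hr
      rw [hr, real_inner_self_eq_norm_sq]
    rw [e]
    have h1 := hC (1 / ((n : ℝ) + 1)) (by positivity)
    have h2 : ∀ r, ‖D n r‖ ^ 2 = ((n : ℝ) + 1) ^ 2 * ‖u (r + 1 / ((n : ℝ) + 1)) - u r‖ ^ 2 := by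
      intro r
      simp only [hD]
      rw [norm_smul, mul_pow, Real.norm_of_nonneg (by positivity)]
    simp only [h2]
    rw [intervalIntegral.integral_const_mul]
    calc _ ≤ ((n : ℝ) + 1) ^ 2 * (C * (1 / ((n : ℝ) + 1)) ^ 2) := by gcongr
      _ = C := by field_simp)
  refine ⟨g, Lp.memLp g, fun c d hac hcd hdb => ?_⟩
  have hsub : Set.Ioc c d ⊆ Set.Icc a b := fun r hr => ⟨hac.trans hr.1.le, hr.2.trans hdb⟩
  have hrestr : ν.restrict (Set.Ioc c d) = volume.restrict (Set.Ioc c d) := by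
    rw [hν, Measure.restrict_restrict measurableSet_Ioc, Set.inter_eq_self_of_subset_left hsub]
  -- Test the weak limit against e times the indicator of (c, d]. The integrated difference quotient
  -- is a difference of averages of u just after d and just after c, which tends to u d - u c.
  refine ext_inner_left ℝ fun e => ?_
  have h1 := hg (indicatorConstLp 2 (measurableSet_Ioc (a := c) (b := d)) (by finiteness) e)
  simp only [L2.inner_indicatorConstLp_eq_inner_setIntegral, hrestr,
    ← intervalIntegral.integral_of_le hcd] at h1
  have h2 : ∀ n, ∫ r in c..d, (hDm n).toLp (D n) r =
      (((n : ℝ) + 1) • ∫ r in d..(d + 1 / ((n : ℝ) + 1)), u r) -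
        ((n : ℝ) + 1) • ∫ r in c..(c + 1 / ((n : ℝ) + 1)), u r := by
    intro n
    rw [← smul_sub, ← integral_difference_quotient hu, ← intervalIntegral.integral_smul,
      intervalIntegral.integral_of_le hcd, intervalIntegral.integral_of_le hcd, ← hrestr]
    exact integral_congr_ae (ae_restrict_of_ae (hDm n).coeFn_toLp)
  simp only [h2] at h1
  refine tendsto_nhds_unique ?_ h1
  refine Tendsto.mono_left ?_ (Nat.hyperfilter_le_atTop)
  exact tendsto_const_nhds.inner
    ((tendsto_average_of_continuous hu d).sub (tendsto_average_of_continuous hu c))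

/-- The integral telescopes to the one over [a, a + h] minus the one over [b, b + h]; drop the
second and bound the first by monotonicity. -/
theorem integral_sub_shift_le {φ : ℝ → ℝ} {a : ℝ} (hφ : AntitoneOn φ (Set.Ici a))
    (h0 : ∀ r, 0 ≤ φ r) {b h : ℝ} (hab : a ≤ b) (hh : 0 < h) :
    ∫ r in a..b, (φ r - φ (r + h)) ≤ φ a * h := by
  have hi : ∀ x y, a ≤ x → a ≤ y → IntervalIntegrable φ volume x y := fun x y hx hy =>
    (hφ.mono fun z hz => (le_min hx hy).trans hz.1).intervalIntegrable
  have hsh : IntervalIntegrable (fun r => φ (r + h)) volume a b := by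
    simpa using (hi (a + h) (b + h) (by linarith) (by linarith)).comp_add_right h
  rw [intervalIntegral.integral_sub (hi a b le_rfl hab) hsh,
    intervalIntegral.integral_comp_add_right]
  have h1 := intervalIntegral.integral_add_adjacent_intervals
    (hi a (a + h) le_rfl (by linarith)) (hi (a + h) (b + h) (by linarith) (by linarith))
  have h2 := intervalIntegral.integral_add_adjacent_intervals
    (hi a b le_rfl hab) (hi b (b + h) hab (by linarith))
  have h3 : 0 ≤ ∫ r in b..(b + h), φ r :=
    intervalIntegral.integral_nonneg (by linarith) fun r _ => h0 r
  have h4 : ∫ r in a..(a + h), φ r ≤ ∫ _ in a..(a + h), φ a :=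
    intervalIntegral.integral_mono_on (by linarith) (hi _ _ le_rfl (by linarith))
      intervalIntegrable_const fun r hr => hφ Set.self_mem_Ici hr.1 hr.1
  rw [intervalIntegral.integral_const, smul_eq_mul] at h4
  linarith

end WeakDerivative

/-! ### Strong solutions -/

section StrongSolution

variable {H : Type*} [NormedAddCommGroup H] [InnerProductSpace ℝ H] [CompleteSpace H]
  {W : H → ℝ≥0∞}

/-- The evolution inequality tested with the orbit at time r bounds the squared increment by 2h
times the energy drop on [r, r + h]. Integrating that drop in r gains a second factor h. -/
theorem IsConvexEnergy.integral_flow_shift_le (hW : IsConvexEnergy W) (x : H) {a b : ℝ}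
    (ha : 0 < a) (hab : a ≤ b) {h : ℝ} (hh : 0 < h) :
    ∫ r in a..b, ‖flow W (r + h).toNNReal x - flow W r.toNNReal x‖ ^ 2 ≤
      2 * (W (flow W a.toNNReal x)).toReal * h ^ 2 := by
  set φ : ℝ → ℝ := fun r => (W (flow W r.toNNReal x)).toReal with hφ
  have hanti : AntitoneOn φ (Set.Ici a) := fun r hr s _ hrs =>
    hW.energy_flow_antitone (Real.toNNReal_le_toNNReal hrs) x
      (hW.flow_ne_top (Real.toNNReal_pos.2 (ha.trans_le hr)) x)
  have hcont : Continuous fun r : ℝ => flow W r.toNNReal x :=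
    (hW.continuous_flow x).comp continuous_real_toNNReal
  have hc2 : Continuous fun r : ℝ => flow W (r + h).toNNReal x :=
    hcont.comp (continuous_add_const h)
  have hi : ∀ x y, a ≤ x → a ≤ y → IntervalIntegrable φ volume x y := fun x y hx hy =>
    (hanti.mono fun z hz => (le_min hx hy).trans hz.1).intervalIntegrable
  have hsh : IntervalIntegrable (fun r => φ (r + h)) volume a b := by
    simpa using (hi (a + h) (b + h) (by linarith) (by linarith)).comp_add_right h
  have h1 : ∫ r in a..b, ‖flow W (r + h).toNNReal x - flow W r.toNNReal x‖ ^ 2 ≤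
      ∫ r in a..b, 2 * h * (φ r - φ (r + h)) := by
    refine intervalIntegral.integral_mono_on hab
      (((hc2.sub hcont).norm.pow 2).intervalIntegrable _ _)
      (((hi a b le_rfl hab).sub hsh).const_mul _) fun r hr => ?_
    have hr0 : 0 < r := ha.trans_le hr.1
    have h2 := hW.norm_flow_sub_sq_le (Real.toNNReal_le_toNNReal (by linarith : r ≤ r + h)) x
      (hW.flow_ne_top (Real.toNNReal_pos.2 hr0) x)
    rw [sub_self, norm_zero, Real.coe_toNNReal _ hr0.le, Real.coe_toNNReal _ (by linarith)] at h2
    simp only [hφ]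
    linarith
  refine h1.trans ?_
  rw [intervalIntegral.integral_const_mul]
  have h2 := integral_sub_shift_le hanti (fun r => ENNReal.toReal_nonneg) hab hh
  nlinarith

/-- The right derivative at t of the squared distance to y + v turns the evolution inequality into
the subgradient inequality; lower semicontinuity handles the energy at times t + h. -/
theorem IsConvexEnergy.mem_subgradient_of_hasDerivAt (hW : IsConvexEnergy W) (x : H) {t : ℝ}
    (ht : 0 < t) {g : H} (hg : HasDerivAt (fun r : ℝ => flow W r.toNNReal x) g t) :
    -g ∈ subgradient W (flow W t.toNNReal x) := by
  have htop : W (flow W t.toNNReal x) ≠ ⊤ := hW.flow_ne_top (Real.toNNReal_pos.2 ht) x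
  refine ⟨htop.lt_top, fun v => ?_⟩
  set y := flow W t.toNNReal x with hy
  by_cases hv : W (y + v) = ⊤
  · rw [hv]; exact le_top
  set U : ℝ → H := fun r => flow W r.toNNReal x with hU
  have hUt : U t = y := rfl
  have hsq : HasDerivAt (fun r => ‖U r - (y + v)‖ ^ 2) (2 * inner ℝ (U t - (y + v)) g) t :=
    (hg.sub_const (y + v)).norm_sq
  have e1 : U t - (y + v) = -v := by rw [hUt]; abel
  rw [e1] at hsq
  have hsl := hsq.tendsto_slope_zero_right
  have hUc : Tendsto (fun h : ℝ => U (t + h)) (𝓝[>] 0) (𝓝 y) := by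
    have h1 : ContinuousAt U t := hg.continuousAt
    have h2 : Tendsto (fun h : ℝ => t + h) (𝓝[>] 0) (𝓝 t) := by
      have := (continuous_const_add t).tendsto 0
      rw [add_zero] at this
      exact this.mono_left nhdsWithin_le_nhds
    exact h1.tendsto.comp h2
  have hlim : Tendsto (fun h : ℝ => (W (y + v)).toReal -
      h⁻¹ • (‖U (t + h) - (y + v)‖ ^ 2 - ‖U t - (y + v)‖ ^ 2) / 2) (𝓝[>] 0)
      (𝓝 ((W (y + v)).toReal - 2 * inner ℝ (-v) g / 2)) :=
    tendsto_const_nhds.sub (hsl.div_const 2)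
  have hfin := (hW.lsc.toReal_le_of_tendsto hUc hlim (by
    filter_upwards [self_mem_nhdsWithin] with h hh
    have hh : 0 < h := hh
    have hth : 0 < t + h := by linarith
    refine ⟨hW.flow_ne_top (Real.toNNReal_pos.2 hth) x, ?_⟩
    have h2 := hW.norm_flow_sub_sq_le (Real.toNNReal_le_toNNReal (by linarith : t ≤ t + h)) x hv
    rw [Real.coe_toNNReal _ ht.le, Real.coe_toNNReal _ hth.le] at h2
    change ‖U (t + h) - (y + v)‖ ^ 2 ≤ ‖U t - (y + v)‖ ^ 2 + 2 * (t + h - t) *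
      ((W (y + v)).toReal - (W (U (t + h))).toReal) at h2
    rw [le_sub_comm, smul_eq_mul, div_le_iff₀ two_pos, inv_mul_le_iff₀ hh]
    linarith)).2
  have h3 : (W y).toReal + inner ℝ (-g) v ≤ (W (y + v)).toReal := by
    rw [inner_neg_left, real_inner_comm] at hfin
    rw [inner_neg_left]
    linarith [real_inner_comm g v]
  rw [← EReal.coe_ennreal_toReal htop, ← EReal.coe_ennreal_toReal hv, ← EReal.coe_add]
  exact_mod_cast h3

theorem IsConvexEnergy.isStrongSolution_flow (hW : IsConvexEnergy W) (x : H) :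
    IsStrongSolution W x fun t => flow W t x := by
  set U : ℝ → H := fun r => flow W r.toNNReal x with hU
  have hUc : Continuous U := (hW.continuous_flow x).comp continuous_real_toNNReal
  have key : ∀ a b : ℝ, 0 < a → a ≤ b → ∃ g : ℝ → H,
      MemLp g 2 (volume.restrict (Set.Icc a b)) ∧ U b - U a = ∫ r in a..b, g r ∧
      ∀ᵐ t, t ∈ Set.Ioo a b → HasDerivAt U (g t) t := by
    intro a b ha hab
    obtain ⟨g, hg, hgi⟩ := exists_weak_derivative hUc (C := 2 * (W (U a)).toReal)
      (fun h hh => hW.integral_flow_shift_le x ha hab hh) hab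
    refine ⟨g, hg, hgi a b le_rfl hab le_rfl, ?_⟩
    have h_int : IntervalIntegrable g volume a b := by
      rw [intervalIntegrable_iff_integrableOn_Icc_of_le hab]
      exact hg.integrable (by norm_num)
    filter_upwards [h_int.ae_hasDerivAt_integral] with t ht htab
    have h1 := ht (Set.Icc_subset_uIcc (Set.Ioo_subset_Icc_self htab)) a Set.left_mem_uIcc
    refine (h1.const_add (U a)).congr_of_eventuallyEq ?_
    filter_upwards [Ioo_mem_nhds htab.1 htab.2] with s hs
    rw [← hgi a s le_rfl hs.1.le hs.2.le]
    abel
  -- One derivative must serve all intervals, whereas `key` produces one for each; `deriv U` agrees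
  -- almost everywhere with all of them.
  refine ⟨hW.continuous_flow x, hW.flow_zero x, deriv U, fun a b ha hab => ?_, ?_⟩
  · obtain ⟨g, hg, hgi, hd⟩ := key a b (NNReal.coe_pos.2 ha) (NNReal.coe_le_coe.2 hab)
    have hae : deriv U =ᵐ[volume.restrict (Set.Icc (a : ℝ) b)] g := by
      rw [restrict_Ioo_eq_restrict_Icc.symm]
      refine (ae_restrict_iff' measurableSet_Ioo).2 ?_
      filter_upwards [hd] with t ht htab using (ht htab).deriv
    refine ⟨hg.ae_eq hae.symm, ?_⟩
    have h1 : U b - U a = flow W b x - flow W a x := by simp [hU]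
    rw [← h1, hgi, intervalIntegral.integral_of_le (NNReal.coe_le_coe.2 hab),
      intervalIntegral.integral_of_le (NNReal.coe_le_coe.2 hab), ← integral_Icc_eq_integral_Ioc,
      ← integral_Icc_eq_integral_Ioc]
    exact integral_congr_ae hae.symm
  · have hall : ∀ᵐ t : ℝ, ∀ n : ℕ, t ∈ Set.Ioo (1 / ((n : ℝ) + 1)) ((n : ℝ) + 1) →
        HasDerivAt U (deriv U t) t := by
      refine ae_all_iff.2 fun n => ?_
      obtain ⟨g, -, -, hd⟩ := key (1 / ((n : ℝ) + 1)) ((n : ℝ) + 1) (by positivity) (by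
        rw [div_le_iff₀ (by positivity)]
        nlinarith [Nat.cast_nonneg (α := ℝ) n])
      filter_upwards [hd] with t ht htn using (ht htn).differentiableAt.hasDerivAt
    refine (ae_restrict_iff' measurableSet_Ioi).2 ?_
    filter_upwards [hall] with t ht ht0
    have ht0 : 0 < t := ht0
    obtain ⟨n, hn⟩ := exists_nat_one_div_lt ht0
    obtain ⟨m, hm⟩ := exists_nat_gt t
    refine hW.mem_subgradient_of_hasDerivAt x ht0 (ht (max n m) ⟨lt_of_le_of_lt ?_ hn, ?_⟩)
    · have : (n : ℝ) ≤ (max n m : ℕ) := by exact_mod_cast le_max_left n m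
      gcongr
    · have : (m : ℝ) ≤ (max n m : ℕ) := by exact_mod_cast le_max_right n m
      linarith

theorem IsConvexEnergy.generates (hW : IsConvexEnergy W) : Generates W hW.semigroup :=
  hW.isStrongSolution_flow

end StrongSolution

/-! ### Uniqueness of strong solutions -/

section Uniqueness

theorem le_of_locally_antitone {G : ℝ → ℝ} {a b δ : ℝ} (hab : a ≤ b) (hδ : 0 < δ)
    (h : ∀ c d, a ≤ c → c ≤ d → d ≤ b → d - c < δ → G d ≤ G c) : G b ≤ G a := by
  obtain ⟨n, hn⟩ := exists_nat_gt ((b - a) / δ)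
  have hn0 : (0 : ℝ) < n := lt_of_le_of_lt (div_nonneg (sub_nonneg.2 hab) hδ.le) hn
  set σ := (b - a) / n with hσ
  have hσ0 : 0 ≤ σ := div_nonneg (sub_nonneg.2 hab) hn0.le
  have hnσ : n * σ = b - a := mul_div_cancel₀ _ hn0.ne'
  have hσδ : σ < δ := by
    rw [hσ, div_lt_iff₀ hn0]
    rwa [div_lt_iff₀ hδ, mul_comm] at hn
  have key : ∀ k : ℕ, k ≤ n → G (a + k * σ) ≤ G a := by
    intro k
    induction k with
    | zero => simp
    | succ k ih =>
      intro hk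
      have hk' : ((k : ℝ) + 1) * σ ≤ n * σ := by
        gcongr
        exact_mod_cast hk
      have hkσ : 0 ≤ (k : ℝ) * σ := by positivity
      refine (h (a + k * σ) _ (by linarith) ?_ ?_ ?_).trans (ih (by omega)) <;> push_cast <;>
        linarith
  have := key n le_rfl
  rwa [hnσ, add_sub_cancel] at this

variable {H : Type*} [NormedAddCommGroup H] [InnerProductSpace ℝ H]

/-- Formally the derivative of ‖w‖² is 2⟨h, w⟩ ≤ 0. Instead of differentiating, write ‖w d‖² - ‖w
c‖² as ∫ ⟨w d + w c, h⟩ and replace w d + w c by 2 w s on short intervals. Uniform continuity makes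
the error at most 2ε ∫ ‖h‖; sum over a partition and let ε → 0. -/
theorem norm_le_of_integral_eq [CompleteSpace H] {w h : ℝ → H} {a b : ℝ} (hab : a ≤ b)
    (hw : ContinuousOn w (Set.Icc a b)) (hh : IntegrableOn h (Set.Icc a b))
    (hwh : ∀ c d, a ≤ c → c ≤ d → d ≤ b → w d - w c = ∫ s in c..d, h s)
    (hneg : ∀ᵐ s ∂volume.restrict (Set.Icc a b), inner ℝ (h s) (w s) ≤ 0) : ‖w b‖ ≤ ‖w a‖ := by
  have h_int : ∀ c d, a ≤ c → c ≤ d → d ≤ b → IntervalIntegrable h volume c d := by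
    intro c d hc hcd hd
    rw [intervalIntegrable_iff_integrableOn_Icc_of_le hcd]
    exact hh.mono_set (Set.Icc_subset_Icc hc hd)
  have hε : ∀ ε > 0, ‖w b‖ ^ 2 ≤ ‖w a‖ ^ 2 + ε * (2 * ∫ s in a..b, ‖h s‖) := by
    intro ε hε
    obtain ⟨δ, hδ, hδw⟩ := Metric.uniformContinuousOn_iff.1
      (isCompact_Icc.uniformContinuousOn_of_continuous hw) ε hε
    have hG := le_of_locally_antitone (G := fun t => ‖w t‖ ^ 2 - ε * (2 * ∫ s in a..t, ‖h s‖))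
      hab hδ (by
        intro c d hc hcd hd hdc
        have e1 : ‖w d‖ ^ 2 - ‖w c‖ ^ 2 = ∫ s in c..d, inner ℝ (w d + w c) (h s) := by
          rw [intervalIntegral.integral_of_le hcd,
            integral_inner ((intervalIntegrable_iff_integrableOn_Ioc_of_le hcd).1
              (h_int c d hc hcd hd)), ← intervalIntegral.integral_of_le hcd, ← hwh c d hc hcd hd,
            inner_add_left, inner_sub_right, inner_sub_right, real_inner_self_eq_norm_sq,
            real_inner_self_eq_norm_sq, real_inner_comm (w d) (w c)]
          ring
        have e2 : ∫ s in c..d, inner ℝ (w d + w c) (h s) ≤ ∫ s in c..d, ε * (2 * ‖h s‖) := by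
          refine intervalIntegral.integral_mono_ae_restrict hcd ?_ ?_ ?_
          · rw [intervalIntegrable_iff_integrableOn_Ioc_of_le hcd]
            exact Integrable.const_inner _ ((intervalIntegrable_iff_integrableOn_Ioc_of_le hcd).1
              (h_int c d hc hcd hd))
          · exact ((h_int c d hc hcd hd).norm.const_mul 2).const_mul ε
          · have hsub : Set.Icc c d ⊆ Set.Icc a b := Set.Icc_subset_Icc hc hd
            filter_upwards [ae_restrict_of_ae_restrict_of_subset hsub hneg,
              ae_restrict_mem measurableSet_Icc] with s hs hscd
            have hd1 := (hδw d ⟨hc.trans hcd, hd⟩ s (hsub hscd) (by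
              rw [Real.dist_eq, abs_of_nonneg (by linarith [hscd.2])]; linarith [hscd.1])).le
            have hc1 := (hδw c ⟨hc, hcd.trans hd⟩ s (hsub hscd) (by
              rw [Real.dist_eq, abs_sub_comm, abs_of_nonneg (by linarith [hscd.1])]
              linarith [hscd.2])).le
            rw [dist_eq_norm] at hd1 hc1
            have e3 : inner ℝ (w d + w c) (h s) = inner ℝ (w d - w s) (h s) +
                inner ℝ (w c - w s) (h s) + 2 * inner ℝ (h s) (w s) := by
              rw [inner_add_left, inner_sub_left, inner_sub_left, real_inner_comm (h s) (w s)]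
              ring
            have h1 := (real_inner_le_norm (w d - w s) (h s)).trans
              (mul_le_mul_of_nonneg_right hd1 (norm_nonneg _))
            have h2 := (real_inner_le_norm (w c - w s) (h s)).trans
              (mul_le_mul_of_nonneg_right hc1 (norm_nonneg _))
            change inner ℝ (w d + w c) (h s) ≤ ε * (2 * ‖h s‖)
            linarith
        rw [intervalIntegral.integral_const_mul, intervalIntegral.integral_const_mul] at e2
        have e4 := intervalIntegral.integral_add_adjacent_intervals
          (h_int a c le_rfl hc (hcd.trans hd)).norm (h_int c d hc hcd hd).norm
        change ‖w d‖ ^ 2 - ε * (2 * ∫ s in a..d, ‖h s‖) ≤ ‖w c‖ ^ 2 - ε * (2 * ∫ s in a..c, ‖h s‖)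
        rw [← e4]
        linarith)
    simp only [intervalIntegral.integral_same, mul_zero, sub_zero] at hG
    linarith
  have hlim : Tendsto (fun ε : ℝ => ‖w a‖ ^ 2 + ε * (2 * ∫ s in a..b, ‖h s‖)) (𝓝[>] 0)
      (𝓝 (‖w a‖ ^ 2 + 0 * (2 * ∫ s in a..b, ‖h s‖))) :=
    ((by fun_prop : Continuous fun ε : ℝ => ‖w a‖ ^ 2 + ε * (2 * ∫ s in a..b, ‖h s‖)).tendsto
      0).mono_left nhdsWithin_le_nhds
  have := ge_of_tendsto hlim (by filter_upwards [self_mem_nhdsWithin] with ε h using hε ε h)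
  rw [zero_mul, add_zero] at this
  exact (sq_le_sq₀ (norm_nonneg _) (norm_nonneg _)).1 this

theorem inner_sub_nonneg_of_mem_subgradient {W : H → ℝ≥0∞} {u v f g : H}
    (hf : f ∈ subgradient W u) (hg : g ∈ subgradient W v) : 0 ≤ inner ℝ (f - g) (u - v) := by
  have h1 := hf.2 (v - u)
  have h2 := hg.2 (u - v)
  rw [add_sub_cancel, ← EReal.coe_ennreal_toReal hf.1.ne, ← EReal.coe_ennreal_toReal hg.1.ne,
    ← EReal.coe_add, EReal.coe_le_coe_iff] at h1 h2
  rw [← neg_sub u v, inner_neg_right] at h1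
  rw [inner_sub_left]
  linarith

theorem IsStrongSolution.eq [CompleteSpace H] {W : H → ℝ≥0∞} {x : H} {u v : ℝ≥0 → H}
    (hu : IsStrongSolution W x u) (hv : IsStrongSolution W x v) : u = v := by
  obtain ⟨huc, hu0, f, hf, hfW⟩ := hu
  obtain ⟨hvc, hv0, g, hg, hgW⟩ := hv
  have key : ∀ a b : ℝ≥0, 0 < a → a ≤ b → ‖u b - v b‖ ≤ ‖u a - v a‖ := by
    intro a b ha hab
    have hab' : (a : ℝ) ≤ b := NNReal.coe_le_coe.2 hab
    have hsub : Set.Icc (a : ℝ) b ⊆ Set.Ioi 0 := fun s hs => (NNReal.coe_pos.2 ha).trans_le hs.1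
    have hfi : IntegrableOn f (Set.Icc (a : ℝ) b) := (hf a b ha hab).1.integrable (by norm_num)
    have hgi : IntegrableOn g (Set.Icc (a : ℝ) b) := (hg a b ha hab).1.integrable (by norm_num)
    have := norm_le_of_integral_eq (w := fun s => u s.toNNReal - v s.toNNReal)
      (h := fun s => f s - g s) hab'
      ((huc.comp continuous_real_toNNReal).sub
        (hvc.comp continuous_real_toNNReal)).continuousOn (hfi.sub hgi) ?_ ?_
    · simpa using this
    · intro c d hac hcd hdb
      lift c to ℝ≥0 using a.2.trans hac
      lift d to ℝ≥0 using c.2.trans hcd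
      have hc : 0 < c := ha.trans_le hac
      have h1 := hf c d hc hcd
      have h2 := hg c d hc hcd
      have hi : ∀ k : ℝ → H, MemLp k 2 (volume.restrict (Set.Icc (c : ℝ) d)) →
          IntervalIntegrable k volume c d := fun k hk => by
        rw [intervalIntegrable_iff_integrableOn_Icc_of_le hcd]
        exact hk.integrable (by norm_num)
      rw [intervalIntegral.integral_sub (hi f h1.1) (hi g h2.1), ← h1.2, ← h2.2]
      simp only [Real.toNNReal_coe]
      abel
    · filter_upwards [ae_restrict_of_ae_restrict_of_subset hsub hfW,
        ae_restrict_of_ae_restrict_of_subset hsub hgW] with s h1 h2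
      have := inner_sub_nonneg_of_mem_subgradient h1 h2
      rw [neg_sub_neg, ← neg_sub (f s) (g s), inner_neg_left] at this
      change inner ℝ (f s - g s) (u s.toNNReal - v s.toNNReal) ≤ 0
      linarith
  funext t
  rcases (zero_le (a := t)).eq_or_lt with rfl | ht
  · rw [hu0, hv0]
  -- The equation holds only on the open half-line, so the comparison starts at a > 0 and continuity
  -- at 0 brings in the common initial value.
  have hlim : Tendsto (fun a : ℝ≥0 => ‖u a - v a‖) (𝓝[>] 0) (𝓝 ‖u 0 - v 0‖) :=
    ((huc.sub hvc).norm.tendsto 0).mono_left nhdsWithin_le_nhds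
  have hle := ge_of_tendsto hlim (b := ‖u t - v t‖) (by
    filter_upwards [Ioo_mem_nhdsGT ht] with a ha using key a t ha.1 ha.2.le)
  rw [hu0, hv0, sub_self, norm_zero] at hle
  exact sub_eq_zero.1 (norm_le_zero_iff.1 hle)

theorem Generates.eq [CompleteSpace H] {W : H → ℝ≥0∞} {S T : ContractionSemigroup H}
    (hS : Generates W S) (hT : Generates W T) : S = T := by
  ext t u
  exact congrFun ((hS u).eq (hT u)) t

theorem IsConvexEnergy.existsUnique_generates [CompleteSpace H] {W : H → ℝ≥0∞}
    (hW : IsConvexEnergy W) : ∃! S, Generates W S :=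
  ⟨hW.semigroup, hW.generates, fun _ hS => hS.eq hW.generates⟩

theorem Generates.toFun_eq_flow [CompleteSpace H] {W : H → ℝ≥0∞} (hW : IsConvexEnergy W)
    {S : ContractionSemigroup H} (hS : Generates W S) : S.toFun = flow W := by
  rw [hS.eq hW.generates]
  rfl

end Uniqueness

/-! ### Reflection of energies -/

section Reflection

variable {H : Type*} [NormedAddCommGroup H] [InnerProductSpace ℝ H] {W : H → ℝ≥0∞}

theorem IsConvexEnergy.comp_neg (hW : IsConvexEnergy W) : IsConvexEnergy fun u => W (-u) where
  convex := ⟨convex_univ, fun x _ y _ a b ha hb hab => by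
    have := hW.convex.2 (Set.mem_univ (-x)) (Set.mem_univ (-y)) ha hb hab
    rwa [smul_neg, smul_neg, ← neg_add] at this⟩
  lsc := hW.lsc.comp continuous_neg
  dense := hW.dense.preimage (Homeomorph.neg H).isOpenMap

theorem IsProx.comp_neg {H : Type*} [NormedAddCommGroup H] {W : H → ℝ≥0∞} {τ : ℝ} {x z : H}
    (h : IsProx W τ (-x) z) :
    IsProx (fun u => W (-u)) τ x (-z) := by
  refine ⟨by simpa using h.1, fun v hv => ?_⟩
  have := h.2 (-v) hv
  simp only [neg_neg]
  rwa [← norm_neg (z - -v), ← norm_neg (-x - -v), ← norm_neg (z - -x),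
    show -(z - -v) = -z - v by abel, show -(-x - -v) = x - v by abel,
    show -(z - -x) = -z - x by abel] at this

theorem IsConvexEnergy.resolvent_comp_neg [CompleteSpace H] (hW : IsConvexEnergy W) {τ : ℝ}
    (hτ : 0 < τ) (x : H) : resolvent (fun u => W (-u)) τ x = -resolvent W τ (-x) :=
  (hW.comp_neg.isProx_resolvent hτ x).eq (hW.isProx_resolvent hτ (-x)).comp_neg

theorem IsConvexEnergy.flow_comp_neg [CompleteSpace H] (hW : IsConvexEnergy W) (t : ℝ≥0) (x : H) :
    flow (fun u => W (-u)) t x = -flow W t (-x) := by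
  refine tendsto_nhds_unique (hW.comp_neg.tendsto_euler t x)
    ((hW.tendsto_euler t (-x)).neg.congr fun k => ?_)
  unfold euler
  generalize ⌊(t : ℝ) * 2 ^ k⌋₊ = n
  induction n generalizing x with
  | zero => simp
  | succ n ih =>
    rw [Function.iterate_succ_apply, Function.iterate_succ_apply, ← ih,
      hW.resolvent_comp_neg (by positivity), neg_neg]

end Reflection

/-! ### Comparison of gradient flows on `L²` -/

section Comparison

/-- Test the two variational inequalities with a' and b' and add: the hypotheses leave ‖a - a'‖² +
‖b - b'‖² ≤ 0. -/
theorem IsProx.eq_of_exchange {H : Type*} [NormedAddCommGroup H] [InnerProductSpace ℝ H]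
    {W₁ W₂ : H → ℝ≥0∞} {τ : ℝ} (hτ : 0 < τ) {u v a b a' b' : H} (ha : IsProx W₁ τ u a)
    (hb : IsProx W₂ τ v b) (hW : W₁ a' + W₂ b' ≤ W₁ a + W₂ b)
    (hn : ‖a' - u‖ ^ 2 + ‖b' - v‖ ^ 2 ≤ ‖a - u‖ ^ 2 + ‖b - v‖ ^ 2) : a' = a ∧ b' = b := by
  have hfin : W₁ a + W₂ b ≠ ⊤ := ENNReal.add_ne_top.2 ⟨ha.1, hb.1⟩
  obtain ⟨ha', hb'⟩ := ENNReal.add_ne_top.1 (ne_top_of_le_ne_top hfin hW)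
  have hWr := ENNReal.toReal_mono hfin hW
  rw [ENNReal.toReal_add ha' hb', ENNReal.toReal_add ha.1 hb.1] at hWr
  have h1 := ha.2 a' ha'
  have h2 := hb.2 b' hb'
  rw [norm_sub_rev u a'] at h1
  rw [norm_sub_rev v b'] at h2
  have h3 : ‖a - a'‖ ^ 2 + ‖b - b'‖ ^ 2 ≤ 0 := by nlinarith
  have h4 : ‖a - a'‖ ^ 2 = 0 := by nlinarith [sq_nonneg ‖a - a'‖, sq_nonneg ‖b - b'‖]
  have h5 : ‖b - b'‖ ^ 2 = 0 := by nlinarith [sq_nonneg ‖a - a'‖, sq_nonneg ‖b - b'‖]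
  rw [sq_eq_zero_iff, norm_eq_zero, sub_eq_zero] at h4 h5
  exact ⟨h4.symm, h5.symm⟩

theorem isProx_zero_zero {H : Type*} [NormedAddCommGroup H] [InnerProductSpace ℝ H]
    {W : H → ℝ≥0∞} (h0 : W 0 = 0) {τ : ℝ} (hτ : 0 < τ) : IsProx W τ 0 0 := by
  refine ⟨by simp [h0], fun v _ => ?_⟩
  rw [h0]
  simp only [zero_sub, norm_neg, sub_self, norm_zero, ENNReal.toReal_zero, sub_zero]
  nlinarith [mul_nonneg hτ.le (ENNReal.toReal_nonneg (a := W v))]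

variable {X : Type*} [MeasurableSpace X] {μ : Measure X}

theorem norm_sq_eq_integral (f : Lp ℝ 2 μ) : ‖f‖ ^ 2 = ∫ x, f x ^ 2 ∂μ := by
  rw [← real_inner_self_eq_norm_sq, L2.inner_def]
  refine integral_congr_ae (Eventually.of_forall fun x => ?_)
  simp [sq]

theorem norm_sq_add_norm_sq_le {f g f' g' : Lp ℝ 2 μ}
    (h : ∀ᵐ x ∂μ, f' x ^ 2 + g' x ^ 2 ≤ f x ^ 2 + g x ^ 2) :
    ‖f'‖ ^ 2 + ‖g'‖ ^ 2 ≤ ‖f‖ ^ 2 + ‖g‖ ^ 2 := by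
  have hi : ∀ k : Lp ℝ 2 μ, Integrable (fun x => k x ^ 2) μ := fun k => (Lp.memLp k).integrable_sq
  simp only [norm_sq_eq_integral]
  rw [← integral_add (hi _) (hi _), ← integral_add (hi _) (hi _)]
  exact integral_mono_ae ((hi _).add (hi _)) ((hi _).add (hi _)) h

theorem inf_sub_sq_add_sup_sub_sq_le {a b u v : ℝ} (h : u ≤ v) :
    (a ⊓ b - u) ^ 2 + (a ⊔ b - v) ^ 2 ≤ (a - u) ^ 2 + (b - v) ^ 2 := by
  rcases le_total a b with hab | hab
  · rw [inf_eq_left.2 hab, sup_eq_right.2 hab]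
  · rw [inf_eq_right.2 hab, sup_eq_left.2 hab]
    nlinarith [mul_nonneg (sub_nonneg.2 hab) (sub_nonneg.2 h)]

/-- If |a| ≤ b nothing moves. Otherwise a and b trade places, up to a sign, and |u| ≤ v makes the
trade favourable. -/
theorem truncation_sub_sq_le {a b u v : ℝ} (hb : 0 ≤ b) (h : |u| ≤ v) :
    ((a ⊓ b) ⊔ -b - u) ^ 2 + (|a| ⊔ b - v) ^ 2 ≤ (a - u) ^ 2 + (b - v) ^ 2 := by
  obtain ⟨h1, h2⟩ := abs_le.1 h
  rcases le_total b a with hab | hab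
  · rw [inf_eq_right.2 hab, sup_eq_left.2 (by linarith), abs_of_nonneg (hb.trans hab),
      sup_eq_left.2 hab]
    nlinarith [mul_nonneg (sub_nonneg.2 hab) (sub_nonneg.2 h2)]
  · rw [inf_eq_left.2 hab]
    rcases le_total a (-b) with hab' | hab'
    · rw [sup_eq_right.2 hab', abs_of_nonpos (by linarith), sup_eq_left.2 (by linarith)]
      nlinarith [mul_nonneg (sub_nonneg.2 hab') (sub_nonneg.2 h1)]
    · rw [sup_eq_left.2 hab', sup_eq_right.2 (abs_le.2 ⟨hab', hab⟩)]

variable {W W₁ W₂ : Lp ℝ 2 μ → ℝ≥0∞}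

theorem IsConvexEnergy.resolvent_mono (hW : IsConvexEnergy W)
    (hsub : ∀ a b, W (a ⊓ b) + W (a ⊔ b) ≤ W a + W b) {τ : ℝ} (hτ : 0 < τ) :
    Monotone (resolvent W τ) := by
  intro u v huv
  refine inf_eq_left.1 (IsProx.eq_of_exchange hτ (hW.isProx_resolvent hτ u)
    (hW.isProx_resolvent hτ v) (hsub _ _) (norm_sq_add_norm_sq_le ?_)).1
  set a := resolvent W τ u
  set b := resolvent W τ v
  filter_upwards [Lp.coeFn_sub (a ⊓ b) u, Lp.coeFn_sub (a ⊔ b) v, Lp.coeFn_sub a u,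
    Lp.coeFn_sub b v, Lp.coeFn_inf a b, Lp.coeFn_sup a b, Lp.coeFn_le u v |>.2 huv]
    with x h1 h2 h3 h4 h5 h6 h7
  rw [h1, h2, h3, h4, Pi.sub_apply, Pi.sub_apply, Pi.sub_apply, Pi.sub_apply, h5, h6]
  exact inf_sub_sq_add_sup_sub_sq_le h7

theorem IsConvexEnergy.abs_resolvent_le (hW₁ : IsConvexEnergy W₁) (hW₂ : IsConvexEnergy W₂)
    (hdom : ∀ a b, 0 ≤ b → W₁ ((a ⊓ b) ⊔ -b) + W₂ (|a| ⊔ b) ≤ W₁ a + W₂ b) {τ : ℝ} (hτ : 0 < τ)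
    {u v : Lp ℝ 2 μ} (huv : |u| ≤ v) (hpos : 0 ≤ resolvent W₂ τ v) :
    |resolvent W₁ τ u| ≤ resolvent W₂ τ v := by
  refine sup_eq_right.1 (IsProx.eq_of_exchange hτ (hW₁.isProx_resolvent hτ u)
    (hW₂.isProx_resolvent hτ v) (hdom _ _ hpos) (norm_sq_add_norm_sq_le ?_)).2
  set a := resolvent W₁ τ u
  set b := resolvent W₂ τ v
  filter_upwards [Lp.coeFn_sub ((a ⊓ b) ⊔ -b) u, Lp.coeFn_sub (|a| ⊔ b) v, Lp.coeFn_sub a u,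
    Lp.coeFn_sub b v, Lp.coeFn_inf a b, Lp.coeFn_sup (a ⊓ b) (-b), Lp.coeFn_neg b,
    Lp.coeFn_sup |a| b, Lp.coeFn_abs a, Lp.coeFn_abs u, Lp.coeFn_le |u| v |>.2 huv,
    (Lp.coeFn_nonneg b).2 hpos] with x h1 h2 h3 h4 h5 h6 h7 h8 h9 h10 h11 h12
  rw [h1, h2, h3, h4, Pi.sub_apply, Pi.sub_apply, Pi.sub_apply, Pi.sub_apply, h6, h8,
    Pi.sup_apply, Pi.sup_apply, h5, h7, h9, Pi.inf_apply, Pi.neg_apply]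
  rw [h10] at h11
  exact truncation_sub_sq_le h12 h11

theorem IsConvexEnergy.flow_orderPreserving (hW : IsConvexEnergy W)
    (hsub : ∀ a b, W (a ⊓ b) + W (a ⊔ b) ≤ W a + W b) : OrderPreserving (flow W) :=
  fun t u v huv => le_of_tendsto_of_tendsto' (hW.tendsto_euler t u) (hW.tendsto_euler t v)
    fun _ => (hW.resolvent_mono hsub (by positivity)).iterate _ huv

theorem IsConvexEnergy.resolvent_nonneg (hW : IsConvexEnergy W) (h0 : W 0 = 0)
    (hsub : ∀ a b, W (a ⊓ b) + W (a ⊔ b) ≤ W a + W b) {τ : ℝ} (hτ : 0 < τ) {u : Lp ℝ 2 μ}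
    (hu : 0 ≤ u) : 0 ≤ resolvent W τ u := by
  have h := hW.resolvent_mono hsub hτ hu
  rwa [(hW.isProx_resolvent hτ 0).eq (isProx_zero_zero h0 hτ)] at h

theorem IsConvexEnergy.flow_isPositive (hW : IsConvexEnergy W) (h0 : W 0 = 0)
    (hsub : ∀ a b, W (a ⊓ b) + W (a ⊔ b) ≤ W a + W b) : IsPositive (flow W) := by
  refine fun t u hu => ge_of_tendsto' (hW.tendsto_euler t u) fun k => ?_
  unfold euler
  generalize ⌊(t : ℝ) * 2 ^ k⌋₊ = n
  induction n with
  | zero => exact hu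
  | succ n ih =>
    rw [Function.iterate_succ_apply']
    exact hW.resolvent_nonneg h0 hsub (by positivity) ih

/-- Domination is propagated through the Euler steps, both schemes having the same mesh and the same
number of steps, and the order relation is closed under limits. -/
theorem IsConvexEnergy.flow_dominatedBy (hW₁ : IsConvexEnergy W₁) (hW₂ : IsConvexEnergy W₂)
    (h0 : W₂ 0 = 0) (hsub : ∀ a b, W₂ (a ⊓ b) + W₂ (a ⊔ b) ≤ W₂ a + W₂ b)
    (hdom : ∀ a b, 0 ≤ b → W₁ ((a ⊓ b) ⊔ -b) + W₂ (|a| ⊔ b) ≤ W₁ a + W₂ b) :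
    DominatedBy (flow W₁) (flow W₂) := by
  refine ⟨hW₂.flow_orderPreserving hsub, fun t u v huv => ?_⟩
  refine le_of_tendsto_of_tendsto' ((hW₁.tendsto_euler t u).sup_nhds
    (hW₁.tendsto_euler t u).neg) (hW₂.tendsto_euler t v) fun k => ?_
  -- The modulus in a lattice-ordered group is by definition a ⊔ -a, whose limit is the one taken
  -- above.
  change |euler W₁ k t u| ≤ _
  unfold euler
  generalize ⌊(t : ℝ) * 2 ^ k⌋₊ = n
  induction n with
  | zero => exact huv
  | succ n ih =>
    rw [Function.iterate_succ_apply', Function.iterate_succ_apply']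
    exact hW₁.abs_resolvent_le hW₂ hdom (by positivity) ih
      (hW₂.resolvent_nonneg h0 hsub (by positivity) ((abs_nonneg _).trans ih))

theorem IsConvexEnergy.flow_totallyDominatedBy (hW₁ : IsConvexEnergy W₁)
    (hW₂ : IsConvexEnergy W₂) (h0 : W₂ 0 = 0)
    (hsub : ∀ a b, W₂ (a ⊓ b) + W₂ (a ⊔ b) ≤ W₂ a + W₂ b)
    (hdom : ∀ a b, 0 ≤ b → W₁ ((a ⊓ b) ⊔ -b) + W₂ (|a| ⊔ b) ≤ W₁ a + W₂ b)
    (hdom' : ∀ a b, 0 ≤ b → W₁ ((a ⊓ b) ⊔ -b) + W₂ (-(|a| ⊔ b)) ≤ W₁ a + W₂ (-b)) :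
    TotallyDominatedBy (flow W₁) (flow W₂) := by
  refine ⟨hW₁.flow_dominatedBy hW₂ h0 hsub hdom, ?_⟩
  have h := hW₁.flow_dominatedBy hW₂.comp_neg (by simpa using h0) (fun a b => ?_) hdom'
  · have e : (fun (t : ℝ≥0) u => -flow W₂ t (-u)) = flow fun u => W₂ (-u) :=
      funext fun t => funext fun u => (hW₂.flow_comp_neg t u).symm
    rwa [e]
  · have := hsub (-a) (-b)
    rwa [← neg_sup, ← neg_inf, add_comm] at this

end Comparison

/-! ### Self-similarity of the gasket -/

section SelfSimilar

variable {E : Type*} [NormedAddCommGroup E] [NormedSpace ℝ E] {N : ℕ} {p : Fin N → E}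

theorem continuous_similarity (i : Fin N) : Continuous (similarity p i) := by
  unfold similarity
  fun_prop

theorem similarity_injective (i : Fin N) : Function.Injective (similarity p i) := by
  intro x y h
  simpa [similarity] using h

theorem similarity_mem_levelSet {m : ℕ} {x : E} (i : Fin N) (hx : x ∈ levelSet p m) :
    similarity p i x ∈ levelSet p (m + 1) := by
  classical
  simp only [levelSet, Finset.mem_biUnion, Finset.mem_univ, true_and, Finset.mem_image]
  exact ⟨i, x, hx, rfl⟩

theorem similarity_mem_gasket (i : Fin N) {x : E} (hx : x ∈ gasket p) :
    similarity p i x ∈ gasket p := by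
  refine map_mem_closure (continuous_similarity i) hx fun y hy => ?_
  obtain ⟨m, hm⟩ := Set.mem_iUnion.1 hy
  exact Set.mem_iUnion.2 ⟨m + 1, similarity_mem_levelSet i hm⟩

/-- An induction principle for the gasket: closed conditions are checked at the p_i and under the
similarities. -/
theorem gasket_subset_of_isClosed {s : Set E} (hs : IsClosed s) (hp : ∀ i, p i ∈ s)
    (h : ∀ i, ∀ x ∈ s, similarity p i x ∈ s) : gasket p ⊆ s := by
  refine closure_minimal (Set.iUnion_subset fun m => ?_) hs
  induction m with
  | zero =>
    intro x hx
    obtain ⟨i, rfl⟩ : ∃ i, p i = x := by simpa [levelSet] using hx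
    exact hp i
  | succ m ih =>
    intro x hx
    obtain ⟨i, y, hy, rfl⟩ : ∃ i, ∃ y ∈ levelSet p m, similarity p i y = x := by
      simpa [levelSet] using hx
    exact h i y (ih hy)

/-- The similarity `F_i` as a map of the gasket into itself. -/
def cellMap (p : Fin N → E) (i : Fin N) (x : gasket p) : gasket p :=
  ⟨similarity p i x, similarity_mem_gasket i x.2⟩

/-- The map `F_w` of the gasket into itself. -/
def cellWord (p : Fin N → E) : List (Fin N) → gasket p → gasket p
  | [] => id
  | i :: w => cellMap p i ∘ cellWord p w

theorem continuous_cellMap (i : Fin N) : Continuous (cellMap p i) :=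
  ((continuous_similarity i).comp continuous_subtype_val).subtype_mk _

theorem cellMap_injective (i : Fin N) : Function.Injective (cellMap p i) := fun _ _ h =>
  Subtype.ext (similarity_injective i (congrArg Subtype.val h))

theorem dist_cellMap (i : Fin N) (x y : gasket p) :
    dist (cellMap p i x) (cellMap p i y) = 1 / 2 * dist x y := by
  rw [Subtype.dist_eq, Subtype.dist_eq]
  simp only [cellMap, similarity, dist_add_right]
  rw [dist_smul₀]
  norm_num

theorem continuous_cellWord (w : List (Fin N)) : Continuous (cellWord p w) := by
  induction w with
  | nil => exact continuous_id
  | cons i w ih => exact (continuous_cellMap i).comp ih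

theorem dist_cellWord (w : List (Fin N)) (x y : gasket p) :
    dist (cellWord p w x) (cellWord p w y) = (1 / 2) ^ w.length * dist x y := by
  induction w with
  | nil => simp [cellWord]
  | cons i w ih =>
    rw [cellWord, Function.comp_apply, Function.comp_apply, dist_cellMap, ih, List.length_cons]
    ring

theorem cellMap_vertex (i : Fin N) : cellMap p i (vertex p i) = vertex p i := by
  apply Subtype.ext
  simp only [cellMap, vertex, similarity]
  module

theorem cellMap_vertex_comm (i j : Fin N) :
    cellMap p i (vertex p j) = cellMap p j (vertex p i) := by
  apply Subtype.ext
  simp only [cellMap, vertex, similarity]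
  module

theorem coe_cellWord (w : List (Fin N)) (x : gasket p) :
    (cellWord p w x : E) = wordMap p w x := by
  induction w with
  | nil => rfl
  | cons i w ih => simp only [cellWord, wordMap, Function.comp_apply, cellMap, ih]

theorem mem_gasketLevel {m : ℕ} {x : gasket p} : x ∈ gasketLevel p m ↔ (x : E) ∈ levelSet p m := by
  classical
  simp [gasketLevel]

theorem mem_gasketLevel_zero {x : gasket p} : x ∈ gasketLevel p 0 ↔ ∃ i, vertex p i = x := by
  rw [mem_gasketLevel]
  simp [levelSet, vertex, Subtype.ext_iff]

theorem mem_gasketLevel_succ {m : ℕ} {x : gasket p} :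
    x ∈ gasketLevel p (m + 1) ↔ ∃ i, ∃ y ∈ gasketLevel p m, cellMap p i y = x := by
  rw [mem_gasketLevel]
  constructor
  · intro hx
    obtain ⟨i, y, hy, h⟩ : ∃ i, ∃ y ∈ levelSet p m, similarity p i y = x := by
      simpa [levelSet] using hx
    exact ⟨i, ⟨y, levelSet_subset_gasket p m hy⟩, mem_gasketLevel.2 hy, Subtype.ext h⟩
  · rintro ⟨i, y, hy, rfl⟩
    exact similarity_mem_levelSet i (mem_gasketLevel.1 hy)

theorem vertex_mem_gasketLevel (i : Fin N) (m : ℕ) : vertex p i ∈ gasketLevel p m := by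
  induction m with
  | zero => exact mem_gasketLevel_zero.2 ⟨i, rfl⟩
  | succ m ih => exact mem_gasketLevel_succ.2 ⟨i, _, ih, cellMap_vertex i⟩

theorem dense_iUnion_gasketLevel : Dense (⋃ m, (gasketLevel p m : Set (gasket p))) := by
  intro x
  have hx : (x : E) ∈ closure (⋃ m, (levelSet p m : Set E)) := x.2
  rw [closure_subtype]
  convert hx using 1
  congr 1
  ext y
  simp only [Set.mem_image, Set.mem_iUnion, Finset.mem_coe, mem_gasketLevel]
  constructor
  · rintro ⟨z, ⟨m, hm⟩, rfl⟩
    exact ⟨m, hm⟩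
  · rintro ⟨m, hm⟩
    exact ⟨⟨y, levelSet_subset_gasket p m hm⟩, ⟨m, hm⟩, rfl⟩

theorem isCompact_gasket [ProperSpace E] : IsCompact (gasket p) := by
  obtain ⟨R, hR⟩ := (Set.finite_range p).isBounded.subset_closedBall 0
  refine (isCompact_closedBall (0 : E) R).of_isClosed_subset isClosed_closure
    (gasket_subset_of_isClosed Metric.isClosed_closedBall (fun i => hR ⟨i, rfl⟩)
      fun i x hx => ?_)
  have hpi := hR ⟨i, rfl⟩
  exact convex_closedBall (0 : E) R hx hpi (by norm_num) (by norm_num) (by norm_num)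

instance [ProperSpace E] : CompactSpace (gasket p) := isCompact_iff_compactSpace.1 isCompact_gasket

theorem exists_cellMap_eq [ProperSpace E] (x : gasket p) : ∃ i y, cellMap p i y = x := by
  have hcl : IsClosed (⋃ i, Set.range (cellMap p i)) :=
    isClosed_iUnion_of_finite fun i => (isCompact_range (continuous_cellMap i)).isClosed
  have hsub : (⋃ m, (gasketLevel p m : Set (gasket p))) ⊆ ⋃ i, Set.range (cellMap p i) := by
    refine Set.iUnion_subset fun m y hy => ?_
    cases m with
    | zero =>
      obtain ⟨i, rfl⟩ := mem_gasketLevel_zero.1 hy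
      exact Set.mem_iUnion.2 ⟨i, _, cellMap_vertex i⟩
    | succ m =>
      obtain ⟨i, z, -, rfl⟩ := mem_gasketLevel_succ.1 hy
      exact Set.mem_iUnion.2 ⟨i, z, rfl⟩
  have := closure_minimal hsub hcl (dense_iUnion_gasketLevel x)
  simpa using this

theorem exists_cellWord_eq [ProperSpace E] (m : ℕ) (x : gasket p) :
    ∃ w y, w.length = m ∧ cellWord p w y = x := by
  induction m generalizing x with
  | zero => exact ⟨[], x, rfl, rfl⟩
  | succ m ih =>
    obtain ⟨i, y, rfl⟩ := exists_cellMap_eq x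
    obtain ⟨w, z, rfl, rfl⟩ := ih y
    exact ⟨i :: w, z, rfl, rfl⟩

/-- The cells of level `m` that contain `x` form a neighbourhood of `x`. -/
theorem eventually_mem_cell [ProperSpace E] (m : ℕ) (x : gasket p) :
    ∀ᶠ y in 𝓝 x, ∃ w x' y', w.length = m ∧ cellWord p w x' = x ∧ cellWord p w y' = y := by
  set T : Set (List (Fin N)) := {w | w.length = m ∧ x ∉ Set.range (cellWord p w)}
  have hT : T.Finite := (List.finite_length_eq (Fin N) m).subset fun w hw => hw.1
  have hcl : IsClosed (⋃ w ∈ T, Set.range (cellWord p w)) :=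
    hT.isClosed_biUnion fun w _ => (isCompact_range (continuous_cellWord w)).isClosed
  have hx : x ∈ (⋃ w ∈ T, Set.range (cellWord p w))ᶜ := by
    simp only [Set.mem_compl_iff, Set.mem_iUnion, not_exists]
    exact fun w hw => hw.2
  filter_upwards [hcl.isOpen_compl.mem_nhds hx] with y hy
  obtain ⟨w, y', hw, rfl⟩ := exists_cellWord_eq m y
  simp only [Set.mem_compl_iff, Set.mem_iUnion, not_exists] at hy
  have h1 := hy w
  have h2 : x ∈ Set.range (cellWord p w) := by
    by_contra hcon
    exact h1 ⟨hw, hcon⟩ ⟨y', rfl⟩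
  obtain ⟨x', hx'⟩ := h2
  exact ⟨w, x', y', hw, hx', rfl⟩

theorem sameCell_iff {m : ℕ} {x y : gasket p} : SameCell p m x y ↔
    ∃ w x' y', w.length = m ∧ cellWord p w x' = x ∧ cellWord p w y' = y := by
  constructor
  · rintro ⟨w, hw, ⟨x', hx', hx⟩, ⟨y', hy', hy⟩⟩
    exact ⟨w, ⟨x', hx'⟩, ⟨y', hy'⟩, hw, Subtype.ext (by rw [coe_cellWord]; exact hx),
      Subtype.ext (by rw [coe_cellWord]; exact hy)⟩
  · rintro ⟨w, x', y', hw, rfl, rfl⟩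
    exact ⟨w, hw, ⟨x', x'.2, (coe_cellWord w x').symm⟩, ⟨y', y'.2, (coe_cellWord w y').symm⟩⟩

theorem sameCell_zero (x y : gasket p) : SameCell p 0 x y :=
  sameCell_iff.2 ⟨[], x, y, rfl, rfl, rfl⟩

theorem sameCell_succ {m : ℕ} {x y : gasket p} : SameCell p (m + 1) x y ↔
    ∃ i x' y', cellMap p i x' = x ∧ cellMap p i y' = y ∧ SameCell p m x' y' := by
  rw [sameCell_iff]
  constructor
  · rintro ⟨w, x', y', hw, rfl, rfl⟩
    obtain ⟨i, v, rfl⟩ := List.exists_cons_of_length_eq_add_one hw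
    exact ⟨i, cellWord p v x', cellWord p v y', rfl, rfl,
      sameCell_iff.2 ⟨v, x', y', by simpa using hw, rfl, rfl⟩⟩
  · rintro ⟨i, x', y', rfl, rfl, h⟩
    obtain ⟨w, x'', y'', hw, rfl, rfl⟩ := sameCell_iff.1 h
    exact ⟨i :: w, x'', y'', by simp [hw], rfl, rfl⟩

end SelfSimilar

/-! ### Regular simplices -/

section Simplex

variable {E : Type*} [NormedAddCommGroup E] [InnerProductSpace ℝ E] {N : ℕ} {p : Fin N → E}

/-- The `i`-th barycentric coordinate with respect to the regular simplex `p`. -/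
def bary (p : Fin N → E) (i : Fin N) (x : E) : ℝ :=
  1 - 2 / N * inner ℝ (x - p i) (∑ k, (p k - p i))

theorem continuous_bary (i : Fin N) : Continuous (bary p i) := by
  unfold bary
  fun_prop

theorem bary_similarity (i j : Fin N) (x : E) :
    bary p i (similarity p j x) = 1 / 2 * bary p i x + 1 / 2 * bary p i (p j) := by
  have e : similarity p j x - p i = (1 / 2 : ℝ) • (x - p i) + (1 / 2 : ℝ) • (p j - p i) := by
    unfold similarity
    module
  unfold bary
  rw [e, inner_add_left, real_inner_smul_left, real_inner_smul_left]
  ring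

theorem bary_self (i : Fin N) : bary p i (p i) = 1 := by simp [bary]

theorem bary_of_ne (hp : ∀ i j, i ≠ j → ‖p i - p j‖ = 1) {i j : Fin N} (hij : i ≠ j) :
    bary p i (p j) = 0 := by
  have hN : (N : ℝ) ≠ 0 := by
    have := i.pos
    positivity
  have h1 : ∀ k, inner ℝ (p j - p i) (p k - p i) =
      1 / 2 * (1 + (if k = i then 0 else 1) - (if k = j then 0 else 1)) := by
    intro k
    have e : p j - p k = (p j - p i) - (p k - p i) := by abel
    have h := norm_sub_sq_real (p j - p i) (p k - p i)
    rw [← e, hp j i hij.symm] at h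
    have hki : ‖p k - p i‖ ^ 2 = if k = i then 0 else 1 := by
      split_ifs with hk
      · simp [hk]
      · rw [hp k i hk, one_pow]
    have hjk : ‖p j - p k‖ ^ 2 = if k = j then 0 else 1 := by
      split_ifs with hk
      · simp [hk]
      · rw [hp j k (Ne.symm hk), one_pow]
    rw [hki, hjk] at h
    linarith
  have h2 : ∀ l : Fin N, ∑ k : Fin N, (if k = l then (0 : ℝ) else 1) = N - 1 := by
    intro l
    have : ∀ k : Fin N, (if k = l then (0 : ℝ) else 1) = 1 - if k = l then 1 else 0 := by
      intro k; split_ifs <;> simp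
    simp [this]
  unfold bary
  rw [inner_sum, Finset.sum_congr rfl fun k _ => h1 k, ← Finset.mul_sum, Finset.sum_sub_distrib,
    Finset.sum_add_distrib, h2, h2]
  simp
  field_simp
  norm_num

/-- Both conditions are closed, hold at the vertices and survive averaging with a vertex. The second
bounds the distance to p_i by the defect of the coordinate, so that coordinate 1 is attained only at
p_i. -/
theorem bary_bounds (hp : ∀ i j, i ≠ j → ‖p i - p j‖ = 1) (i : Fin N) {x : E}
    (hx : x ∈ gasket p) : 0 ≤ bary p i x ∧ ‖x - p i‖ ≤ 1 - bary p i x := by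
  have hcl : IsClosed {x | 0 ≤ bary p i x ∧ ‖x - p i‖ ≤ 1 - bary p i x} :=
    (isClosed_le continuous_const (continuous_bary i)).inter
      (isClosed_le (by fun_prop) (continuous_const.sub (continuous_bary i)))
  have hv : ∀ j, p j ∈ {x | 0 ≤ bary p i x ∧ ‖x - p i‖ ≤ 1 - bary p i x} := by
    intro j
    rcases eq_or_ne i j with rfl | hij
    · simp [bary_self]
    · simp [bary_of_ne hp hij, hp j i hij.symm]
  refine gasket_subset_of_isClosed hcl hv (fun j x hx => ?_) hx
  have hj := hv j
  simp only [Set.mem_ofPred_eq] at hx hj ⊢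
  rw [bary_similarity]
  have e : similarity p j x - p i = (1 / 2 : ℝ) • (x - p i) + (1 / 2 : ℝ) • (p j - p i) := by
    unfold similarity
    module
  have hn : ‖similarity p j x - p i‖ ≤ 1 / 2 * ‖x - p i‖ + 1 / 2 * ‖p j - p i‖ := by
    rw [e]
    refine (norm_add_le _ _).trans_eq ?_
    rw [norm_smul, norm_smul, Real.norm_of_nonneg (by norm_num)]
  exact ⟨by linarith [hx.1, hj.1], by linarith [hx.2, hj.2]⟩

/-- On cell i the i-th coordinate is at least 1/2, on cell j at most 1/2. At a common point equality
forces y to have coordinate 1, so two distinct cells share at most one point. -/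
theorem eq_vertex_of_cellMap_eq (hp : ∀ i j, i ≠ j → ‖p i - p j‖ = 1) {i j : Fin N} (hij : i ≠ j)
    {x y : gasket p} (h : cellMap p i x = cellMap p j y) : y = vertex p i := by
  have h' : similarity p i x = similarity p j y := congrArg Subtype.val h
  have h1 := congrArg (bary p i) h'
  rw [bary_similarity, bary_similarity, bary_self, bary_of_ne hp hij] at h1
  have hx := bary_bounds hp i x.2
  have hy := bary_bounds hp i y.2
  have : ‖(y : E) - p i‖ ≤ 0 := by linarith [hx.1, hy.2]
  exact Subtype.ext (sub_eq_zero.1 (norm_le_zero_iff.1 this))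

theorem vertex_injective (hp : ∀ i j, i ≠ j → ‖p i - p j‖ = 1) :
    Function.Injective (vertex p) := by
  intro i j h
  by_contra hij
  have h1 : p i = p j := congrArg Subtype.val h
  have h2 := hp i j hij
  rw [h1, sub_self, norm_zero] at h2
  exact zero_ne_one h2

/-! ### The energies of level `m` -/

open Classical in
/-- The pairs of distinct vertices of level `m` in a common cell. -/
def edges (p : Fin N → E) (m : ℕ) : Finset (gasket p × gasket p) :=
  (gasketLevel p m ×ˢ gasketLevel p m).filter fun q => q.1 ≠ q.2 ∧ SameCell p m q.1 q.2

theorem mem_edges {m : ℕ} {q : gasket p × gasket p} : q ∈ edges p m ↔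
    q.1 ∈ gasketLevel p m ∧ q.2 ∈ gasketLevel p m ∧ q.1 ≠ q.2 ∧ SameCell p m q.1 q.2 := by
  classical
  simp [edges, and_assoc]

theorem levelEnergy_eq_sum_edges (m : ℕ) (u : gasket p → ℝ) :
    levelEnergy p m u = 1 / 2 * (((N : ℝ) + 2) / N) ^ m * ∑ q ∈ edges p m, (u q.1 - u q.2) ^ 2 := by
  classical
  unfold levelEnergy edges
  rw [Finset.sum_filter, Finset.sum_product]
  congr 1
  refine Finset.sum_congr rfl fun x _ => Finset.sum_congr rfl fun y _ => ?_
  by_cases hxy : x = y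
  · simp [hxy]
  · simp [hxy]

theorem mem_gasketLevel_of_cellMap_mem (hp : ∀ i j, i ≠ j → ‖p i - p j‖ = 1) {m : ℕ} {i : Fin N}
    {x : gasket p} (h : cellMap p i x ∈ gasketLevel p (m + 1)) : x ∈ gasketLevel p m := by
  obtain ⟨j, y, hy, hyx⟩ := mem_gasketLevel_succ.1 h
  rcases eq_or_ne j i with rfl | hij
  · rwa [← cellMap_injective j hyx]
  · rw [eq_vertex_of_cellMap_eq hp hij hyx]
    exact vertex_mem_gasketLevel j m

theorem levelEnergy_zero (hp : ∀ i j, i ≠ j → ‖p i - p j‖ = 1) (u : gasket p → ℝ) :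
    levelEnergy p 0 u = 1 / 2 * ∑ i, ∑ j, (u (vertex p i) - u (vertex p j)) ^ 2 := by
  classical
  have h : gasketLevel p 0 = Finset.univ.map ⟨vertex p, vertex_injective hp⟩ := by
    ext x
    simp [mem_gasketLevel_zero]
  simp [levelEnergy, sameCell_zero, h]

/-- Two cells share at most one point, so each pair of distinct neighbours lies in exactly one
first-level cell. Diagonal pairs, which may be shared, contribute nothing and are excluded from
`edges`. -/
theorem levelEnergy_succ (hp : ∀ i j, i ≠ j → ‖p i - p j‖ = 1) (m : ℕ) (u : gasket p → ℝ) :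
    levelEnergy p (m + 1) u =
      ((N : ℝ) + 2) / N * ∑ i, levelEnergy p m (fun x => u (cellMap p i x)) := by
  simp only [levelEnergy_eq_sum_edges]
  rw [← Finset.mul_sum, ← Finset.sum_product', pow_succ]
  have h : ∑ q ∈ edges p (m + 1), (u q.1 - u q.2) ^ 2 =
      ∑ r ∈ Finset.univ ×ˢ edges p m,
        (u (cellMap p r.1 r.2.1) - u (cellMap p r.1 r.2.2)) ^ 2 := by
    symm
    refine Finset.sum_nbij (fun r => (cellMap p r.1 r.2.1, cellMap p r.1 r.2.2)) ?_ ?_ ?_ ?_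
    · rintro ⟨i, x, y⟩ hr
      obtain ⟨hx, hy, hne, hc⟩ := mem_edges.1 (Finset.mem_product.1 hr).2
      exact mem_edges.2 ⟨mem_gasketLevel_succ.2 ⟨i, x, hx, rfl⟩,
        mem_gasketLevel_succ.2 ⟨i, y, hy, rfl⟩, fun h => hne (cellMap_injective i h),
        sameCell_succ.2 ⟨i, x, y, rfl, rfl, hc⟩⟩
    · rintro ⟨i, x, y⟩ hr ⟨j, x', y'⟩ - heq
      obtain ⟨-, -, hne, -⟩ := mem_edges.1 (Finset.mem_product.1 hr).2
      obtain ⟨h1, h2⟩ := Prod.mk.inj heq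
      rcases eq_or_ne i j with rfl | hij
      · exact Prod.ext rfl (Prod.ext (cellMap_injective i h1) (cellMap_injective i h2))
      · exact absurd ((eq_vertex_of_cellMap_eq hp hij.symm h1.symm).trans
          (eq_vertex_of_cellMap_eq hp hij.symm h2.symm).symm) hne
    · rintro ⟨x, y⟩ hq
      obtain ⟨hx, hy, hne, hc⟩ := mem_edges.1 hq
      obtain ⟨i, x', y', rfl, rfl, hc'⟩ := sameCell_succ.1 hc
      exact ⟨(i, x', y'), Finset.mem_product.2 ⟨Finset.mem_univ _, mem_edges.2
        ⟨mem_gasketLevel_of_cellMap_mem hp hx, mem_gasketLevel_of_cellMap_mem hp hy,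
          fun h => hne (congrArg (cellMap p i) h), hc'⟩⟩, rfl⟩
    · exact fun _ _ => rfl
  rw [h]
  ring

end Simplex

/-! ### Harmonic extension from level `0` to level `1` -/

section Harmonic

variable {N : ℕ}

/-- The harmonic extension of `c`: the value at `F_i(p_j)` for the boundary values `c`. -/
def harmonicStep (c : Fin N → ℝ) (i j : Fin N) : ℝ :=
  if i = j then c i else (c i + c j + ∑ k, c k) / (N + 2)

theorem harmonicStep_self (c : Fin N → ℝ) (i : Fin N) : harmonicStep c i i = c i := by
  simp [harmonicStep]

theorem harmonicStep_comm (c : Fin N → ℝ) (i j : Fin N) :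
    harmonicStep c i j = harmonicStep c j i := by
  unfold harmonicStep
  by_cases h : i = j
  · rw [h]
  · rw [if_neg h, if_neg (Ne.symm h), add_comm (c i)]

theorem sum_sum_sub_mul_sub (a b : Fin N → ℝ) :
    ∑ j, ∑ k, (a j - a k) * (b j - b k) = 2 * ∑ j, b j * (N * a j - ∑ k, a k) := by
  have h : ∀ j k, (a j - a k) * (b j - b k) = (b j * a j - b j * a k) +
      (b k * a k - b k * a j) := fun j k => by ring
  simp only [h, Finset.sum_add_distrib]
  rw [Finset.sum_comm (f := fun j k => b k * a k - b k * a j), ← two_mul]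
  congr 1
  refine Finset.sum_congr rfl fun j _ => ?_
  rw [Finset.sum_sub_distrib, Finset.sum_const, Finset.card_univ, Fintype.card_fin, nsmul_eq_mul,
    ← Finset.mul_sum]
  ring

theorem sum_harmonicStep (c : Fin N → ℝ) (i : Fin N) :
    ∑ k, harmonicStep c i k = (2 * N * c i + N * ∑ k, c k) / (N + 2) := by
  have h : ∀ k, harmonicStep c i k = (c i + c k + ∑ l, c l) / (N + 2) +
      if i = k then c i - (2 * c i + ∑ l, c l) / (N + 2) else 0 := by
    intro k
    unfold harmonicStep
    split_ifs with hk
    · rw [← hk]; ring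
    · ring
  have hN : (N : ℝ) + 2 ≠ 0 := by positivity
  simp only [h, Finset.sum_add_distrib, ← Finset.sum_div]
  simp
  field_simp
  ring

/-- This is the graph Laplacian inside cell i. Off the diagonal it is antisymmetric in i and j, so
the two cells meeting at F_i(p_j) = F_j(p_i) cancel: the extension is harmonic at new vertices. -/
theorem card_mul_harmonicStep_sub_sum (c : Fin N → ℝ) (i j : Fin N) :
    N * harmonicStep c i j - ∑ k, harmonicStep c i k = N / (N + 2) * (c j - c i) +
      if i = j then N / (N + 2) * (N * c i - ∑ k, c k) else 0 := by
  have hN : (N : ℝ) + 2 ≠ 0 := by positivity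
  rw [sum_harmonicStep]
  unfold harmonicStep
  split_ifs with h
  · rw [← h]; field_simp; ring
  · field_simp; ring

/-- The polarised energy of a harmonic extension depends on the boundary values only. -/
theorem sum_harmonicStep_mul (c : Fin N → ℝ) (x : Fin N → Fin N → ℝ)
    (hx : ∀ i j, x i j = x j i) :
    ∑ i, ∑ j, ∑ k, (harmonicStep c i j - harmonicStep c i k) * (x i j - x i k) =
      2 * (N / (N + 2)) * ∑ i, x i i * (N * c i - ∑ k, c k) := by
  -- A symmetric factor times an antisymmetric one; swapping i and j changes the sign of the sum.
  have h0 : ∑ i, ∑ j, x i j * (N / (N + 2) * (c j - c i)) = 0 := by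
    have h1 : ∑ i, ∑ j, x i j * (N / (N + 2) * (c j - c i)) =
        -∑ i, ∑ j, x i j * (N / (N + 2) * (c j - c i)) := by
      conv_lhs => rw [Finset.sum_comm]
      rw [← Finset.sum_neg_distrib]
      refine Finset.sum_congr rfl fun i _ => ?_
      rw [← Finset.sum_neg_distrib]
      refine Finset.sum_congr rfl fun j _ => ?_
      rw [hx j i]; ring
    linarith
  have h1 : ∀ i, ∑ j, x i j * (N * harmonicStep c i j - ∑ k, harmonicStep c i k) =
      ∑ j, x i j * (N / (N + 2) * (c j - c i)) +
        N / (N + 2) * (x i i * (N * c i - ∑ k, c k)) := by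
    intro i
    simp only [card_mul_harmonicStep_sub_sum, mul_add, Finset.sum_add_distrib, mul_ite, mul_zero,
      Finset.sum_ite_eq, Finset.mem_univ, if_true]
    ring
  simp only [sum_sum_sub_mul_sub]
  rw [← Finset.mul_sum, Finset.sum_congr rfl fun i _ => h1 i, Finset.sum_add_distrib, h0,
    ← Finset.mul_sum, zero_add, mul_assoc]

/-- The normalisation (N + 2) / N is exactly the one for which harmonic extension preserves energy.
-/
theorem sum_sub_sq_eq_harmonicStep (hN : 0 < N) (c : Fin N → ℝ) :
    ∑ j, ∑ k, (c j - c k) ^ 2 = ((N : ℝ) + 2) / N *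
      ∑ i, ∑ j, ∑ k, (harmonicStep c i j - harmonicStep c i k) ^ 2 := by
  have hN' : (N : ℝ) ≠ 0 := by positivity
  have hN2 : (N : ℝ) + 2 ≠ 0 := by positivity
  simp only [sq]
  rw [sum_harmonicStep_mul c _ (harmonicStep_comm c), sum_sum_sub_mul_sub]
  simp only [harmonicStep_self]
  field_simp
  exact Finset.sum_congr rfl fun i _ => by ring

/-- Expand around the harmonic extension of the diagonal values. The mixed term sees only these
values, so x has the energy of the extension plus that of the difference. -/
theorem sum_sub_sq_le (hN : 0 < N) (x : Fin N → Fin N → ℝ) (hx : ∀ i j, x i j = x j i) :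
    ∑ j, ∑ k, (x j j - x k k) ^ 2 ≤
      ((N : ℝ) + 2) / N * ∑ i, ∑ j, ∑ k, (x i j - x i k) ^ 2 := by
  set c : Fin N → ℝ := fun i => x i i
  rw [sum_sub_sq_eq_harmonicStep hN c]
  refine mul_le_mul_of_nonneg_left ?_ (by positivity)
  have h1 := sum_harmonicStep_mul c x hx
  have h2 := sum_harmonicStep_mul c _ (harmonicStep_comm c)
  simp only [harmonicStep_self] at h2
  have h3 : ∑ i, ∑ j, ∑ k, (x i j - x i k) ^ 2 =
      ∑ i, ∑ j, ∑ k, ((x i j - harmonicStep c i j) - (x i k - harmonicStep c i k)) ^ 2 +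
      2 * ∑ i, ∑ j, ∑ k, (harmonicStep c i j - harmonicStep c i k) * (x i j - x i k) -
      ∑ i, ∑ j, ∑ k, (harmonicStep c i j - harmonicStep c i k) *
        (harmonicStep c i j - harmonicStep c i k) := by
    simp only [Finset.mul_sum, ← Finset.sum_add_distrib, ← Finset.sum_sub_distrib]
    refine Finset.sum_congr rfl fun i _ => Finset.sum_congr rfl fun j _ =>
      Finset.sum_congr rfl fun k _ => ?_
    ring
  have h4 : 0 ≤ ∑ i, ∑ j, ∑ k,
      ((x i j - harmonicStep c i j) - (x i k - harmonicStep c i k)) ^ 2 :=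
    Finset.sum_nonneg fun i _ => Finset.sum_nonneg fun j _ => Finset.sum_nonneg fun k _ =>
      sq_nonneg _
  have h5 : ∑ i, ∑ j, ∑ k, (harmonicStep c i j - harmonicStep c i k) ^ 2 =
      ∑ i, ∑ j, ∑ k, (harmonicStep c i j - harmonicStep c i k) *
        (harmonicStep c i j - harmonicStep c i k) := by simp only [sq]
  rw [h3, h5, h1, h2]
  linarith

end Harmonic

/-! ### The energy as a supremum -/

section Energy

variable {E : Type*} [NormedAddCommGroup E] [InnerProductSpace ℝ E] {N : ℕ} {p : Fin N → E}

theorem levelEnergy_nonneg (m : ℕ) (u : gasket p → ℝ) : 0 ≤ levelEnergy p m u := by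
  rw [levelEnergy_eq_sum_edges]
  have : 0 ≤ ∑ q ∈ edges p m, (u q.1 - u q.2) ^ 2 := Finset.sum_nonneg fun _ _ => sq_nonneg _
  positivity

theorem continuous_levelEnergy (m : ℕ) : Continuous fun u : gasket p → ℝ => levelEnergy p m u := by
  simp only [levelEnergy_eq_sum_edges]
  fun_prop

theorem levelEnergy_mono (hp : ∀ i j, i ≠ j → ‖p i - p j‖ = 1) (hN : 0 < N) (u : gasket p → ℝ) :
    Monotone fun m => levelEnergy p m u := by
  refine monotone_nat_of_le_succ fun m => ?_
  induction m generalizing u with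
  | zero =>
    rw [levelEnergy_succ hp, levelEnergy_zero hp]
    simp only [levelEnergy_zero hp]
    have h := sum_sub_sq_le hN (fun i j => u (cellMap p i (vertex p j)))
      fun i j => by rw [cellMap_vertex_comm]
    simp only [cellMap_vertex] at h
    rw [← Finset.mul_sum]
    linarith
  | succ m ih =>
    rw [levelEnergy_succ hp, levelEnergy_succ hp (m + 1)]
    exact mul_le_mul_of_nonneg_left (Finset.sum_le_sum fun i _ => ih _) (by positivity)

theorem tendsto_levelEnergy (hp : ∀ i j, i ≠ j → ‖p i - p j‖ = 1) (hN : 0 < N)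
    (u : gasket p → ℝ) :
    Tendsto (fun m => ENNReal.ofReal (levelEnergy p m u)) atTop (𝓝 (energy p u)) :=
  tendsto_nhds_limUnder ⟨_, tendsto_atTop_iSup fun _ _ h =>
    ENNReal.ofReal_le_ofReal (levelEnergy_mono hp hN u h)⟩

theorem energy_eq_iSup (hp : ∀ i j, i ≠ j → ‖p i - p j‖ = 1) (hN : 0 < N) (u : gasket p → ℝ) :
    energy p u = ⨆ m, ENNReal.ofReal (levelEnergy p m u) :=
  tendsto_nhds_unique (tendsto_levelEnergy hp hN u) (tendsto_atTop_iSup fun _ _ h =>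
    ENNReal.ofReal_le_ofReal (levelEnergy_mono hp hN u h))

theorem energy_le_ofReal_iff (hp : ∀ i j, i ≠ j → ‖p i - p j‖ = 1) (hN : 0 < N)
    {u : gasket p → ℝ} {C : ℝ} (hC : 0 ≤ C) :
    energy p u ≤ ENNReal.ofReal C ↔ ∀ m, levelEnergy p m u ≤ C := by
  rw [energy_eq_iSup hp hN, iSup_le_iff]
  exact forall_congr' fun m => ENNReal.ofReal_le_ofReal_iff hC

/-- The form in which every lattice operation enters: an inequality between squared increments at
pairs of points passes to each level and to the limit. -/
theorem energy_add_le (hp : ∀ i j, i ≠ j → ‖p i - p j‖ = 1) (hN : 0 < N)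
    {a b a' b' : gasket p → ℝ} (h : ∀ x y, (a' x - a' y) ^ 2 + (b' x - b' y) ^ 2 ≤
      (a x - a y) ^ 2 + (b x - b y) ^ 2) :
    energy p a' + energy p b' ≤ energy p a + energy p b := by
  refine le_of_tendsto_of_tendsto' ((tendsto_levelEnergy hp hN a').add
    (tendsto_levelEnergy hp hN b')) ((tendsto_levelEnergy hp hN a).add
    (tendsto_levelEnergy hp hN b)) fun m => ?_
  rw [← ENNReal.ofReal_add (levelEnergy_nonneg _ _) (levelEnergy_nonneg _ _),
    ← ENNReal.ofReal_add (levelEnergy_nonneg _ _) (levelEnergy_nonneg _ _)]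
  apply ENNReal.ofReal_le_ofReal
  simp only [levelEnergy_eq_sum_edges]
  rw [← mul_add, ← mul_add, ← Finset.sum_add_distrib, ← Finset.sum_add_distrib]
  exact mul_le_mul_of_nonneg_left (Finset.sum_le_sum fun q _ => h _ _) (by positivity)

theorem energy_combo_le (hp : ∀ i j, i ≠ j → ‖p i - p j‖ = 1) (hN : 0 < N) (u v : gasket p → ℝ)
    {a b : ℝ≥0} (hab : a + b = 1) :
    energy p (fun x => a * u x + b * v x) ≤ a * energy p u + b * energy p v := by
  refine le_of_tendsto_of_tendsto' (tendsto_levelEnergy hp hN _)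
    ((ENNReal.Tendsto.const_mul (tendsto_levelEnergy hp hN u) (Or.inr ENNReal.coe_ne_top)).add
      (ENNReal.Tendsto.const_mul (tendsto_levelEnergy hp hN v) (Or.inr ENNReal.coe_ne_top)))
    fun m => ?_
  have hab' : (b : ℝ) = 1 - a := by
    rw [← NNReal.coe_one, ← hab, NNReal.coe_add]; ring
  rw [← ENNReal.ofReal_coe_nnreal, ← ENNReal.ofReal_coe_nnreal,
    ← ENNReal.ofReal_mul a.coe_nonneg, ← ENNReal.ofReal_mul b.coe_nonneg,
    ← ENNReal.ofReal_add (mul_nonneg a.coe_nonneg (levelEnergy_nonneg _ _))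
      (mul_nonneg b.coe_nonneg (levelEnergy_nonneg _ _))]
  apply ENNReal.ofReal_le_ofReal
  simp only [levelEnergy_eq_sum_edges]
  have h : ∑ q ∈ edges p m, (a * u q.1 + b * v q.1 - (a * u q.2 + b * v q.2)) ^ 2 ≤
      a * ∑ q ∈ edges p m, (u q.1 - u q.2) ^ 2 + b * ∑ q ∈ edges p m, (v q.1 - v q.2) ^ 2 := by
    rw [Finset.mul_sum, Finset.mul_sum, ← Finset.sum_add_distrib]
    refine Finset.sum_le_sum fun q _ => ?_
    have hb : 0 ≤ (b : ℝ) := b.coe_nonneg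
    rw [hab'] at hb ⊢
    nlinarith [mul_nonneg (mul_nonneg a.coe_nonneg hb) (sq_nonneg ((u q.1 - u q.2) - (v q.1 - v q.2)))]
  calc _ ≤ 1 / 2 * (((N : ℝ) + 2) / N) ^ m * (a * ∑ q ∈ edges p m, (u q.1 - u q.2) ^ 2 +
        b * ∑ q ∈ edges p m, (v q.1 - v q.2) ^ 2) := mul_le_mul_of_nonneg_left h (by positivity)
    _ = _ := by ring

theorem energy_const (hp : ∀ i j, i ≠ j → ‖p i - p j‖ = 1) (hN : 0 < N) (c : ℝ) :
    energy p (fun _ => c) = 0 := by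
  rw [energy_eq_iSup hp hN]
  simp [levelEnergy_eq_sum_edges]

/-! ### Oscillation estimates -/

theorem levelEnergy_comp_cellMap_le (hp : ∀ i j, i ≠ j → ‖p i - p j‖ = 1) (hN : 0 < N) (m : ℕ)
    (u : gasket p → ℝ) (i : Fin N) :
    levelEnergy p m (fun x => u (cellMap p i x)) ≤ N / (N + 2) * levelEnergy p (m + 1) u := by
  have hN' : (0 : ℝ) < N := by exact_mod_cast hN
  have h := Finset.single_le_sum (f := fun i => levelEnergy p m (fun x => u (cellMap p i x)))
    (fun i _ => levelEnergy_nonneg m _) (Finset.mem_univ i)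
  rw [levelEnergy_succ hp, ← mul_assoc]
  have e : (N : ℝ) / (N + 2) * ((N + 2) / N) = 1 := by field_simp
  rw [e, one_mul]
  exact h

theorem sq_sub_vertex_le (hp : ∀ i j, i ≠ j → ‖p i - p j‖ = 1) (u : gasket p → ℝ)
    (i j : Fin N) : (u (vertex p i) - u (vertex p j)) ^ 2 ≤ 2 * levelEnergy p 0 u := by
  rw [levelEnergy_zero hp]
  have h1 := Finset.single_le_sum (f := fun j => (u (vertex p i) - u (vertex p j)) ^ 2)
    (fun j _ => sq_nonneg _) (Finset.mem_univ j)
  have h2 := Finset.single_le_sum (f := fun i => ∑ j, (u (vertex p i) - u (vertex p j)) ^ 2)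
    (fun i _ => Finset.sum_nonneg fun j _ => sq_nonneg _) (Finset.mem_univ i)
  linarith [h1.trans h2]

theorem sqrt_ratio_lt_one (N : ℕ) : √((N : ℝ) / (N + 2)) < 1 := by
  rw [Real.sqrt_lt' one_pos, one_pow, div_lt_one (by positivity)]
  linarith

/-- Move towards x through the nested cells containing it. Passing to a subcell multiplies the
available energy by N / (N + 2), so the increments are bounded by a geometric series of ratio √(N /
(N + 2)). -/
theorem abs_sub_vertex_le (hp : ∀ i j, i ≠ j → ‖p i - p j‖ = 1) (hN : 0 < N) (n : ℕ) {C : ℝ}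
    (u : gasket p → ℝ) (hu : ∀ m, levelEnergy p m u ≤ C) {x : gasket p}
    (hx : x ∈ gasketLevel p n) (j : Fin N) :
    |u x - u (vertex p j)| ≤ √(2 * C) / (1 - √((N : ℝ) / (N + 2))) := by
  set r : ℝ := (N : ℝ) / (N + 2) with hr
  have hr0 : 0 ≤ r := by positivity
  have hr1 : 0 < 1 - √r := sub_pos.2 (sqrt_ratio_lt_one N)
  have hedge : ∀ (v : gasket p → ℝ) (D : ℝ), (∀ m, levelEnergy p m v ≤ D) → ∀ i j,
      |v (vertex p i) - v (vertex p j)| ≤ √(2 * D) := fun v D hv i j =>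
    Real.abs_le_sqrt ((sq_sub_vertex_le hp v i j).trans (by linarith [hv 0]))
  induction n generalizing C u x j with
  | zero =>
    obtain ⟨i, rfl⟩ := mem_gasketLevel_zero.1 hx
    refine (hedge u C hu i j).trans ?_
    rw [le_div_iff₀ hr1]
    nlinarith [Real.sqrt_nonneg (2 * C), Real.sqrt_nonneg r]
  | succ n ih =>
    obtain ⟨i, y, hy, rfl⟩ := mem_gasketLevel_succ.1 hx
    have h1 := ih (C := r * C) (fun z => u (cellMap p i z)) (fun m =>
      (levelEnergy_comp_cellMap_le hp hN m u i).trans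
        (mul_le_mul_of_nonneg_left (hu (m + 1)) hr0)) hy i
    have h2 := hedge u C hu i j
    simp only [cellMap_vertex] at h1
    have e : √(2 * (r * C)) = √r * √(2 * C) := by
      rw [← Real.sqrt_mul hr0]; congr 1; ring
    rw [e, le_div_iff₀ hr1] at h1
    rw [le_div_iff₀ hr1]
    have h3 := abs_sub_le (u (cellMap p i y)) (u (vertex p i)) (u (vertex p j))
    nlinarith [mul_le_mul_of_nonneg_right h3 hr1.le, mul_le_mul_of_nonneg_right h2 hr1.le]

theorem levelEnergy_comp_cellWord_le (hp : ∀ i j, i ≠ j → ‖p i - p j‖ = 1) (hN : 0 < N) {C : ℝ}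
    (w : List (Fin N)) (u : gasket p → ℝ) (hu : ∀ m, levelEnergy p m u ≤ C) (m : ℕ) :
    levelEnergy p m (fun x => u (cellWord p w x)) ≤ (N / (N + 2)) ^ w.length * C := by
  induction w generalizing u C with
  | nil => simpa [cellWord] using hu m
  | cons i w ih =>
    have := ih (C := N / (N + 2) * C) (fun z => u (cellMap p i z)) fun m =>
      (levelEnergy_comp_cellMap_le hp hN m u i).trans
        (mul_le_mul_of_nonneg_left (hu (m + 1)) (by positivity))
    simp only [cellWord, Function.comp_apply, List.length_cons, pow_succ]
    rw [mul_assoc]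
    exact this

/-- The oscillation on cells of level `m` of functions with energy at most `C`. -/
def oscBound (N : ℕ) (C : ℝ) (m : ℕ) : ℝ :=
  2 * (√(2 * ((N / (N + 2)) ^ m * C)) / (1 - √((N : ℝ) / (N + 2))))

theorem tendsto_oscBound (N : ℕ) (C : ℝ) : Tendsto (oscBound N C) atTop (𝓝 0) := by
  have h1 : Tendsto (fun m : ℕ => ((N : ℝ) / (N + 2)) ^ m) atTop (𝓝 0) :=
    tendsto_pow_atTop_nhds_zero_of_lt_one (by positivity) (by
      rw [div_lt_one (by positivity)]; linarith)
  have h2 := ((((h1.mul_const C).const_mul 2).sqrt).div_const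
    (1 - √((N : ℝ) / (N + 2)))).const_mul 2
  simp only [zero_mul, mul_zero, Real.sqrt_zero, zero_div] at h2
  exact h2

/-- Apply the vertex estimate to u ∘ F_w, whose energy carries the factor (N / (N + 2))^m with m the
length of w. Continuity extends it from vertices to the gasket, and the factor 2 in `oscBound` comes
from passing through a reference vertex. -/
theorem abs_sub_le_oscBound (hp : ∀ i j, i ≠ j → ‖p i - p j‖ = 1) (hN : 0 < N) {C : ℝ}
    {u : gasket p → ℝ} (hc : Continuous u) (hu : ∀ m, levelEnergy p m u ≤ C) (w : List (Fin N))
    (x y : gasket p) : |u (cellWord p w x) - u (cellWord p w y)| ≤ oscBound N C w.length := by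
  set j : Fin N := ⟨0, hN⟩
  set v : gasket p → ℝ := fun z => u (cellWord p w z) with hv
  have hvc : Continuous v := hc.comp (continuous_cellWord w)
  have key : ∀ z, |v z - v (vertex p j)| ≤
      √(2 * ((N / (N + 2)) ^ w.length * C)) / (1 - √((N : ℝ) / (N + 2))) := by
    have hcl : IsClosed {z | |v z - v (vertex p j)| ≤
        √(2 * ((N / (N + 2)) ^ w.length * C)) / (1 - √((N : ℝ) / (N + 2)))} :=
      isClosed_le (by fun_prop) continuous_const
    intro z
    refine closure_minimal (Set.iUnion_subset fun n z hz => ?_) hcl (dense_iUnion_gasketLevel z)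
    exact abs_sub_vertex_le hp hN n v (levelEnergy_comp_cellWord_le hp hN w u hu) hz j
  have h1 := key x
  have h2 := key y
  rw [abs_sub_comm] at h2
  refine (abs_sub_le (v x) (v (vertex p j)) (v y)).trans ?_
  unfold oscBound
  linarith

end Energy

/-! ### The perturbed energy on `L²` -/

section Perturbed

variable {E : Type*} [NormedAddCommGroup E] [InnerProductSpace ℝ E] {N : ℕ} {p : Fin N → E}
  [MeasurableSpace E] {μ : Measure (gasket p)}

theorem exists_of_perturbedEnergy_ne_top {B : Fin N → ℝ → ℝ≥0∞} {u : Lp ℝ 2 μ}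
    (h : perturbedEnergy p μ B u ≠ ⊤) : ∃ g : C(gasket p, ℝ), g ∈ H1 p ∧ u =ᵐ[μ] g := by
  by_contra hcon
  exact h (by rw [perturbedEnergy, dif_neg hcon])

variable [μ.IsOpenPosMeasure]

theorem perturbedEnergy_zero (hp : ∀ i j, i ≠ j → ‖p i - p j‖ = 1) (hN : 0 < N)
    {B : Fin N → ℝ → ℝ≥0∞} (hB : ∀ i, B i 0 = 0) : perturbedEnergy p μ B 0 = 0 := by
  have h0 : energy p (0 : C(gasket p, ℝ)) = 0 := energy_const hp hN 0
  rw [perturbedEnergy_eq p μ B 0 0 (h0.trans_lt ENNReal.zero_lt_top) (Lp.coeFn_zero _ _ _), h0]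
  simp [hB]

theorem perturbedEnergy_add_le (hp : ∀ i j, i ≠ j → ‖p i - p j‖ = 1) (hN : 0 < N)
    {B₁ B₂ : Fin N → ℝ → ℝ≥0∞} {a b a' b' : Lp ℝ 2 μ} {f g f' g' : C(gasket p, ℝ)}
    (ha : a =ᵐ[μ] f) (hb : b =ᵐ[μ] g) (ha' : a' =ᵐ[μ] f') (hb' : b' =ᵐ[μ] g') (hf : f ∈ H1 p)
    (hg : g ∈ H1 p) (h : ∀ x y, (f' x - f' y) ^ 2 + (g' x - g' y) ^ 2 ≤
      (f x - f y) ^ 2 + (g x - g y) ^ 2)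
    (hB : ∀ i, B₁ i (f' (vertex p i)) + B₂ i (g' (vertex p i)) ≤
      B₁ i (f (vertex p i)) + B₂ i (g (vertex p i))) :
    perturbedEnergy p μ B₁ a' + perturbedEnergy p μ B₂ b' ≤
      perturbedEnergy p μ B₁ a + perturbedEnergy p μ B₂ b := by
  have hE := energy_add_le hp hN h
  have hlt : energy p f' + energy p g' < ⊤ := hE.trans_lt (ENNReal.add_lt_top.2 ⟨hf, hg⟩)
  rw [perturbedEnergy_eq p μ B₁ a f hf ha, perturbedEnergy_eq p μ B₂ b g hg hb,
    perturbedEnergy_eq p μ B₁ a' f' (ENNReal.add_lt_top.1 hlt).1 ha',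
    perturbedEnergy_eq p μ B₂ b' g' (ENNReal.add_lt_top.1 hlt).2 hb', add_add_add_comm,
    add_add_add_comm (energy p f), ← Finset.sum_add_distrib, ← Finset.sum_add_distrib]
  exact add_le_add hE (Finset.sum_le_sum fun i _ => hB i)

theorem sq_inf_add_sq_sup_le (a b c d : ℝ) :
    (a ⊓ b - c ⊓ d) ^ 2 + (a ⊔ b - c ⊔ d) ^ 2 ≤ (a - c) ^ 2 + (b - d) ^ 2 := by
  rcases le_total a b with h | h <;> rcases le_total c d with h' | h' <;> simp only [h, h',
    inf_of_le_left, inf_of_le_right, sup_of_le_left, sup_of_le_right] <;>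
    nlinarith [mul_nonneg (sub_nonneg.2 h) (sub_nonneg.2 h')]

theorem truncation_cases {a b : ℝ} (hb : 0 ≤ b) :
    (-b ≤ a ∧ a ≤ b ∧ (a ⊓ b) ⊔ -b = a ∧ |a| ⊔ b = b) ∨
    (b ≤ a ∧ (a ⊓ b) ⊔ -b = b ∧ |a| ⊔ b = a) ∨
    (a ≤ -b ∧ (a ⊓ b) ⊔ -b = -b ∧ |a| ⊔ b = -a) := by
  rcases le_total b a with hab | hab
  · refine Or.inr (Or.inl ⟨hab, ?_, ?_⟩)
    · rw [inf_eq_right.2 hab, sup_eq_left.2 (by linarith)]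
    · rw [abs_of_nonneg (hb.trans hab), sup_eq_left.2 hab]
  · rcases le_total a (-b) with hab' | hab'
    · refine Or.inr (Or.inr ⟨hab', ?_, ?_⟩)
      · rw [inf_eq_left.2 hab, sup_eq_right.2 hab']
      · rw [abs_of_nonpos (by linarith), sup_eq_left.2 (by linarith)]
    · refine Or.inl ⟨hab', hab, ?_, ?_⟩
      · rw [inf_eq_left.2 hab, sup_eq_left.2 hab']
      · rw [sup_eq_right.2 (abs_le.2 ⟨hab', hab⟩)]

theorem sq_truncation_add_le {a b c d : ℝ} (hb : 0 ≤ b) (hd : 0 ≤ d) :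
    ((a ⊓ b) ⊔ -b - (c ⊓ d) ⊔ -d) ^ 2 + (|a| ⊔ b - |c| ⊔ d) ^ 2 ≤ (a - c) ^ 2 + (b - d) ^ 2 := by
  rcases truncation_cases (a := a) hb with ⟨h1, h2, e1, e2⟩ | ⟨h1, e1, e2⟩ | ⟨h1, e1, e2⟩ <;>
  rcases truncation_cases (a := c) hd with ⟨h3, h4, e3, e4⟩ | ⟨h3, e3, e4⟩ | ⟨h3, e3, e4⟩ <;>
  rw [e1, e2, e3, e4]
  · nlinarith [mul_nonneg (sub_nonneg.2 h2) (sub_nonneg.2 h3)]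
  · nlinarith [mul_nonneg (sub_nonneg.2 h1) (sub_nonneg.2 h3)]
  · nlinarith [mul_nonneg (sub_nonneg.2 h1) (sub_nonneg.2 h4)]
  · nlinarith
  · nlinarith [mul_nonneg (sub_nonneg.2 h1) (sub_nonneg.2 h3), mul_nonneg hb hd,
      mul_nonneg (sub_nonneg.2 h1) hd, mul_nonneg (sub_nonneg.2 h3) hb]
  · nlinarith [mul_nonneg (sub_nonneg.2 h1) (sub_nonneg.2 h3)]
  · nlinarith [mul_nonneg (sub_nonneg.2 h1) (sub_nonneg.2 h3), mul_nonneg hb hd,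
      mul_nonneg (sub_nonneg.2 h1) hd, mul_nonneg (sub_nonneg.2 h3) hb]
  · nlinarith

theorem perturbedEnergy_inf_add_sup_le (hp : ∀ i j, i ≠ j → ‖p i - p j‖ = 1) (hN : 0 < N)
    (B : Fin N → ℝ → ℝ≥0∞) (a b : Lp ℝ 2 μ) :
    perturbedEnergy p μ B (a ⊓ b) + perturbedEnergy p μ B (a ⊔ b) ≤
      perturbedEnergy p μ B a + perturbedEnergy p μ B b := by
  by_cases ha : perturbedEnergy p μ B a = ⊤
  · simp [ha]
  by_cases hb : perturbedEnergy p μ B b = ⊤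
  · simp [hb]
  obtain ⟨f, hf, haf⟩ := exists_of_perturbedEnergy_ne_top ha
  obtain ⟨g, hg, hbg⟩ := exists_of_perturbedEnergy_ne_top hb
  refine perturbedEnergy_add_le hp hN haf hbg (f' := f ⊓ g) (g' := f ⊔ g) ?_ ?_ hf hg
    (fun x y => sq_inf_add_sq_sup_le _ _ _ _) fun i => ?_
  · filter_upwards [haf, hbg, Lp.coeFn_inf a b] with x h1 h2 h3
    rw [h3, Pi.inf_apply, h1, h2]; rfl
  · filter_upwards [haf, hbg, Lp.coeFn_sup a b] with x h1 h2 h3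
    rw [h3, Pi.sup_apply, h1, h2]; rfl
  · rw [ContinuousMap.inf_apply, ContinuousMap.sup_apply]
    rcases le_total (f (vertex p i)) (g (vertex p i)) with h | h
    · rw [inf_eq_left.2 h, sup_eq_right.2 h]
    · rw [inf_eq_right.2 h, sup_eq_left.2 h, add_comm]

theorem nonneg_of_ae_eq {b : Lp ℝ 2 μ} (hb : 0 ≤ b) {g : C(gasket p, ℝ)} (hbg : b =ᵐ[μ] g)
    (x : gasket p) : 0 ≤ g x := by
  have h : (fun x => g x ⊔ 0) = g := by
    refine (Continuous.ae_eq_iff_eq μ (by fun_prop) g.continuous).1 ?_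
    filter_upwards [hbg, (Lp.coeFn_nonneg b).2 hb] with x h1 h2
    rw [← h1]
    exact sup_eq_left.2 h2
  rw [← congrFun h x]
  exact le_sup_right

theorem perturbedEnergy_truncation_le (hp : ∀ i j, i ≠ j → ‖p i - p j‖ = 1) (hN : 0 < N)
    {B₁ B₂ : Fin N → ℝ → ℝ≥0∞} (hB : ∀ i s t, 0 ≤ t →
      B₁ i ((s ⊓ t) ⊔ -t) + B₂ i (|s| ⊔ t) ≤ B₁ i s + B₂ i t) (a b : Lp ℝ 2 μ) (hb0 : 0 ≤ b) :
    perturbedEnergy p μ B₁ ((a ⊓ b) ⊔ -b) + perturbedEnergy p μ B₂ (|a| ⊔ b) ≤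
      perturbedEnergy p μ B₁ a + perturbedEnergy p μ B₂ b := by
  by_cases ha : perturbedEnergy p μ B₁ a = ⊤
  · simp [ha]
  by_cases hb : perturbedEnergy p μ B₂ b = ⊤
  · simp [hb]
  obtain ⟨f, hf, haf⟩ := exists_of_perturbedEnergy_ne_top ha
  obtain ⟨g, hg, hbg⟩ := exists_of_perturbedEnergy_ne_top hb
  have hg0 := nonneg_of_ae_eq hb0 hbg
  refine perturbedEnergy_add_le hp hN haf hbg (f' := ⟨fun x => (f x ⊓ g x) ⊔ -g x, by fun_prop⟩)
    (g' := ⟨fun x => |f x| ⊔ g x, by fun_prop⟩) ?_ ?_ hf hg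
    (fun x y => sq_truncation_add_le (hg0 x) (hg0 y)) fun i => hB i _ _ (hg0 _)
  · filter_upwards [haf, hbg, Lp.coeFn_inf a b, Lp.coeFn_sup (a ⊓ b) (-b), Lp.coeFn_neg b]
      with x h1 h2 h3 h4 h5
    rw [h4, Pi.sup_apply, h3, h5, Pi.inf_apply, Pi.neg_apply, h1, h2]; rfl
  · filter_upwards [haf, hbg, Lp.coeFn_abs a, Lp.coeFn_sup |a| b] with x h1 h2 h3 h4
    rw [h4, Pi.sup_apply, h3, h1, h2]; rfl

theorem perturbedEnergy_comp_neg (hp : ∀ i j, i ≠ j → ‖p i - p j‖ = 1) (hN : 0 < N)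
    (B : Fin N → ℝ → ℝ≥0∞) (u : Lp ℝ 2 μ) :
    perturbedEnergy p μ (fun i s => B i (-s)) u = perturbedEnergy p μ B (-u) := by
  have hle : ∀ (B : Fin N → ℝ → ℝ≥0∞) (u : Lp ℝ 2 μ),
      perturbedEnergy p μ (fun i s => B i (-s)) u ≤ perturbedEnergy p μ B (-u) := by
    intro B u
    by_cases hu : perturbedEnergy p μ B (-u) = ⊤
    · simp [hu]
    obtain ⟨f, hf, huf⟩ := exists_of_perturbedEnergy_ne_top hu
    have hE : energy p (-f : C(gasket p, ℝ)) ≤ energy p f := by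
      have := energy_add_le hp hN (a := f) (b := fun _ => 0) (a' := (-f : C(gasket p, ℝ)))
        (b' := fun _ => 0) fun x y => by
          rw [ContinuousMap.neg_apply, ContinuousMap.neg_apply]
          exact le_of_eq (by ring)
      rwa [energy_const hp hN, add_zero, add_zero] at this
    have hu' : u =ᵐ[μ] (-f : C(gasket p, ℝ)) := by
      filter_upwards [huf, Lp.coeFn_neg u] with x h1 h2
      rw [ContinuousMap.neg_apply, ← h1, h2, Pi.neg_apply, neg_neg]
    rw [perturbedEnergy_eq p μ _ u (-f) (hE.trans_lt hf) hu', perturbedEnergy_eq p μ B _ f hf huf]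
    simpa using add_le_add_left hE _
  refine (hle B u).antisymm ?_
  have := hle (fun i s => B i (-s)) (-u)
  simpa using this

theorem convexOn_perturbedEnergy (hp : ∀ i j, i ≠ j → ‖p i - p j‖ = 1) (hN : 0 < N)
    {B : Fin N → ℝ → ℝ≥0∞} (hB : ∀ i (a b : ℝ≥0) s t, a + b = 1 →
      B i (a * s + b * t) ≤ a * B i s + b * B i t) :
    ConvexOn ℝ≥0 Set.univ (perturbedEnergy p μ B) := by
  refine ⟨convex_univ, fun u _ v _ a b _ _ hab => ?_⟩
  simp only [ENNReal.smul_def, smul_eq_mul]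
  -- Zero weights are split off because `0 * ⊤ = 0`: the right side need not be infinite when an
  -- energy is.
  rcases eq_or_ne a 0 with rfl | ha0
  · rw [zero_add] at hab
    simp [hab]
  rcases eq_or_ne b 0 with rfl | hb0
  · rw [add_zero] at hab
    simp [hab]
  by_cases hu : perturbedEnergy p μ B u = ⊤
  · rw [hu, ENNReal.mul_top (by simpa using ha0), top_add]; exact le_top
  by_cases hv : perturbedEnergy p μ B v = ⊤
  · rw [hv, ENNReal.mul_top (by simpa using hb0), add_top]; exact le_top
  obtain ⟨f, hf, huf⟩ := exists_of_perturbedEnergy_ne_top hu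
  obtain ⟨g, hg, hvg⟩ := exists_of_perturbedEnergy_ne_top hv
  set k : C(gasket p, ℝ) := ⟨fun x => a * f x + b * g x, by fun_prop⟩ with hk
  have hE : energy p k ≤ a * energy p f + b * energy p g := energy_combo_le hp hN f g hab
  have hkH : k ∈ H1 p := hE.trans_lt (ENNReal.add_lt_top.2
    ⟨ENNReal.mul_lt_top ENNReal.coe_lt_top hf, ENNReal.mul_lt_top ENNReal.coe_lt_top hg⟩)
  have huv : (a • u + b • v : Lp ℝ 2 μ) =ᵐ[μ] k := by
    have e : (a • u + b • v : Lp ℝ 2 μ) = (a : ℝ) • u + (b : ℝ) • v := rfl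
    rw [e]
    filter_upwards [huf, hvg, Lp.coeFn_add ((a : ℝ) • u) ((b : ℝ) • v), Lp.coeFn_smul (a : ℝ) u,
      Lp.coeFn_smul (b : ℝ) v] with x h1 h2 h3 h4 h5
    rw [h3, Pi.add_apply, h4, h5, Pi.smul_apply, Pi.smul_apply, h1, h2]; rfl
  rw [perturbedEnergy_eq p μ B _ k hkH huv, perturbedEnergy_eq p μ B u f hf huf,
    perturbedEnergy_eq p μ B v g hg hvg, mul_add, mul_add, add_add_add_comm, Finset.mul_sum,
    Finset.mul_sum, ← Finset.sum_add_distrib]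
  exact add_le_add hE (Finset.sum_le_sum fun i _ => hB i a b _ _ hab)

theorem perturbedEnergy_lt_top_of (B : Fin N → ℝ → ℝ≥0∞) {u : Lp ℝ 2 μ} {g : C(gasket p, ℝ)}
    (hg : g ∈ H1 p) (hu : u =ᵐ[μ] g) (hB : ∀ i, B i (g (vertex p i)) = 0) :
    perturbedEnergy p μ B u < ⊤ := by
  rw [perturbedEnergy_eq p μ B u g hg hu, Finset.sum_eq_zero fun i _ => hB i, add_zero]
  exact hg

/-! ### Lower semicontinuity -/

/-- The oscillation bound makes the sequence equicontinuous, and almost everywhere convergence gives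
convergence on a dense set because `μ` has full support. Together these force convergence everywhere
to a continuous limit. -/
theorem exists_continuous_limit [ProperSpace E] (hp : ∀ i j, i ≠ j → ‖p i - p j‖ = 1)
    (hN : 0 < N) {C : ℝ} (g : ℕ → C(gasket p, ℝ)) (hg : ∀ n m, levelEnergy p m (g n) ≤ C)
    {u : gasket p → ℝ} (hu : ∀ᵐ x ∂μ, Tendsto (fun n => g n x) atTop (𝓝 (u x))) :
    ∃ f : C(gasket p, ℝ), ∀ x, Tendsto (fun n => g n x) atTop (𝓝 (f x)) := by
  have hosc : ∀ ε > 0, ∀ x, ∀ᶠ y in 𝓝 x, ∀ n, |g n x - g n y| ≤ ε := by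
    intro ε hε x
    obtain ⟨m, hm⟩ := ((tendsto_oscBound N C).eventually_lt_const hε).exists
    filter_upwards [eventually_mem_cell m x] with y hy n
    obtain ⟨w, x', y', rfl, rfl, rfl⟩ := hy
    exact (abs_sub_le_oscBound hp hN (g n).continuous (hg n) w x' y').trans hm.le
  have hdense : Dense {x | Tendsto (fun n => g n x) atTop (𝓝 (u x))} := Measure.dense_of_ae hu
  have hlim : ∀ x, ∃ l, Tendsto (fun n => g n x) atTop (𝓝 l) := by
    intro x
    refine cauchySeq_tendsto_of_complete (Metric.cauchySeq_iff.2 fun ε hε => ?_)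
    obtain ⟨y, hy, hyu⟩ := mem_closure_iff_nhds.1 (hdense x) _ (hosc (ε / 3) (by positivity) x)
    obtain ⟨K, hK⟩ := Metric.cauchySeq_iff.1 (Tendsto.cauchySeq hyu) (ε / 3) (by positivity)
    refine ⟨K, fun m hm n hn => ?_⟩
    have h1 := hK m hm n hn
    have h2 : |g m x - g m y| ≤ ε / 3 := hy m
    have h3 : |g n x - g n y| ≤ ε / 3 := hy n
    rw [Real.dist_eq] at h1 ⊢
    rw [abs_lt] at h1 ⊢
    rw [abs_le] at h2 h3
    constructor <;> linarith [h1.1, h1.2, h2.1, h2.2, h3.1, h3.2]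
  choose f hf using hlim
  refine ⟨⟨f, continuous_iff_continuousAt.2 fun x => ?_⟩, hf⟩
  refine Metric.tendsto_nhds.2 fun ε hε => ?_
  filter_upwards [hosc (ε / 2) (by positivity) x] with y hy
  have : |f x - f y| ≤ ε / 2 :=
    le_of_tendsto ((hf x).sub (hf y)).abs (Eventually.of_forall hy)
  rw [dist_comm, Real.dist_eq]
  linarith

theorem lowerSemicontinuous_perturbedEnergy [ProperSpace E]
    (hp : ∀ i j, i ≠ j → ‖p i - p j‖ = 1) (hN : 0 < N) {B : Fin N → ℝ → ℝ≥0∞}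
    (hB : ∀ i, LowerSemicontinuous (B i)) : LowerSemicontinuous (perturbedEnergy p μ B) := by
  rw [lowerSemicontinuous_iff_isClosed_preimage]
  intro c
  rcases eq_or_ne c ⊤ with rfl | hc
  · simp
  refine IsSeqClosed.isClosed fun u v hu huv => ?_
  have hu : ∀ n, perturbedEnergy p μ B (u n) ≤ c := hu
  have hex := fun n => exists_of_perturbedEnergy_ne_top (ne_top_of_le_ne_top hc (hu n))
  choose g hg hug using hex
  have hgc : ∀ n, energy p (g n) + ∑ i, B i (g n (vertex p i)) ≤ c := fun n => by
    rw [← perturbedEnergy_eq p μ B (u n) (g n) (hg n) (hug n)]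
    exact hu n
  have hgC : ∀ n m, levelEnergy p m (g n) ≤ c.toReal := fun n => by
    rw [← energy_le_ofReal_iff hp hN ENNReal.toReal_nonneg, ENNReal.ofReal_toReal hc]
    exact le_self_add.trans (hgc n)
  obtain ⟨φ, hφ, hae⟩ := (tendstoInMeasure_of_tendsto_Lp huv).exists_seq_tendsto_ae
  have hae' : ∀ᵐ x ∂μ, Tendsto (fun n => g (φ n) x) atTop (𝓝 (v x)) := by
    filter_upwards [hae, ae_all_iff.2 hug] with x hx hx'
    exact hx.congr fun n => hx' (φ n)
  obtain ⟨f, hf⟩ := exists_continuous_limit hp hN (fun n => g (φ n)) (fun n => hgC (φ n)) hae'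
  have hvf : v =ᵐ[μ] f := by
    filter_upwards [hae'] with x hx using tendsto_nhds_unique hx (hf x)
  have hpi : Tendsto (fun n => (g (φ n) : gasket p → ℝ)) atTop (𝓝 (f : gasket p → ℝ)) :=
    tendsto_pi_nhds.2 hf
  -- At a fixed level, energy and boundary terms depend on finitely many point values, so pointwise
  -- convergence suffices; the supremum over m is taken afterwards.
  have hm : ∀ m, ENNReal.ofReal (levelEnergy p m f) + ∑ i, B i (f (vertex p i)) ≤ c := by
    intro m
    have hl : LowerSemicontinuous fun k : gasket p → ℝ =>
        ENNReal.ofReal (levelEnergy p m k) + ∑ i, B i (k (vertex p i)) := by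
      refine (ENNReal.continuous_ofReal.comp (continuous_levelEnergy m)).lowerSemicontinuous.add
        (lowerSemicontinuous_sum fun i _ => (hB i).comp (continuous_apply _))
    refine hl.le_of_tendsto hpi tendsto_const_nhds (Eventually.of_forall fun n => ?_)
    refine le_trans ?_ (hgc (φ n))
    rw [energy_eq_iSup hp hN]
    gcongr
    exact le_iSup (fun m => ENNReal.ofReal (levelEnergy p m (g (φ n)))) m
  have htot : energy p f + ∑ i, B i (f (vertex p i)) ≤ c := by
    rw [energy_eq_iSup hp hN, ENNReal.iSup_add]
    exact iSup_le hm
  have hfH : f ∈ H1 p := (le_self_add.trans htot).trans_lt hc.lt_top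
  change perturbedEnergy p μ B v ≤ c
  rwa [perturbedEnergy_eq p μ B v f hfH hvf]

end Perturbed

/-! ### Harmonic functions and splines -/

section Splines

variable {E : Type*} [NormedAddCommGroup E] [InnerProductSpace ℝ E] {N : ℕ} {p : Fin N → E}

/-- Distinct cells meet only at shared vertices F_i(p_j) = F_j(p_i), where the data agree;
continuity follows from the finite closed cover by cells. -/
theorem exists_glue [ProperSpace E] (hp : ∀ i j, i ≠ j → ‖p i - p j‖ = 1) (g : Fin N → C(gasket p, ℝ))
    (hg : ∀ i j, g i (vertex p j) = g j (vertex p i)) :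
    ∃ G : C(gasket p, ℝ), ∀ i x, G (cellMap p i x) = g i x := by
  choose idx pt hpt using exists_cellMap_eq (p := p)
  set G : gasket p → ℝ := fun x => g (idx x) (pt x) with hG
  have hGF : ∀ i x, G (cellMap p i x) = g i x := by
    intro i x
    have h := hpt (cellMap p i x)
    simp only [hG]
    generalize idx (cellMap p i x) = j at h ⊢
    generalize pt (cellMap p i x) = y at h ⊢
    rcases eq_or_ne j i with rfl | hij
    · rw [cellMap_injective j h]
    · rw [eq_vertex_of_cellMap_eq hp hij h, eq_vertex_of_cellMap_eq hp hij.symm h.symm, hg]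
  refine ⟨⟨G, continuous_iff_isClosed.2 fun T hT => ?_⟩, hGF⟩
  have : G ⁻¹' T = ⋃ i, cellMap p i '' (g i ⁻¹' T) := by
    ext x
    simp only [Set.mem_preimage, Set.mem_iUnion, Set.mem_image]
    constructor
    · intro hx
      exact ⟨idx x, pt x, hx, hpt x⟩
    · rintro ⟨i, y, hy, rfl⟩
      rwa [hGF]
  rw [this]
  exact isClosed_iUnion_of_finite fun i =>
    ((hT.preimage (g i).continuous).isCompact.image (continuous_cellMap i)).isClosed

theorem abs_harmonicStep_sub_le {c : Fin N → ℝ} {d : ℝ} (hc : ∀ j k, |c j - c k| ≤ d)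
    (i j k : Fin N) :
    |harmonicStep c i j - harmonicStep c i k| ≤ N / (N + 2) * d := by
  have hd : 0 ≤ d := (abs_nonneg _).trans (hc i i)
  have hN1 : (1 : ℝ) ≤ N := by exact_mod_cast i.pos
  have hN2 : (0 : ℝ) < (N : ℝ) + 2 := by positivity
  -- comparison of the new value at `F_i(p_j)` with the value at `p_i`
  have hdiag : ∀ j, i ≠ j → |harmonicStep c i j - c i| ≤ N / (N + 2) * d := by
    intro j hij
    have e : harmonicStep c i j - c i = ((c j - c i) + ∑ l, (c l - c i)) / (N + 2) := by
      rw [harmonicStep, if_neg hij, Finset.sum_sub_distrib]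
      simp
      field_simp
      ring
    have hs : |∑ l, (c l - c i)| ≤ (N - 1) * d := by
      rw [← Finset.sum_erase Finset.univ (a := i) (f := fun l => c l - c i) (sub_self _)]
      refine (Finset.abs_sum_le_sum_abs _ _).trans ((Finset.sum_le_card_nsmul _ _ d
        fun l _ => hc l i).trans_eq ?_)
      rw [Finset.card_erase_of_mem (Finset.mem_univ i), Finset.card_univ, Fintype.card_fin,
        nsmul_eq_mul, Nat.cast_sub (by exact_mod_cast i.pos), Nat.cast_one]
    rw [e, abs_div, abs_of_pos hN2, div_mul_eq_mul_div, div_le_div_iff_of_pos_right hN2]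
    refine (abs_add_le _ _).trans ?_
    linarith [hc j i]
  have hρ : 0 ≤ N / (N + 2) * d := by positivity
  by_cases hj : i = j
  · by_cases hk : i = k
    · rw [← hj, ← hk, sub_self, abs_zero]; exact hρ
    · rw [← hj, harmonicStep_self, abs_sub_comm]
      exact hdiag k hk
  · by_cases hk : i = k
    · rw [← hk, harmonicStep_self]
      exact hdiag j hj
    · have e : harmonicStep c i j - harmonicStep c i k = (c j - c k) / (N + 2) := by
        rw [harmonicStep, harmonicStep, if_neg hj, if_neg hk]
        ring
      rw [e, abs_div, abs_of_pos hN2, div_mul_eq_mul_div, div_le_div_iff_of_pos_right hN2]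
      exact (hc j k).trans (le_mul_of_one_le_left hd hN1)

/-- A continuous function with given values at the boundary vertices. -/
def baryExtension (p : Fin N → E) (z : Fin N) (c : Fin N → ℝ) : C(gasket p, ℝ) where
  toFun x := c z + ∑ j, (c j - c z) * bary p j x
  continuous_toFun := by
    have : ∀ j, Continuous fun x : gasket p => bary p j x := fun j =>
      (continuous_bary j).comp continuous_subtype_val
    fun_prop

theorem baryExtension_vertex (hp : ∀ i j, i ≠ j → ‖p i - p j‖ = 1) (z : Fin N) (c : Fin N → ℝ)
    (j : Fin N) : baryExtension p z c (vertex p j) = c j := by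
  have h : ∀ k, bary p k (p j) = if k = j then 1 else 0 := by
    intro k
    split_ifs with hk
    · rw [hk, bary_self]
    · exact bary_of_ne hp hk
  simp [baryExtension, vertex, h]

theorem abs_baryExtension_sub_le (hp : ∀ i j, i ≠ j → ‖p i - p j‖ = 1) (z : Fin N)
    {c : Fin N → ℝ} {d : ℝ} (hc : ∀ j k, |c j - c k| ≤ d) (x : gasket p) :
    |baryExtension p z c x - c z| ≤ N * d := by
  have e : baryExtension p z c x - c z = ∑ j, (c j - c z) * bary p j x := by
    simp [baryExtension]
  have hd : 0 ≤ d := (abs_nonneg _).trans (hc z z)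
  rw [e]
  refine (Finset.abs_sum_le_sum_abs _ _).trans ((Finset.sum_le_card_nsmul _ _ d
    fun j _ => ?_).trans_eq (by simp))
  obtain ⟨h0, h1⟩ := bary_bounds hp j x.2
  rw [abs_mul, abs_of_nonneg h0]
  nlinarith [hc j z, norm_nonneg ((x : E) - p j), abs_nonneg (c j - c z)]

/-- Start from the affine extension and repeatedly put, in each cell, the previous extension of the
harmonic values at its corners. Symmetry of `harmonicStep` makes the pieces fit together. -/
theorem exists_harmonic_approximation [ProperSpace E] (hp : ∀ i j, i ≠ j → ‖p i - p j‖ = 1) (z : Fin N) :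
    ∃ h : ℕ → (Fin N → ℝ) → C(gasket p, ℝ), h 0 = baryExtension p z ∧
      (∀ n c j, h n c (vertex p j) = c j) ∧
      ∀ n c i x, h (n + 1) c (cellMap p i x) = h n (harmonicStep c i) x := by
  have hstep : ∀ k : {k : (Fin N → ℝ) → C(gasket p, ℝ) // ∀ c j, k c (vertex p j) = c j},
      ∃ k' : {k : (Fin N → ℝ) → C(gasket p, ℝ) // ∀ c j, k c (vertex p j) = c j},
        ∀ c i x, k'.1 c (cellMap p i x) = k.1 (harmonicStep c i) x := by
    rintro ⟨k, hk⟩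
    choose k' hk' using fun c => exists_glue hp (fun i => k (harmonicStep c i)) fun i j => by
      rw [hk, hk, harmonicStep_comm]
    refine ⟨⟨k', fun c j => ?_⟩, hk'⟩
    rw [← cellMap_vertex j, hk', hk, harmonicStep_self]
  choose T hT using hstep
  refine ⟨fun n => (T^[n] ⟨baryExtension p z, baryExtension_vertex hp z⟩).1, rfl,
    fun n => (T^[n] _).2, fun n c i x => ?_⟩
  change (T^[n + 1] _).1 c (cellMap p i x) = _
  rw [Function.iterate_succ_apply', hT]

theorem exists_harmonic [ProperSpace E] (hp : ∀ i j, i ≠ j → ‖p i - p j‖ = 1) (hN : 0 < N) :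
    ∃ h : (Fin N → ℝ) → C(gasket p, ℝ), (∀ c j, h c (vertex p j) = c j) ∧
      ∀ c i x, h c (cellMap p i x) = h (harmonicStep c i) x := by
  set z : Fin N := ⟨0, hN⟩
  obtain ⟨h, h0, hv, hs⟩ := exists_harmonic_approximation hp z
  set ρ : ℝ := (N : ℝ) / (N + 2) with hρ
  have hρ0 : 0 ≤ ρ := by positivity
  have hρ1 : ρ < 1 := by rw [hρ, div_lt_one (by positivity)]; linarith
  -- Each refinement shrinks the oscillation of the data by ρ. For n = 0 the constant 2N + 2
  -- collects N d from each of two affine extensions and d from each of two differences of reference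
  -- values.
  have key : ∀ (n : ℕ) (c : Fin N → ℝ) (d : ℝ), (∀ j k, |c j - c k| ≤ d) → ∀ x,
      |h (n + 1) c x - h n c x| ≤ (2 * N + 2) * d * ρ ^ n := by
    intro n
    induction n with
    | zero =>
      intro c d hc x
      have hd : 0 ≤ d := (abs_nonneg _).trans (hc z z)
      obtain ⟨i, y, rfl⟩ := exists_cellMap_eq x
      rw [hs, h0]
      have h1 := abs_baryExtension_sub_le hp z hc (cellMap p i y)
      have h2 := abs_baryExtension_sub_le hp z (abs_harmonicStep_sub_le hc i) y
      have h3 := abs_harmonicStep_sub_le hc i z i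
      rw [harmonicStep_self] at h3
      have h4 := hc i z
      have h5 : N / (N + 2) * d ≤ d := mul_le_of_le_one_left hd hρ1.le
      have h6 : (N : ℝ) * (N / (N + 2) * d) ≤ N * d := by gcongr
      rw [pow_zero, mul_one]
      rw [abs_le] at *
      constructor <;> linarith [h1.1, h1.2, h2.1, h2.2, h3.1, h3.2, h4.1, h4.2]
    | succ n ih =>
      intro c d hc x
      obtain ⟨i, y, rfl⟩ := exists_cellMap_eq x
      rw [hs, hs]
      refine (ih _ _ (abs_harmonicStep_sub_le hc i) y).trans_eq ?_
      rw [pow_succ]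
      ring
  have hcau : ∀ c, CauchySeq fun n => h n c := by
    intro c
    have hc : ∀ j k, |c j - c k| ≤ 2 * ∑ l, |c l| := by
      intro j k
      have hj := Finset.single_le_sum (f := fun l => |c l|) (fun l _ => abs_nonneg _)
        (Finset.mem_univ j)
      have hk := Finset.single_le_sum (f := fun l => |c l|) (fun l _ => abs_nonneg _)
        (Finset.mem_univ k)
      linarith [abs_sub (c j) (c k)]
    refine cauchySeq_of_le_geometric ρ ((2 * N + 2) * (2 * ∑ l, |c l|)) hρ1 fun n => ?_
    have : 0 ≤ ∑ l, |c l| := Finset.sum_nonneg fun l _ => abs_nonneg _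
    refine (ContinuousMap.dist_le (by positivity)).2 fun x => ?_
    rw [dist_comm, Real.dist_eq]
    exact key n c _ hc x
  choose H hH using fun c => cauchySeq_tendsto_of_complete (hcau c)
  have hHx : ∀ c x, Tendsto (fun n => h n c x) atTop (𝓝 (H c x)) := fun c x =>
    ((continuous_eval_const x).tendsto (H c)).comp (hH c)
  refine ⟨H, fun c j => ?_, fun c i x => ?_⟩
  · refine tendsto_nhds_unique (hHx c _) ?_
    simp only [hv]
    exact tendsto_const_nhds
  · refine tendsto_nhds_unique ((tendsto_add_atTop_iff_nat 1).2 (hHx c (cellMap p i x))) ?_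
    simp only [hs]
    exact hHx _ x

theorem levelEnergy_harmonic (hp : ∀ i j, i ≠ j → ‖p i - p j‖ = 1) (hN : 0 < N)
    {h : (Fin N → ℝ) → C(gasket p, ℝ)} (hv : ∀ c j, h c (vertex p j) = c j)
    (hs : ∀ c i x, h c (cellMap p i x) = h (harmonicStep c i) x) (m : ℕ) (c : Fin N → ℝ) :
    levelEnergy p m (h c) = 1 / 2 * ∑ i, ∑ j, (c i - c j) ^ 2 := by
  induction m generalizing c with
  | zero => simp only [levelEnergy_zero hp, hv]
  | succ m ih =>
    rw [levelEnergy_succ hp]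
    simp only [hs, ih]
    rw [sum_sub_sq_eq_harmonicStep hN, ← Finset.mul_sum]
    ring

/-- The constant relating the oscillation of a spline on a cell to that of its data. -/
def splineConst (N : ℕ) : ℝ := 2 * N / (1 - √((N : ℝ) / (N + 2)))

theorem splineConst_nonneg (N : ℕ) : 0 ≤ splineConst N :=
  div_nonneg (by positivity) (sub_pos.2 (sqrt_ratio_lt_one N)).le

/-- The spline is harmonic on each cell of level m with the vertex values of f. In the base case the
energy is at most (N d)² / 2, and the oscillation bound then produces `splineConst`. -/
theorem exists_spline [ProperSpace E] (hp : ∀ i j, i ≠ j → ‖p i - p j‖ = 1) (hN : 0 < N) (m : ℕ) {d : ℝ}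
    (f : C(gasket p, ℝ)) (hf : ∀ w, w.length = m → ∀ j k,
      |f (cellWord p w (vertex p j)) - f (cellWord p w (vertex p k))| ≤ d) :
    ∃ g : C(gasket p, ℝ), (∃ C, ∀ n, levelEnergy p n g ≤ C) ∧
      (∀ j, g (vertex p j) = f (vertex p j)) ∧ ∀ w, w.length = m → ∀ j x,
        |g (cellWord p w x) - f (cellWord p w (vertex p j))| ≤ splineConst N * d := by
  induction m generalizing f with
  | zero =>
    obtain ⟨h, hv, hs⟩ := exists_harmonic hp hN
    set c : Fin N → ℝ := fun j => f (vertex p j)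
    have hE := fun m => (levelEnergy_harmonic hp hN hv hs m c).le
    have hf0 : ∀ j k, |c j - c k| ≤ d := hf [] rfl
    have hd : 0 ≤ d := (abs_nonneg _).trans (hf0 ⟨0, hN⟩ ⟨0, hN⟩)
    have hsum : 2 * (1 / 2 * ∑ i, ∑ j, (c i - c j) ^ 2) ≤ (N * d) ^ 2 := by
      have h1 : ∑ i, ∑ j, (c i - c j) ^ 2 ≤ ∑ _ : Fin N, ∑ _ : Fin N, d ^ 2 :=
        Finset.sum_le_sum fun i _ => Finset.sum_le_sum fun j _ => sq_le_sq' (by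
          linarith [(abs_le.1 (hf0 i j)).1]) (abs_le.1 (hf0 i j)).2
      simp only [Finset.sum_const, Finset.card_univ, Fintype.card_fin, nsmul_eq_mul] at h1
      linarith
    refine ⟨h c, ⟨_, hE⟩, fun j => hv c j, fun w hw j x => ?_⟩
    rw [List.length_eq_zero_iff] at hw
    subst hw
    have h1 := abs_sub_le_oscBound hp hN (h c).continuous hE [] x (vertex p j)
    simp only [cellWord, id] at h1 ⊢
    rw [hv] at h1
    refine h1.trans ?_
    have hr1 : 0 < 1 - √((N : ℝ) / (N + 2)) := sub_pos.2 (sqrt_ratio_lt_one N)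
    unfold oscBound splineConst
    have hsq := Real.sqrt_le_iff.2 ⟨by positivity, hsum⟩
    rw [List.length_nil, pow_zero, one_mul]
    calc _ ≤ 2 * (N * d / (1 - √((N : ℝ) / (N + 2)))) := by gcongr
      _ = _ := by ring
  | succ m ih =>
    have hcell : ∀ i, ∃ g : C(gasket p, ℝ), (∃ C, ∀ n, levelEnergy p n g ≤ C) ∧
        (∀ j, g (vertex p j) = f (cellMap p i (vertex p j))) ∧ ∀ w, w.length = m → ∀ j x,
          |g (cellWord p w x) - f (cellMap p i (cellWord p w (vertex p j)))| ≤
            splineConst N * d := fun i =>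
      ih (f.comp ⟨cellMap p i, continuous_cellMap i⟩) fun w hw j k =>
        hf (i :: w) (by rw [List.length_cons, hw]) j k
    choose g hgC hgv hgw using hcell
    choose C hC using hgC
    obtain ⟨G, hG⟩ := exists_glue hp g fun i j => by rw [hgv, hgv, cellMap_vertex_comm]
    refine ⟨G, ⟨((N : ℝ) + 2) / N * ∑ i, C i, fun n => ?_⟩, fun j => ?_, fun w hw j x => ?_⟩
    · refine (levelEnergy_mono hp hN G (Nat.le_succ n)).trans ?_
      simp only [Nat.succ_eq_add_one]
      rw [levelEnergy_succ hp]
      simp only [hG]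
      exact mul_le_mul_of_nonneg_left (Finset.sum_le_sum fun i _ => hC i n) (by positivity)
    · rw [← cellMap_vertex j, hG, hgv]
    · obtain ⟨i, v, rfl⟩ := List.exists_cons_of_length_eq_add_one hw
      simp only [cellWord, Function.comp_apply, hG]
      exact hgw i v (by simpa using hw) j x

/-- Functions of finite energy with prescribed boundary values are uniformly dense. -/
theorem exists_H1_approximation [ProperSpace E] (hp : ∀ i j, i ≠ j → ‖p i - p j‖ = 1) (hN : 0 < N)
    (f : C(gasket p, ℝ)) {ε : ℝ} (hε : 0 < ε) :
    ∃ g ∈ H1 p, (∀ j, g (vertex p j) = f (vertex p j)) ∧ ∀ x, |g x - f x| ≤ ε := by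
  have hM := splineConst_nonneg N
  set d : ℝ := ε / (splineConst N + 1) with hd
  have hd0 : 0 < d := by positivity
  obtain ⟨δ, hδ, hfδ⟩ := Metric.uniformContinuous_iff.1
    (CompactSpace.uniformContinuous_of_continuous f.continuous) d hd0
  obtain ⟨D, hD⟩ : ∃ D, ∀ x y : gasket p, dist x y ≤ D := by
    obtain ⟨D, hD⟩ := Metric.isBounded_iff.1 (isCompact_univ (X := gasket p)).isBounded
    exact ⟨D, fun x y => hD (Set.mem_univ x) (Set.mem_univ y)⟩
  obtain ⟨m, hm⟩ : ∃ m : ℕ, (1 / 2 : ℝ) ^ m * D < δ := by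
    have h1 := (tendsto_pow_atTop_nhds_zero_of_lt_one (r := (1 / 2 : ℝ)) (by norm_num)
      (by norm_num)).mul_const D
    rw [zero_mul] at h1
    exact (h1.eventually_lt_const hδ).exists
  have hcell : ∀ w, w.length = m → ∀ x y, |f (cellWord p w x) - f (cellWord p w y)| ≤ d := by
    intro w hw x y
    have h1 : dist (cellWord p w x) (cellWord p w y) < δ := by
      rw [dist_cellWord, hw]
      exact (mul_le_mul_of_nonneg_left (hD x y) (by positivity)).trans_lt hm
    have := hfδ h1
    rw [Real.dist_eq] at this
    exact this.le
  obtain ⟨g, ⟨C, hC⟩, hgv, hgw⟩ := exists_spline hp hN m f fun w hw j k => hcell w hw _ _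
  have hC0 : 0 ≤ C := (levelEnergy_nonneg 0 _).trans (hC 0)
  refine ⟨g, ((energy_le_ofReal_iff hp hN hC0).2 hC).trans_lt ENNReal.ofReal_lt_top, hgv,
    fun x => ?_⟩
  obtain ⟨w, y, hw, rfl⟩ := exists_cellWord_eq m x
  have h1 := hgw w hw ⟨0, hN⟩ y
  have h2 := hcell w hw (vertex p ⟨0, hN⟩) y
  have h3 := abs_sub_le (g (cellWord p w y)) (f (cellWord p w (vertex p ⟨0, hN⟩)))
    (f (cellWord p w y))
  have h4 : splineConst N * d + d = ε := by rw [hd]; field_simp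
  linarith

/-! ### Density of the domain -/

theorem isClosed_boundary : IsClosed (boundary p) := (Set.finite_range _).isClosed

theorem exists_H1_sequence [ProperSpace E] (hp : ∀ i j, i ≠ j → ‖p i - p j‖ = 1) (hN : 0 < N)
    (f : C(gasket p, ℝ)) : ∃ g : ℕ → C(gasket p, ℝ), (∀ n, g n ∈ H1 p) ∧
      (∀ n i, g n (vertex p i) = 0) ∧ (∀ n x, |g n x| ≤ |f x| + 1) ∧
      ∀ x ∉ boundary p, Tendsto (fun n => g n x) atTop (𝓝 (f x)) := by
  -- The cut-off vanishes on V₀ and is eventually 1 at each other point. As the approximation keeps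
  -- vertex values exactly, it vanishes on V₀ too.
  set χ : ℕ → gasket p → ℝ := fun n x => min 1 (n * Metric.infDist x (boundary p)) with hχ
  have hχ0 : ∀ n x, 0 ≤ χ n x := fun n x =>
    le_min zero_le_one (mul_nonneg n.cast_nonneg Metric.infDist_nonneg)
  have hχ1 : ∀ n x, χ n x ≤ 1 := fun n x => min_le_left _ _
  have hχc : ∀ n, Continuous (χ n) := fun n =>
    continuous_const.min (continuous_const.mul (Metric.continuous_infDist_pt _))
  have hex : ∀ n : ℕ, ∃ g ∈ H1 p, (∀ j, g (vertex p j) = f (vertex p j) * χ n (vertex p j)) ∧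
      ∀ x, |g x - f x * χ n x| ≤ 1 / ((n : ℝ) + 1) := fun n =>
    exists_H1_approximation hp hN ⟨fun x => f x * χ n x, f.continuous.mul (hχc n)⟩ (by positivity)
  choose g hgH hgv hgx using hex
  refine ⟨g, hgH, fun n i => ?_, fun n x => ?_, fun x hx => ?_⟩
  · have : Metric.infDist (vertex p i) (boundary p) = 0 := Metric.infDist_zero_of_mem ⟨i, rfl⟩
    rw [hgv]
    simp [hχ, this]
  · have h1 : |f x * χ n x| ≤ |f x| := by
      rw [abs_mul, abs_of_nonneg (hχ0 n x)]
      exact mul_le_of_le_one_right (abs_nonneg _) (hχ1 n x)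
    have h2 : 1 / ((n : ℝ) + 1) ≤ 1 := by
      rw [div_le_one (by positivity)]
      linarith [Nat.cast_nonneg (α := ℝ) n]
    have h3 := abs_sub_abs_le_abs_sub (g n x) (f x * χ n x)
    linarith [hgx n x]
  · have hpos : 0 < Metric.infDist x (boundary p) :=
      (isClosed_boundary.notMem_iff_infDist_pos ⟨_, Set.mem_range_self ⟨0, hN⟩⟩).1 hx
    have h1 : Tendsto (fun n => f x * χ n x) atTop (𝓝 (f x)) := by
      refine tendsto_const_nhds.congr' ?_
      have := (tendsto_natCast_atTop_atTop (R := ℝ)).atTop_mul_const hpos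
      filter_upwards [this.eventually_ge_atTop 1] with n hn
      rw [hχ]
      simp only
      rw [min_eq_left hn, mul_one]
    have h2 : Tendsto (fun n => g n x - f x * χ n x) atTop (𝓝 0) :=
      squeeze_zero_norm (fun n => hgx n x) tendsto_one_div_add_atTop_nhds_zero_nat
    simpa using h2.add h1

/-- Continuous functions are dense in L², and each is the L² limit of functions of finite energy
vanishing on V₀, by dominated convergence and μ(V₀) = 0. The vanishing gives finite energy whatever
values the B_i take away from 0. -/
theorem dense_perturbedEnergy_ne_top [ProperSpace E] [MeasurableSpace E] [BorelSpace E]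
    {μ : Measure (gasket p)} [IsFiniteMeasure μ] [μ.IsOpenPosMeasure]
    (hp : ∀ i j, i ≠ j → ‖p i - p j‖ = 1) (hN : 0 < N) (hμ : μ (boundary p) = 0)
    {B : Fin N → ℝ → ℝ≥0∞} (hB : ∀ i, B i 0 = 0) :
    Dense {u : Lp ℝ 2 μ | perturbedEnergy p μ B u ≠ ⊤} := by
  have hd := ContinuousMap.toLp_denseRange (p := 2) ℝ μ ℝ (by norm_num)
  refine fun u => closure_minimal ?_ isClosed_closure (hd u)
  rintro _ ⟨f, rfl⟩
  obtain ⟨g, hgH, hgv, hgb, hgf⟩ := exists_H1_sequence hp hN f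
  set T : C(gasket p, ℝ) →L[ℝ] Lp ℝ 2 μ := ContinuousMap.toLp 2 μ ℝ
  refine mem_closure_of_tendsto (f := fun n => T (g n)) (b := atTop) ?_
    (Eventually.of_forall fun n => (perturbedEnergy_lt_top_of B (hgH n)
      (ContinuousMap.coeFn_toLp μ (g n)) fun i => by rw [hgv, hB]).ne)
  obtain ⟨M, hM⟩ := isCompact_univ.exists_bound_of_continuousOn f.continuous.continuousOn
  have hM' : ∀ x, |f x| ≤ M := fun x => hM x (Set.mem_univ x)
  have h_int : Tendsto (fun n => ∫ x, (g n x - f x) ^ 2 ∂μ) atTop (𝓝 (∫ _, (0 : ℝ) ∂μ)) := by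
    refine tendsto_integral_of_dominated_convergence (fun _ => (2 * M + 1) ^ 2)
      (fun n => (((g n).continuous.sub f.continuous).pow 2).aestronglyMeasurable)
      (integrable_const _) (fun n => Eventually.of_forall fun x => ?_) ?_
    · rw [norm_pow, Real.norm_eq_abs]
      gcongr
      linarith [abs_sub (g n x) (f x), hgb n x, hM' x]
    · filter_upwards [compl_mem_ae_iff.2 hμ] with x hx
      simpa using ((hgf x hx).sub_const (f x)).pow 2
  rw [integral_zero] at h_int
  have hsq : Tendsto (fun n => ‖T (g n) - T f‖ ^ 2) atTop (𝓝 0) := by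
    refine h_int.congr fun n => ?_
    rw [← map_sub, norm_sq_eq_integral]
    refine integral_congr_ae ?_
    filter_upwards [ContinuousMap.coeFn_toLp (p := 2) (𝕜 := ℝ) μ (g n - f)] with x hx
    rw [hx, ContinuousMap.sub_apply]
  have := hsq.sqrt
  simp only [Real.sqrt_sq (norm_nonneg _), Real.sqrt_zero] at this
  exact tendsto_iff_norm_sub_tendsto_zero.2 this

theorem isConvexEnergy_perturbedEnergy [ProperSpace E] [MeasurableSpace E] [BorelSpace E]
    {μ : Measure (gasket p)} [IsFiniteMeasure μ] [μ.IsOpenPosMeasure]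
    (hp : ∀ i j, i ≠ j → ‖p i - p j‖ = 1) (hN : 0 < N) (hμ : μ (boundary p) = 0)
    {B : Fin N → ℝ → ℝ≥0∞} (hlsc : ∀ i, LowerSemicontinuous (B i)) (hB : ∀ i, B i 0 = 0)
    (hconv : ConvexOn ℝ≥0 Set.univ (perturbedEnergy p μ B)) :
    IsConvexEnergy (perturbedEnergy p μ B) :=
  ⟨hconv, lowerSemicontinuous_perturbedEnergy hp hN hlsc,
    dense_perturbedEnergy_ne_top hp hN hμ hB⟩

/-! ### Boundary functionals -/

theorem lowerSemicontinuous_indicator_zero :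
    LowerSemicontinuous fun s : ℝ => open Classical in if s = 0 then (0 : ℝ≥0∞) else ⊤ := by
  classical
  intro s y hy
  rcases eq_or_ne s 0 with rfl | hs
  · simp at hy
  · filter_upwards [isOpen_ne.mem_nhds hs] with t ht
    have ht : t ≠ 0 := ht
    simp only [ht, hs, if_false] at hy ⊢
    exact hy

theorem indicator_zero_combo_le (a b : ℝ≥0) (s t : ℝ) (hab : a + b = 1) :
    (open Classical in if a * s + b * t = 0 then (0 : ℝ≥0∞) else ⊤) ≤
      a * (open Classical in if s = 0 then (0 : ℝ≥0∞) else ⊤) +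
        b * (open Classical in if t = 0 then (0 : ℝ≥0∞) else ⊤) := by
  classical
  rcases eq_or_ne a 0 with rfl | ha
  · rw [zero_add] at hab
    simp [hab]
  rcases eq_or_ne b 0 with rfl | hb
  · rw [add_zero] at hab
    simp [hab]
  rcases eq_or_ne s 0 with rfl | hs
  · rcases eq_or_ne t 0 with rfl | ht
    · simp
    · simp [ht, ENNReal.mul_top, hb]
  · simp [hs, ENNReal.mul_top, ha]

/-- Clipping to [-t, t] moves s towards 0 without crossing it. -/
theorem BiMonotone.truncation_le {f : ℝ → ℝ≥0∞} (hf : BiMonotone f) (s : ℝ) {t : ℝ} (ht : 0 ≤ t) :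
    f ((s ⊓ t) ⊔ -t) ≤ f s := by
  rcases truncation_cases (a := s) ht with ⟨_, _, e, _⟩ | ⟨h, e, _⟩ | ⟨h, e, _⟩ <;> rw [e]
  · exact hf.2 ht (ht.trans h) h
  · exact hf.1 (Set.mem_Iic.2 (by linarith)) (Set.mem_Iic.2 (by linarith)) h

end Splines

end Sierpinski

end

/-! ### Proof of the corollary -/

theorem corollary4p1 (N : ℕ) (hN : 2 ≤ N) (p : Fin N → EuclideanSpace ℝ (Fin (N - 1)))
    (hp : ∀ i j, i ≠ j → ‖p i - p j‖ = 1)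
    (μ : Measure (Sierpinski.gasket p)) [IsFiniteMeasure μ] [μ.IsOpenPosMeasure]
    (hμ : μ (Sierpinski.boundary p) = 0)
    (B : Fin N → ℝ → ℝ≥0∞)
    (hlsc : ∀ i, LowerSemicontinuous (B i))
    (hmono : ∀ i, Sierpinski.BiMonotone (B i))
    (hnorm : ∀ i, B i 0 = 0)
    (hconv : ConvexOn ℝ≥0 Set.univ (Sierpinski.perturbedEnergy p μ B)) :
    (∃! S, Sierpinski.Generates (Sierpinski.perturbedEnergy p μ B) S) ∧
    (∃! S, Sierpinski.Generates (Sierpinski.neumannEnergy p μ) S) ∧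
    (∃! S, Sierpinski.Generates (Sierpinski.dirichletEnergy p μ) S) ∧
    ∀ S_B S S_inf : Sierpinski.ContractionSemigroup (Lp ℝ 2 μ),
      Sierpinski.Generates (Sierpinski.perturbedEnergy p μ B) S_B →
      Sierpinski.Generates (Sierpinski.neumannEnergy p μ) S →
      Sierpinski.Generates (Sierpinski.dirichletEnergy p μ) S_inf →
      Sierpinski.IsPositive S_B ∧ Sierpinski.OrderPreserving S_B ∧
      Sierpinski.TotallyDominatedBy S_inf S_B ∧ Sierpinski.TotallyDominatedBy S_B S := by
  classical
  have hN0 : 0 < N := by omega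
  have hWB := Sierpinski.isConvexEnergy_perturbedEnergy hp hN0 hμ hlsc hnorm hconv
  have hW0 : Sierpinski.IsConvexEnergy (Sierpinski.neumannEnergy p μ) :=
    Sierpinski.isConvexEnergy_perturbedEnergy hp hN0 hμ (fun _ => lowerSemicontinuous_const)
      (fun _ => rfl) (Sierpinski.convexOn_perturbedEnergy hp hN0 fun _ _ _ _ _ _ => by simp)
  have hWi : Sierpinski.IsConvexEnergy (Sierpinski.dirichletEnergy p μ) :=
    Sierpinski.isConvexEnergy_perturbedEnergy hp hN0 hμ
      (fun _ => Sierpinski.lowerSemicontinuous_indicator_zero) (fun _ => by simp)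
      (Sierpinski.convexOn_perturbedEnergy hp hN0 fun _ => Sierpinski.indicator_zero_combo_le)
  refine ⟨hWB.existsUnique_generates, hW0.existsUnique_generates, hWi.existsUnique_generates,
    fun S_B S S_inf hB hS hi => ?_⟩
  rw [hB.toFun_eq_flow hWB, hS.toFun_eq_flow hW0, hi.toFun_eq_flow hWi]
  have hsub := Sierpinski.perturbedEnergy_inf_add_sup_le (μ := μ) hp hN0 B
  have h0 : Sierpinski.perturbedEnergy p μ B 0 = 0 := Sierpinski.perturbedEnergy_zero hp hN0 hnorm
  -- For s = 0 the exchange changes nothing, and for s ≠ 0 the right side is infinite. Leaving `A`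
  -- arbitrary covers both B and its reflection.
  have hinf : ∀ (A : Fin N → ℝ → ℝ≥0∞) (i : Fin N) (s t : ℝ), 0 ≤ t →
      (if (s ⊓ t) ⊔ -t = 0 then (0 : ℝ≥0∞) else ⊤) + A i (|s| ⊔ t) ≤
        (if s = 0 then (0 : ℝ≥0∞) else ⊤) + A i t := by
    intro A i s t ht
    rcases eq_or_ne s 0 with rfl | hs
    · have e1 : ((0 : ℝ) ⊓ t) ⊔ -t = 0 := by
        rw [inf_eq_left.2 ht, sup_eq_left.2 (by linarith)]
      have e2 : |(0 : ℝ)| ⊔ t = t := by rw [abs_zero, sup_eq_right.2 ht]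
      rw [e1, e2]
    · simp [hs]
  refine ⟨hWB.flow_isPositive h0 hsub, hWB.flow_orderPreserving hsub,
    hWi.flow_totallyDominatedBy hWB h0 hsub ?_ ?_,
    hWB.flow_totallyDominatedBy hW0 (Sierpinski.perturbedEnergy_zero hp hN0 fun _ => rfl)
      (Sierpinski.perturbedEnergy_inf_add_sup_le hp hN0 _) ?_ ?_⟩
  · exact Sierpinski.perturbedEnergy_truncation_le hp hN0 (hinf B)
  · intro a b hb
    -- The reflected energy is the perturbed energy of s ↦ B_i(-s), so the same truncation lemma
    -- applies.
    rw [← Sierpinski.perturbedEnergy_comp_neg hp hN0, ← Sierpinski.perturbedEnergy_comp_neg hp hN0]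
    exact Sierpinski.perturbedEnergy_truncation_le hp hN0 (hinf fun i s => B i (-s)) a b hb
  · exact Sierpinski.perturbedEnergy_truncation_le hp hN0 fun i s t ht => by
      simpa using (hmono i).truncation_le s ht
  · intro a b hb
    unfold Sierpinski.neumannEnergy
    rw [← Sierpinski.perturbedEnergy_comp_neg hp hN0, ← Sierpinski.perturbedEnergy_comp_neg hp hN0]
    exact Sierpinski.perturbedEnergy_truncation_le hp hN0 (fun i s t ht => by
      simpa using (hmono i).truncation_le s ht) a b hb
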